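/- Let $d\ge 2$, $\rho,r,\nu>0$, and let $\{x^\omega_m\}_m$, $\omega\in\Omega$, be a (locally finite) Poisson point process on $\mathbb R^d$ with intensity $\nu$ over a probability space $(\Omega,\mathcal F,\mathbb P)$. For $N\in\mathbb N$, $N\ge 1$, let $\Lambda_N=(-L_N/2,L_N/2)^d$ with $L_N=\rho^{-1/d}N^{1/d}$, let $\Lambda_N^\omega=\Lambda_N\setminus\bigcup_m \overline{B}_r(x_m^\omega)$ be the vacancy set, and for $\eta>0$ let $\Omega_N^{(1),\eta}=\{\omega:\ \big||\Lambda_N^\omega|/|\Lambda_N|-e^{-\nu\omega_d r^d}\big|<\eta\}$, where $\omega_d$ is the volume of the unit ball of $\mathbb R^d$. Let $v_N\in (L^1\cap L^\infty)(\mathbb R^d)$ be real-valued, nonnegative and even, with nonnegative Fourier transform $\widehat v_N\in L^1(\mathbb R^d)$. Let $0<\eta<e^{-\nu\omega_d r^d}$, $N\ge 1$, $\omega\in\Omega_N^{(1),\eta}$, and let $\Lambda$ be a connected component of $\Lambda_N^\omega$. For $\psi\in H^1_0(\Lambda)$ (complex-valued) put $$\mathcal E[\psi]=\int_\Lambda|\nabla\psi|^2\,dx+\frac{N-1}{2}\int_\Lambda\int_\Lambda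 v_N(x-y)|\psi(x)|^2|\psi(y)|^2\,dx\,dy ,$$ and for $u\in H_0^1(\Lambda)$, extended by zero, let $h^{u}$ be the self-adjoint operator on $L^2(\Lambda)$ with form domain $H^1_0(\Lambda)$ given in the form sense by $$h^{u}=-\Delta+(N-1)(|u|^2*v_N)-\frac{N-1}{2}\int_{\Lambda_N^\omega}\int_{\Lambda_N^\omega}v_N(x-y)|u(x)|^2|u(y)|^2\,dx\,dy .$$ Then there is a $u\in H^1_0(\Lambda)$ with $\|u\|_2=1$, real-valued and positive almost everywhere on $\Lambda$, such that $$\mathcal E[u]=\varepsilon:=\min\{\mathcal E[\psi]:\psi\in H^1_0(\Lambda),\ \|\psi\|_2=1\}\ge 0 ,$$ and every normalized $w\in H_0^1(\Lambda)$ with $\mathcal E[w]=\varepsilon$ equals $cu$ almost everywhere on $\Lambda$ for some $c\in\mathbb C$ with $|c|=1$. Moreover, $u$ and $\varepsilon$ are the ground state and the ground-state energy of $h^{u}$: $$h^{u}u=\varepsilon u,\qquad \min\{\langle\psi,h^{u}\psi\rangle:\psi\in H^1_0(\Lambda),\ \|\psi\|_2=1\}=\varepsilon ,$$ and every normalized $w$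 in the domain of $h^{u}$ with $h^{u}w=\varepsilon w$ equals $cu$ almost everywhere on $\Lambda$ for some $c\in\mathbb C$ with $|c|=1$. -/

import Mathlib

open MeasureTheory ProbabilityTheory Filter Topology Set
open scoped FourierTransform ComplexConjugate

noncomputable section

/-! ### The random vacancy set -/

/-- `X` is a (simple, locally finite) Poisson point process on `ℝ^d` with constant intensity `ν`:
a random locally finite set of points whose numbers of points in disjoint Borel sets are
independent, the number of points in `B` being Poisson distributed with mean `ν |B|`. -/
structure IsPoissonProcess {Ω : Type*} [MeasurableSpace Ω] (P : Measure Ω) {d : ℕ}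
    (X : Ω → Set (EuclideanSpace ℝ (Fin d))) (ν : ℝ) : Prop where
  locallyFinite : ∀ (ω : Ω) (B : Set (EuclideanSpace ℝ (Fin d))),
    Bornology.IsBounded B → (X ω ∩ B).Finite
  measurable_count : ∀ B : Set (EuclideanSpace ℝ (Fin d)), MeasurableSet B →
    Measurable fun ω => (X ω ∩ B).encard
  count_law : ∀ B : Set (EuclideanSpace ℝ (Fin d)), MeasurableSet B → volume B ≠ ⊤ → ∀ k : ℕ,
    P {ω | (X ω ∩ B).encard = k} =
      ENNReal.ofReal (Real.exp (-(ν * volume.real B)) * (ν * volume.real B) ^ k / k.factorial)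
  indep : ∀ (n : ℕ) (B : Fin n → Set (EuclideanSpace ℝ (Fin d))), (∀ i, MeasurableSet (B i)) →
    Pairwise (fun i j => Disjoint (B i) (B j)) →
    iIndepFun (fun i ω => (X ω ∩ B i).encard) P

/-- The side length `L_N = ρ^{-1/d} N^{1/d}`. -/
def sideLength (d : ℕ) (ρ : ℝ) (N : ℕ) : ℝ :=
  ρ ^ (-(1 / (d : ℝ))) * (N : ℝ) ^ (1 / (d : ℝ))

/-- The open box `Λ_N = (-L_N/2, L_N/2)^d`. -/
def box (d : ℕ) (ρ : ℝ) (N : ℕ) : Set (EuclideanSpace ℝ (Fin d)) :=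
  {x | ∀ i, x i ∈ Ioo (-(sideLength d ρ N / 2)) (sideLength d ρ N / 2)}

/-- The vacancy set: the box without the (closed) balls of radius `r` around the points of `S`. -/
def vacancySet {d : ℕ} (ρ r : ℝ) (N : ℕ) (S : Set (EuclideanSpace ℝ (Fin d))) :
    Set (EuclideanSpace ℝ (Fin d)) :=
  box d ρ N \ ⋃ x ∈ S, Metric.closedBall x r

/-- `e^{-ν ω_d r^d}`, with `ω_d` the volume of the unit ball of `ℝ^d`. -/
def vacancyFraction (d : ℕ) (ν r : ℝ) : ℝ :=
  Real.exp (-(ν * volume.real (Metric.ball (0 : EuclideanSpace ℝ (Fin d)) 1) * r ^ d))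

/-- The event `Ω_N^{(1),η}` that `| |Λ_N^ω| / |Λ_N| - e^{-ν ω_d r^d} | < η`. -/
def volumeEvent {Ω : Type*} {d : ℕ} (X : Ω → Set (EuclideanSpace ℝ (Fin d)))
    (ρ r ν : ℝ) (N : ℕ) (η : ℝ) : Set Ω :=
  {ω | |volume.real (vacancySet ρ r N (X ω)) / volume.real (box d ρ N)
    - vacancyFraction d ν r| < η}

/-- `U` is a connected component of the set `A`. -/
def IsComponentOf {α : Type*} [TopologicalSpace α] (A U : Set α) : Prop :=
  ∃ x ∈ A, U = connectedComponentIn A x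

/-! ### The interaction -/

/-- `v` is in `L¹ ∩ L^∞`, nonnegative, even, and its Fourier transform is nonnegative and in `L¹`.
(The normalisation of the Fourier transform is irrelevant for these properties.) -/
structure IsInteraction {d : ℕ} (v : EuclideanSpace ℝ (Fin d) → ℝ) : Prop where
  memLp_one : MemLp v 1 volume
  memLp_top : MemLp v ⊤ volume
  nonneg : ∀ᵐ x, 0 ≤ v x
  even : ∀ᵐ x, v (-x) = v x
  fourier_nonneg : ∀ ξ, 0 ≤ (𝓕 (fun x => (v x : ℂ)) ξ).re ∧ (𝓕 (fun x => (v x : ℂ)) ξ).im = 0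
  fourier_integrable : Integrable (𝓕 (fun x => (v x : ℂ))) volume

/-! ### The Sobolev space `H¹₀(U)` of complex-valued functions

Elements are represented by functions on `ℝ^d` of which only the values almost everywhere on `U`
matter. -/

/-- `φ` is a `C_c^∞(U)` function. -/
def IsTestFun {d : ℕ} {F : Type*} [NormedAddCommGroup F] [NormedSpace ℝ F]
    (U : Set (EuclideanSpace ℝ (Fin d))) (φ : EuclideanSpace ℝ (Fin d) → F) : Prop :=
  ContDiff ℝ ((⊤ : ℕ∞) : WithTop ℕ∞) φ ∧ HasCompactSupport φ ∧ tsupport φ ⊆ U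

/-- The `i`-th partial derivative. -/
def partialDeriv {d : ℕ} {F : Type*} [NormedAddCommGroup F] [NormedSpace ℝ F] (i : Fin d)
    (φ : EuclideanSpace ℝ (Fin d) → F) (x : EuclideanSpace ℝ (Fin d)) : F :=
  fderiv ℝ φ x (EuclideanSpace.single i 1)

/-- The classical gradient of a complex-valued function. -/
def classicalGrad {d : ℕ} (φ : EuclideanSpace ℝ (Fin d) → ℂ) (x : EuclideanSpace ℝ (Fin d)) :
    EuclideanSpace ℂ (Fin d) :=
  WithLp.toLp 2 fun i => partialDeriv i φ x

/-- `G` is a square-integrable weak gradient of `ψ` on `U`. -/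
def HasWeakGrad {d : ℕ} (U : Set (EuclideanSpace ℝ (Fin d))) (ψ : EuclideanSpace ℝ (Fin d) → ℂ)
    (G : EuclideanSpace ℝ (Fin d) → EuclideanSpace ℂ (Fin d)) : Prop :=
  MemLp G 2 (volume.restrict U) ∧
    ∀ φ : EuclideanSpace ℝ (Fin d) → ℝ, IsTestFun U φ → ∀ i : Fin d,
      ∫ x in U, ψ x * ((partialDeriv i φ x : ℝ) : ℂ) = -∫ x in U, G x i * (φ x : ℂ)

/-- `ψ ∈ H¹(U)`. -/
def MemH1 {d : ℕ} (U : Set (EuclideanSpace ℝ (Fin d)))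
    (ψ : EuclideanSpace ℝ (Fin d) → ℂ) : Prop :=
  MemLp ψ 2 (volume.restrict U) ∧ ∃ G, HasWeakGrad U ψ G

open Classical in
/-- The weak gradient `∇ψ` on `U` of `ψ ∈ H¹(U)`; for open `U` it is unique almost everywhere
on `U`. -/
def weakGrad {d : ℕ} (U : Set (EuclideanSpace ℝ (Fin d))) (ψ : EuclideanSpace ℝ (Fin d) → ℂ) :
    EuclideanSpace ℝ (Fin d) → EuclideanSpace ℂ (Fin d) :=
  if h : ∃ G, HasWeakGrad U ψ G then h.choose else 0

/-- `ψ ∈ H¹₀(U)`: `ψ ∈ H¹(U)` is the limit in `H¹(U)` of a sequence in `C_c^∞(U)`. -/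
def MemH10 {d : ℕ} (U : Set (EuclideanSpace ℝ (Fin d)))
    (ψ : EuclideanSpace ℝ (Fin d) → ℂ) : Prop :=
  MemH1 U ψ ∧ ∃ φ : ℕ → EuclideanSpace ℝ (Fin d) → ℂ, (∀ n, IsTestFun U (φ n)) ∧
    Tendsto (fun n => eLpNorm (fun x => φ n x - ψ x) 2 (volume.restrict U)) atTop (𝓝 0) ∧
    Tendsto (fun n => eLpNorm (fun x => classicalGrad (φ n) x - weakGrad U ψ x) 2
      (volume.restrict U)) atTop (𝓝 0)

/-- `ψ ∈ H¹₀(U)` with `‖ψ‖_{L²(U)} = 1`. -/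
def IsNormalizedH10 {d : ℕ} (U : Set (EuclideanSpace ℝ (Fin d)))
    (ψ : EuclideanSpace ℝ (Fin d) → ℂ) : Prop :=
  MemH10 U ψ ∧ eLpNorm ψ 2 (volume.restrict U) = 1

/-! ### The Hartree functional and the mean-field operator -/

/-- `∫_A ∫_A v(x - y) |ψ(x)|² |ψ(y)|² dx dy`. -/
def interactionEnergy {d : ℕ} (A : Set (EuclideanSpace ℝ (Fin d)))
    (v : EuclideanSpace ℝ (Fin d) → ℝ) (ψ : EuclideanSpace ℝ (Fin d) → ℂ) : ℝ :=
  ∫ x in A, ∫ y in A, v (x - y) * ‖ψ x‖ ^ 2 * ‖ψ y‖ ^ 2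

/-- The Hartree functional
`∫_U |∇ψ|² + (N-1)/2 ∫_U ∫_U v(x - y) |ψ(x)|² |ψ(y)|² dx dy` on `H¹₀(U)`. -/
def hartree {d : ℕ} (U : Set (EuclideanSpace ℝ (Fin d))) (v : EuclideanSpace ℝ (Fin d) → ℝ)
    (N : ℕ) (ψ : EuclideanSpace ℝ (Fin d) → ℂ) : ℝ :=
  (∫ x in U, ‖weakGrad U ψ x‖ ^ 2) + ((N : ℝ) - 1) / 2 * interactionEnergy U v ψ

/-- The convolution `(|u|² * v)(x)` for a function `u` on `A` (extended by zero). -/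
def densityConv {d : ℕ} (A : Set (EuclideanSpace ℝ (Fin d)))
    (v : EuclideanSpace ℝ (Fin d) → ℝ) (u : EuclideanSpace ℝ (Fin d) → ℂ)
    (x : EuclideanSpace ℝ (Fin d)) : ℝ :=
  ∫ y in A, ‖u y‖ ^ 2 * v (x - y)

/-- The sesquilinear form `⟨φ, h ψ⟩` on `H¹₀(U)` of the mean-field operator
`h = -Δ + (N-1) (|u|² * v) - (N-1)/2 ∫_A ∫_A v(x - y) |u(x)|² |u(y)|² dx dy` on `L²(U)`
(Dirichlet boundary conditions), for a function `u` on `A ⊇ U`. -/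
def meanFieldForm {d : ℕ} (A U : Set (EuclideanSpace ℝ (Fin d)))
    (v : EuclideanSpace ℝ (Fin d) → ℝ) (N : ℕ) (u : EuclideanSpace ℝ (Fin d) → ℂ)
    (φ ψ : EuclideanSpace ℝ (Fin d) → ℂ) : ℂ :=
  (∫ x in U, inner ℂ (weakGrad U φ x) (weakGrad U ψ x))
    + ((N : ℂ) - 1) * (∫ x in U, (densityConv A v u x : ℂ) * (conj (φ x) * ψ x))
    - ((N : ℂ) - 1) / 2 * (interactionEnergy A v u : ℂ) * ∫ x in U, conj (φ x) * ψ x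

/-- The self-adjoint operator `h` on `L²(U)` associated with `meanFieldForm`, given by its graph:
`ψ` is in the operator domain and `h ψ = f`, that is, `ψ` is in the form domain, `f ∈ L²(U)`, and
`⟨φ, h ψ⟩ = ⟨φ, f⟩` for all `φ` in the form domain. -/
def MeanFieldOp {d : ℕ} (A U : Set (EuclideanSpace ℝ (Fin d)))
    (v : EuclideanSpace ℝ (Fin d) → ℝ) (N : ℕ) (u : EuclideanSpace ℝ (Fin d) → ℂ)
    (ψ f : EuclideanSpace ℝ (Fin d) → ℂ) : Prop :=
  MemH10 U ψ ∧ MemLp f 2 (volume.restrict U) ∧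
    ∀ φ, MemH10 U φ → meanFieldForm A U v N u φ ψ = ∫ x in U, conj (φ x) * f x

end

/-! ### Test functions -/

namespace IsTestFun

variable {d : ℕ} {F : Type*} [NormedAddCommGroup F] [NormedSpace ℝ F]
  {U : Set (EuclideanSpace ℝ (Fin d))} {φ χ : EuclideanSpace ℝ (Fin d) → F}

/-! Of the domain only four things matter: it is open, connected, nonempty and of finite volume. The
excluded balls form a locally finite family, so the vacancy set is open and bounded, and its
components inherit this.

`H¹₀(U)` is realised as the closure `sobolev U` of the pairs (test function, gradient) in the
Hilbert space `L² × L²`. A minimising sequence is bounded there. A Rellich theorem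
(`exists_tendsto_fst_of_bounded`) gives a subsequence converging in `L²`, along which the
interaction converges because the kernel is bounded, while the gradient term is lower semicontinuous
(`sobolev_lsc`). Passing to the modulus keeps the density and does not raise the gradient term, so a
minimiser `u ≥ 0` exists.

The gradient term is convex in the density: `∫|∇√(|φ|² + |χ|²)|² ≤ ∫|∇φ|² + ∫|∇χ|²`
(`exists_sqrt_mem_sobolev`). Moving the density from `|u|²` towards `|p|²` and differentiating at
the start gives `⟨p, h p⟩ ≥ ε` for normalized `p`, with equality at `p = u`
(`hartreeEnergy_le_meanField`). Thus `h - ε` is a nonnegative form with null vector `u`, and a null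
vector of a nonnegative form is form-orthogonal to everything, which is the eigenvalue equation.

Null vectors are handled without Harnack or regularity theory. If `u ≥ 0` is null and `χ` is a bump,
the functions `min(χ, k u)` have energy at most that of `χ`, so their limit `χ 1_{u ≠ 0}` lies in
`H¹₀`. An indicator function that is locally weakly differentiable has zero gradient, and
connectedness makes `u` vanish almost everywhere or almost nowhere (`null_vector_eq_zero_or_pos`).
Applied to `|f| + f`, this shows that a real null vector orthogonal to `u` is zero; the null space
is therefore spanned by `u` (`null_vector_eq_smul`).

Uniqueness for the Hartree functional comes from positive type. By Fourier inversion `v` agrees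
almost everywhere with a cosine integral of a nonnegative function, so `E[p] - ⟨p, h p⟩`, which is
the coupling constant times the interaction of `|p|² - |u|²` with itself, is nonnegative. Every
Hartree minimiser is thus a null vector of `h - ε` (`meanField_energy_le_hartree`). -/

theorem continuous (h : IsTestFun U φ) : Continuous φ := h.1.continuous

theorem differentiable (h : IsTestFun U φ) : Differentiable ℝ φ :=
  h.1.differentiable (by simp)

theorem continuous_fderiv (h : IsTestFun U φ) : Continuous (fderiv ℝ φ) :=
  h.1.continuous_fderiv (by simp)

theorem continuous_partialDeriv (h : IsTestFun U φ) (i : Fin d) :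
    Continuous (partialDeriv i φ) :=
  h.continuous_fderiv.clm_apply continuous_const

theorem hasCompactSupport_partialDeriv (h : IsTestFun U φ) (i : Fin d) :
    HasCompactSupport (partialDeriv i φ) :=
  h.2.1.fderiv_apply ℝ (EuclideanSpace.single i 1)

theorem eq_zero_of_notMem (h : IsTestFun U φ) {x : EuclideanSpace ℝ (Fin d)} (hx : x ∉ U) :
    φ x = 0 :=
  image_eq_zero_of_notMem_tsupport fun hx' => hx (h.2.2 hx')

theorem partialDeriv_eq_zero_of_notMem (h : IsTestFun U φ) (i : Fin d)
    {x : EuclideanSpace ℝ (Fin d)} (hx : x ∉ U) : partialDeriv i φ x = 0 := by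
  have : fderiv ℝ φ x = 0 := by
    by_contra h0
    exact hx (h.2.2 (support_fderiv_subset ℝ h0))
  simp [partialDeriv, this]

theorem memLp (h : IsTestFun U φ) (p : ENNReal) (μ : Measure (EuclideanSpace ℝ (Fin d)))
    [IsFiniteMeasureOnCompacts μ] : MemLp φ p μ :=
  h.continuous.memLp_of_hasCompactSupport h.2.1

theorem memLp_partialDeriv (h : IsTestFun U φ) (i : Fin d) (p : ENNReal)
    (μ : Measure (EuclideanSpace ℝ (Fin d))) [IsFiniteMeasureOnCompacts μ] :
    MemLp (partialDeriv i φ) p μ :=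
  (h.continuous_partialDeriv i).memLp_of_hasCompactSupport (h.hasCompactSupport_partialDeriv i)

theorem add (h : IsTestFun U φ) (h' : IsTestFun U χ) : IsTestFun U (fun x => φ x + χ x) :=
  ⟨h.1.add h'.1, h.2.1.add h'.2.1,
    (tsupport_add φ χ).trans (union_subset h.2.2 h'.2.2)⟩

theorem of_support_subset {F' : Type*} [NormedAddCommGroup F'] [NormedSpace ℝ F']
    {ψ : EuclideanSpace ℝ (Fin d) → F'} (h : IsTestFun U φ)
    (hψ : ContDiff ℝ ((⊤ : ℕ∞) : WithTop ℕ∞) ψ) (hs : ∀ x, φ x = 0 → ψ x = 0) :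
    IsTestFun U ψ := by
  have hsub : tsupport ψ ⊆ tsupport φ := closure_mono fun x hx hx' => hx (hs x hx')
  exact ⟨hψ, h.2.1.of_isClosed_subset (isClosed_tsupport _) hsub, hsub.trans h.2.2⟩

theorem const_smul {R : Type*} [NormedField R] [NormedAlgebra ℝ R] [NormedSpace R F]
    [IsScalarTower ℝ R F] (h : IsTestFun U φ) (c : R) :
    IsTestFun U (fun x => c • φ x) :=
  h.of_support_subset (h.1.const_smul c) fun x hx => by simp [hx]

theorem zero : IsTestFun U (fun _ => (0 : F)) :=
  ⟨contDiff_const, HasCompactSupport.zero, by simp [tsupport]⟩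

end IsTestFun

/-! ### Classical gradients of test functions. -/

section Gradient

variable {d : ℕ} {U : Set (EuclideanSpace ℝ (Fin d))} {φ χ : EuclideanSpace ℝ (Fin d) → ℂ}

@[simp] theorem classicalGrad_apply (φ : EuclideanSpace ℝ (Fin d) → ℂ)
    (x : EuclideanSpace ℝ (Fin d)) (i : Fin d) : classicalGrad φ x i = partialDeriv i φ x := rfl

theorem IsTestFun.continuous_classicalGrad (h : IsTestFun U φ) : Continuous (classicalGrad φ) :=
  (PiLp.continuous_toLp 2 _).comp (continuous_pi fun i => h.continuous_partialDeriv i)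

theorem IsTestFun.hasCompactSupport_classicalGrad (h : IsTestFun U φ) :
    HasCompactSupport (classicalGrad φ) := by
  refine HasCompactSupport.intro h.2.1 fun x hx => ?_
  ext i
  exact (show IsTestFun (tsupport φ) φ from ⟨h.1, h.2.1, subset_rfl⟩).partialDeriv_eq_zero_of_notMem
    i hx

theorem IsTestFun.memLp_classicalGrad (h : IsTestFun U φ) (p : ENNReal)
    (μ : Measure (EuclideanSpace ℝ (Fin d))) [IsFiniteMeasureOnCompacts μ] :
    MemLp (classicalGrad φ) p μ :=
  h.continuous_classicalGrad.memLp_of_hasCompactSupport h.hasCompactSupport_classicalGrad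

theorem IsTestFun.classicalGrad_add (h : IsTestFun U φ) (h' : IsTestFun U χ) :
    classicalGrad (fun x => φ x + χ x) = fun x => classicalGrad φ x + classicalGrad χ x := by
  ext x i
  have := fderiv_fun_add (h.differentiable x) (h'.differentiable x)
  simp [partialDeriv, this]

theorem IsTestFun.classicalGrad_const_smul (h : IsTestFun U φ) (c : ℂ) :
    classicalGrad (fun x => c • φ x) = fun x => c • classicalGrad φ x := by
  ext x i
  have := fderiv_fun_const_smul (h.differentiable x) c
  simp only [PiLp.smul_apply, classicalGrad_apply, partialDeriv, this]
  rfl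

theorem IsTestFun.integral_mul_partialDeriv (h : IsTestFun U φ)
    {θ : EuclideanSpace ℝ (Fin d) → ℝ} (hθ : IsTestFun U θ) (i : Fin d) :
    ∫ x in U, φ x * ((partialDeriv i θ x : ℝ) : ℂ)
      = -∫ x in U, classicalGrad φ x i * (θ x : ℂ) := by
  -- Both integrands vanish off `U`, so the integration by parts takes place on the whole space and
  -- the boundary of `U` plays no role.
  rw [setIntegral_eq_integral_of_forall_compl_eq_zero
      (fun x hx => by rw [h.eq_zero_of_notMem hx, zero_mul]),
    setIntegral_eq_integral_of_forall_compl_eq_zero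
      (fun x hx => by rw [hθ.eq_zero_of_notMem hx]; simp)]
  have hc : IsTestFun U (fun x => (θ x : ℂ)) :=
    hθ.of_support_subset (Complex.ofRealCLM.contDiff.comp hθ.1) fun x hx => by simp [hx]
  have hd : ∀ x, partialDeriv i (fun x => (θ x : ℂ)) x = ((partialDeriv i θ x : ℝ) : ℂ) := by
    intro x
    have := (Complex.ofRealCLM.hasFDerivAt.comp x (hθ.differentiable x).hasFDerivAt).fderiv
    have h2 : fderiv ℝ (fun x => (θ x : ℂ)) x = Complex.ofRealCLM.comp (fderiv ℝ θ x) := this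
    simp [partialDeriv, h2]
  simp only [← hd, classicalGrad_apply]
  have hi : ∀ f g : EuclideanSpace ℝ (Fin d) → ℂ, MemLp f 2 volume → MemLp g 2 volume →
      Integrable (fun x => f x * g x) := fun f g hf hg => hf.integrable_mul hg
  exact integral_mul_fderiv_eq_neg_fderiv_mul_of_integrable
    (hi _ _ (h.memLp_partialDeriv i 2 _) (hc.memLp 2 _))
    (hi _ _ (h.memLp 2 _) (hc.memLp_partialDeriv i 2 _))
    (hi _ _ (h.memLp 2 _) (hc.memLp 2 _))
    (fun x _ => h.differentiable x) (fun x _ => hc.differentiable x)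

end Gradient

/-! ### The Hilbert space of pairs `(ψ, ∇ψ)` -/

section Sobolev

variable {d : ℕ}

/-- Pairs of a square-integrable function and a square-integrable vector field on `U`. -/
abbrev SobolevPair (U : Set (EuclideanSpace ℝ (Fin d))) : Type :=
  WithLp 2 (Lp ℂ 2 (volume.restrict U) × Lp (EuclideanSpace ℂ (Fin d)) 2 (volume.restrict U))

/-- A test function together with its gradient. -/
noncomputable def IsTestFun.pair {U : Set (EuclideanSpace ℝ (Fin d))}
    {φ : EuclideanSpace ℝ (Fin d) → ℂ} (h : IsTestFun U φ) : SobolevPair U :=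
  WithLp.toLp 2 ((h.memLp 2 _).toLp φ, (h.memLp_classicalGrad 2 _).toLp (classicalGrad φ))

theorem IsTestFun.pair_fst {U : Set (EuclideanSpace ℝ (Fin d))}
    {φ : EuclideanSpace ℝ (Fin d) → ℂ} (h : IsTestFun U φ) :
    h.pair.fst =ᵐ[volume.restrict U] φ :=
  MemLp.coeFn_toLp (h.memLp 2 (volume.restrict U))

theorem IsTestFun.pair_snd {U : Set (EuclideanSpace ℝ (Fin d))}
    {φ : EuclideanSpace ℝ (Fin d) → ℂ} (h : IsTestFun U φ) :
    h.pair.snd =ᵐ[volume.restrict U] classicalGrad φ :=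
  MemLp.coeFn_toLp (h.memLp_classicalGrad 2 (volume.restrict U))

/-- The test functions with their gradients. -/
def testPairs (U : Set (EuclideanSpace ℝ (Fin d))) : Submodule ℂ (SobolevPair U) where
  carrier := {p | ∃ φ, ∃ h : IsTestFun U φ, p = h.pair}
  zero_mem' := ⟨_, IsTestFun.zero, by
    have h : IsTestFun U (fun _ => (0 : ℂ)) := IsTestFun.zero
    apply (WithLp.ofLp_injective 2)
    refine Prod.ext ?_ ?_
    · ext1; exact (Lp.coeFn_zero _ _ _).trans h.pair_fst.symm
    · ext1
      refine (Lp.coeFn_zero _ _ _).trans (EventuallyEq.trans ?_ h.pair_snd.symm)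
      refine Eventually.of_forall fun x => ?_
      ext i; simp [partialDeriv]⟩
  add_mem' := by
    rintro _ _ ⟨φ, h, rfl⟩ ⟨χ, h', rfl⟩
    refine ⟨_, h.add h', ?_⟩
    apply (WithLp.ofLp_injective 2)
    refine Prod.ext ?_ ?_
    · exact (MemLp.toLp_add (h.memLp 2 _) (h'.memLp 2 _)).symm
    · refine (MemLp.toLp_add (h.memLp_classicalGrad 2 _) (h'.memLp_classicalGrad 2 _)).symm.trans ?_
      exact MemLp.toLp_congr _ ((h.add h').memLp_classicalGrad 2 _)
        (by rw [h.classicalGrad_add h']; rfl)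
  smul_mem' := by
    rintro c _ ⟨φ, h, rfl⟩
    refine ⟨_, h.const_smul c, ?_⟩
    apply (WithLp.ofLp_injective 2)
    refine Prod.ext ?_ ?_
    · exact (MemLp.toLp_const_smul c (h.memLp 2 _)).symm
    · refine (MemLp.toLp_const_smul c (h.memLp_classicalGrad 2 _)).symm.trans ?_
      exact MemLp.toLp_congr _ ((h.const_smul c).memLp_classicalGrad 2 _)
        (by rw [h.classicalGrad_const_smul c]; rfl)

theorem mem_testPairs {U : Set (EuclideanSpace ℝ (Fin d))} {p : SobolevPair U} :
    p ∈ testPairs U ↔ ∃ φ, ∃ h : IsTestFun U φ, p = h.pair := Iff.rfl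

/-- `H¹₀(U)` as the closed space of the pairs `(ψ, ∇ψ)`. -/
noncomputable def sobolev (U : Set (EuclideanSpace ℝ (Fin d))) : Submodule ℂ (SobolevPair U) :=
  (testPairs U).topologicalClosure

theorem isClosed_sobolev (U : Set (EuclideanSpace ℝ (Fin d))) :
    IsClosed (sobolev U : Set (SobolevPair U)) :=
  Submodule.isClosed_topologicalClosure _

theorem IsTestFun.pair_mem {U : Set (EuclideanSpace ℝ (Fin d))}
    {φ : EuclideanSpace ℝ (Fin d) → ℂ} (h : IsTestFun U φ) : h.pair ∈ sobolev U :=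
  Submodule.le_topologicalClosure _ (mem_testPairs.2 ⟨φ, h, rfl⟩)

theorem exists_test_seq {U : Set (EuclideanSpace ℝ (Fin d))} {p : SobolevPair U}
    (hp : p ∈ sobolev U) : ∃ (φ : ℕ → EuclideanSpace ℝ (Fin d) → ℂ)
      (h : ∀ n, IsTestFun U (φ n)), Tendsto (fun n => (h n).pair) atTop (𝓝 p) := by
  obtain ⟨x, hx, hlim⟩ := mem_closure_iff_seq_limit.1 hp
  choose φ h hφ using fun n => mem_testPairs.1 (hx n)
  exact ⟨φ, h, by simpa only [← hφ] using hlim⟩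

/-- For a fixed test function and index, the identity says that a pair is annihilated by a fixed
vector `(a, b)` of `L² × L²`. This is a closed condition, true for test pairs by integration by
parts. -/
theorem hasWeakGrad_of_mem_sobolev {U : Set (EuclideanSpace ℝ (Fin d))} {p : SobolevPair U}
    (hp : p ∈ sobolev U) : HasWeakGrad U p.fst p.snd := by
  refine ⟨Lp.memLp _, fun θ hθ i => ?_⟩
  have hc : IsTestFun U (fun x => (θ x : ℂ)) :=
    hθ.of_support_subset (Complex.ofRealCLM.contDiff.comp hθ.1) fun x hx => by simp [hx]
  have m1 : MemLp (fun x => ((partialDeriv i θ x : ℝ) : ℂ)) 2 (volume.restrict U) :=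
    (hθ.memLp_partialDeriv i 2 _).ofReal
  have m2 : MemLp (fun x => (EuclideanSpace.single i (θ x : ℂ) : EuclideanSpace ℂ (Fin d))) 2
      (volume.restrict U) := by
    refine (hc.memLp 2 (volume.restrict U)).of_le ?_ (Eventually.of_forall fun x => by simp)
    refine Continuous.aestronglyMeasurable ?_
    refine (PiLp.continuous_toLp 2 _).comp (continuous_pi fun j => ?_)
    by_cases hj : j = i
    · subst hj; simpa using hc.continuous
    · simpa [hj] using continuous_const
  let a := m1.toLp
  let b := m2.toLp
  have key : ∀ p : SobolevPair U,
      (inner ℂ a p.fst + inner ℂ b p.snd : ℂ) =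
        (∫ x in U, p.fst x * ((partialDeriv i θ x : ℝ) : ℂ)) + ∫ x in U, p.snd x i * (θ x : ℂ) := by
    intro p
    rw [L2.inner_def, L2.inner_def]
    congr 1
    · refine integral_congr_ae ?_
      filter_upwards [m1.coeFn_toLp] with x hx
      simp [a, hx]
    · refine integral_congr_ae ?_
      filter_upwards [m2.coeFn_toLp] with x hx
      simp [b, hx, EuclideanSpace.inner_single_left, mul_comm]
  have hcl : IsClosed {p : SobolevPair U | (inner ℂ a p.fst + inner ℂ b p.snd : ℂ) = 0} := by
    refine isClosed_eq ?_ continuous_const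
    exact ((continuous_const.inner (WithLp.continuous_fst 2 _ _))).add
      (continuous_const.inner (WithLp.continuous_snd 2 _ _))
  have : p ∈ {p : SobolevPair U | (inner ℂ a p.fst + inner ℂ b p.snd : ℂ) = 0} := by
    refine closure_minimal ?_ hcl hp
    intro q hq
    obtain ⟨φ, h, rfl⟩ := mem_testPairs.1 hq
    rw [mem_ofPred_eq, key, integral_congr_ae (g := fun x => φ x * ((partialDeriv i θ x : ℝ) : ℂ)),
      integral_congr_ae (f := fun x => h.pair.snd x i * (θ x : ℂ))
      (g := fun x => classicalGrad φ x i * (θ x : ℂ)), h.integral_mul_partialDeriv hθ, neg_add_cancel]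
    · filter_upwards [h.pair_snd] with x hx
      rw [hx]
    · filter_upwards [h.pair_fst] with x hx
      rw [hx]
  rw [mem_ofPred_eq, key] at this
  exact eq_neg_of_add_eq_zero_left this

theorem HasWeakGrad.congr {U : Set (EuclideanSpace ℝ (Fin d))}
    {ψ ψ' : EuclideanSpace ℝ (Fin d) → ℂ}
    {G G' : EuclideanSpace ℝ (Fin d) → EuclideanSpace ℂ (Fin d)}
    (h : HasWeakGrad U ψ G) (h1 : ψ =ᵐ[volume.restrict U] ψ') (h2 : G =ᵐ[volume.restrict U] G') :
    HasWeakGrad U ψ' G' := by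
  refine ⟨h.1.ae_eq h2, fun φ hφ i => ?_⟩
  have := h.2 φ hφ i
  rw [integral_congr_ae (g := fun x => ψ' x * ((partialDeriv i φ x : ℝ) : ℂ)),
    integral_congr_ae (f := fun x => G x i * (φ x : ℂ))
      (g := fun x => G' x i * (φ x : ℂ))] at this
  · exact this
  · filter_upwards [h2] with x hx
    rw [hx]
  · filter_upwards [h1] with x hx
    rw [hx]

theorem ae_eq_zero_of_integral_test {U : Set (EuclideanSpace ℝ (Fin d))} (hU : IsOpen U)
    {f : EuclideanSpace ℝ (Fin d) → ℂ} (hf : LocallyIntegrable f (volume.restrict U))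
    (h : ∀ φ : EuclideanSpace ℝ (Fin d) → ℝ, IsTestFun U φ → ∫ x in U, f x * (φ x : ℂ) = 0) :
    f =ᵐ[volume.restrict U] 0 := by
  have hf' : LocallyIntegrableOn f U := by
    intro x hx
    obtain ⟨t, ht, hi⟩ := hf x
    refine ⟨t ∩ U, inter_mem (mem_nhdsWithin_of_mem_nhds ht) self_mem_nhdsWithin, ?_⟩
    rwa [IntegrableOn, Measure.restrict_restrict' hU.measurableSet] at hi
  have := hU.ae_eq_zero_of_integral_contDiff_smul_eq_zero hf' fun g hg hg' hg'' => ?_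
  · exact (ae_restrict_iff' hU.measurableSet).2 this
  · have ht : IsTestFun U g := ⟨hg, hg', hg''⟩
    have h1 := h g ht
    rw [setIntegral_eq_integral_of_forall_compl_eq_zero
      (fun x hx => by rw [ht.eq_zero_of_notMem hx]; simp)] at h1
    rw [← h1]
    congr with x
    simp [mul_comm]

theorem HasWeakGrad.ae_unique {U : Set (EuclideanSpace ℝ (Fin d))} (hU : IsOpen U)
    {ψ : EuclideanSpace ℝ (Fin d) → ℂ}
    {G G' : EuclideanSpace ℝ (Fin d) → EuclideanSpace ℂ (Fin d)}
    (h : HasWeakGrad U ψ G) (h' : HasWeakGrad U ψ G') : G =ᵐ[volume.restrict U] G' := by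
  have hm : ∀ {G : EuclideanSpace ℝ (Fin d) → EuclideanSpace ℂ (Fin d)},
      MemLp G 2 (volume.restrict U) → ∀ i, MemLp (fun x => G x i) 2 (volume.restrict U) :=
    fun {G} hG i => hG.of_le
      ((EuclideanSpace.proj i : EuclideanSpace ℂ (Fin d) →L[ℂ] ℂ).continuous.comp_aestronglyMeasurable
        hG.1) (Eventually.of_forall fun x => PiLp.norm_apply_le (G x) i)
  have : ∀ i, (fun x => G x i - G' x i) =ᵐ[volume.restrict U] 0 := by
    intro i
    refine ae_eq_zero_of_integral_test hU ?_ fun φ hφ => ?_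
    · exact ((hm h.1 i).sub (hm h'.1 i)).locallyIntegrable (by norm_num)
    · have e := (h.2 φ hφ i).symm.trans (h'.2 φ hφ i)
      simp only [sub_mul]
      rw [integral_sub, neg_inj.1 e, sub_self]
      · exact (hm h.1 i).integrable_mul ((hφ.memLp 2 _).ofReal)
      · exact (hm h'.1 i).integrable_mul ((hφ.memLp 2 _).ofReal)
  filter_upwards [ae_all_iff.2 this] with x hx
  ext i
  exact sub_eq_zero.1 (hx i)

/-- The choice hidden in `weakGrad` is harmless on an open set, so any known weak gradient may
replace it. -/
theorem weakGrad_ae_eq {U : Set (EuclideanSpace ℝ (Fin d))} (hU : IsOpen U)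
    {ψ : EuclideanSpace ℝ (Fin d) → ℂ}
    {G : EuclideanSpace ℝ (Fin d) → EuclideanSpace ℂ (Fin d)}
    (h : HasWeakGrad U ψ G) : weakGrad U ψ =ᵐ[volume.restrict U] G := by
  have he : ∃ G, HasWeakGrad U ψ G := ⟨G, h⟩
  rw [weakGrad, dif_pos he]
  exact he.choose_spec.ae_unique hU h

/-- `H¹₀(U)` functions are the first components of elements of `sobolev U`. -/
theorem memH10_iff {U : Set (EuclideanSpace ℝ (Fin d))} (hU : IsOpen U)
    {ψ : EuclideanSpace ℝ (Fin d) → ℂ} :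
    MemH10 U ψ ↔ ∃ p ∈ sobolev U, p.fst =ᵐ[volume.restrict U] ψ := by
  constructor
  · rintro ⟨⟨hψ, hG⟩, φ, hφ, h1, h2⟩
    have hw : HasWeakGrad U ψ (weakGrad U ψ) := by
      rw [weakGrad, dif_pos hG]; exact hG.choose_spec
    refine ⟨WithLp.toLp 2 (hψ.toLp, hw.1.toLp), ?_, hψ.coeFn_toLp⟩
    refine mem_closure_of_tendsto (b := atTop) (f := fun n => (hφ n).pair) ?_
      (Eventually.of_forall fun n => mem_testPairs.2 ⟨φ n, hφ n, rfl⟩)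
    refine ((WithLp.prod_continuous_toLp 2 _ _).tendsto _).comp ?_
    refine Tendsto.prodMk_nhds ?_ ?_
    · rw [Lp.tendsto_Lp_iff_tendsto_eLpNorm'']
      exact h1
    · rw [Lp.tendsto_Lp_iff_tendsto_eLpNorm'']
      exact h2
  · rintro ⟨p, hp, he⟩
    have hw := (hasWeakGrad_of_mem_sobolev hp).congr he EventuallyEq.rfl
    refine ⟨⟨(Lp.memLp p.fst).ae_eq he, _, hw⟩, ?_⟩
    obtain ⟨φ, hφ, hlim⟩ := exists_test_seq hp
    refine ⟨φ, hφ, ?_, ?_⟩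
    · have h1 := ((WithLp.continuous_fst 2 _ _).tendsto p).comp hlim
      rw [Lp.tendsto_Lp_iff_tendsto_eLpNorm'] at h1
      refine h1.congr fun n => eLpNorm_congr_ae ?_
      filter_upwards [(hφ n).pair_fst, he] with x h1 h2
      simp [h1, h2]
    · have h1 := ((WithLp.continuous_snd 2 _ _).tendsto p).comp hlim
      rw [Lp.tendsto_Lp_iff_tendsto_eLpNorm'] at h1
      refine h1.congr fun n => eLpNorm_congr_ae ?_
      filter_upwards [(hφ n).pair_snd, weakGrad_ae_eq hU hw] with x h1 h2
      simp [h1, h2]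

end Sobolev

/-! ### Weak limits and lower semicontinuity -/

/-- Sequential Banach–Alaoglu in the dual of a separable space, carried back by the Riesz isometry.
That isometry is conjugate linear, whence the conjugations. -/
theorem exists_weak_subseq {H : Type*} [NormedAddCommGroup H] [InnerProductSpace ℂ H]
    [CompleteSpace H] [TopologicalSpace.SeparableSpace H] {x : ℕ → H} {R : ℝ}
    (hx : ∀ n, ‖x n‖ ≤ R) :
    ∃ g : ℕ → ℕ, StrictMono g ∧ ∃ y : H, ∀ z : H,
      Tendsto (fun n => (inner ℂ z (x (g n)) : ℂ)) atTop (𝓝 (inner ℂ z y)) := by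
  let D := InnerProductSpace.toDual ℂ H
  let w : ℕ → WeakDual ℂ H := fun n => StrongDual.toWeakDual (D (x n))
  have hmem : ∀ n, w n ∈ (WeakDual.toStrongDual ⁻¹' Metric.closedBall (0 : StrongDual ℂ H) R) := by
    intro n
    simp [w, D, hx n]
  obtain ⟨l, -, g, hg, hl⟩ := WeakDual.isSeqCompact_closedBall ℂ H (0 : StrongDual ℂ H) R hmem
  refine ⟨g, hg, D.symm (WeakDual.toStrongDual l), fun z => ?_⟩
  have h2 : Tendsto (fun n => w (g n) z) atTop (𝓝 (l z)) :=
    ((WeakDual.eval_continuous z).tendsto l).comp hl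
  have h3 := (Complex.continuous_conj.tendsto _).comp h2
  have e1 : ∀ n, conj (w (g n) z) = inner ℂ z (x (g n)) := fun n => by
    simp [w, D]
  have e2 : conj (l z) = inner ℂ z (D.symm (WeakDual.toStrongDual l)) := by
    rw [← inner_conj_symm, InnerProductSpace.toDual_symm_apply]
    rfl
  rw [← e2]
  exact h3.congr e1

theorem L2_norm_sq {α F : Type*} [MeasurableSpace α] {μ : Measure α} [NormedAddCommGroup F]
    [InnerProductSpace ℂ F] (f : Lp F 2 μ) : ‖f‖ ^ 2 = ∫ x, ‖f x‖ ^ 2 ∂μ := by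
  have h := inner_self_eq_norm_sq_to_K (𝕜 := ℂ) f
  rw [L2.inner_def] at h
  simp only [inner_self_eq_norm_sq_to_K] at h
  have h2 : (∫ x, ((‖f x‖ ^ 2 : ℝ) : ℂ) ∂μ) = ((‖f‖ ^ 2 : ℝ) : ℂ) := by
    push_cast
    exact h
  exact (Complex.ofReal_injective (integral_ofReal.symm.trans h2)).symm

section

variable {d : ℕ} {U : Set (EuclideanSpace ℝ (Fin d))}

/-- Strong `L²` convergence and the gradient bounds make the pairs bounded, so a subsequence
converges weakly. A closed subspace is its own double orthogonal, hence weakly closed; the strong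
limit identifies the first component; and the norm is weakly lower semicontinuous. Bounds `C n` are
allowed in place of the gradient norms themselves so that energy estimates can be fed in directly.
-/
theorem sobolev_lsc {p : ℕ → SobolevPair U} (hp : ∀ n, p n ∈ sobolev U)
    {f : Lp ℂ 2 (volume.restrict U)} (hf : Tendsto (fun n => (p n).fst) atTop (𝓝 f))
    {C : ℕ → ℝ} {C' : ℝ} (hC : ∀ n, ‖(p n).snd‖ ^ 2 ≤ C n) (hlim : Tendsto C atTop (𝓝 C')) :
    ∃ q ∈ sobolev U, q.fst = f ∧ ‖q.snd‖ ^ 2 ≤ C' := by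
  obtain ⟨R₁, hR₁⟩ := hlim.bddAbove_range
  obtain ⟨R₂, hR₂⟩ := hf.norm.bddAbove_range
  have hb : ∀ n, ‖p n‖ ≤ √(R₂ ^ 2 + R₁) := by
    intro n
    apply Real.le_sqrt_of_sq_le
    rw [WithLp.prod_norm_sq_eq_of_L2]
    have h1 : C n ≤ R₁ := hR₁ (mem_range_self n)
    have h2 : ‖(p n).fst‖ ≤ R₂ := hR₂ (mem_range_self n)
    have := hC n
    gcongr
    linarith
  have : Fact ((2 : ENNReal) ≠ ⊤) := ⟨by norm_num⟩
  have h1 : SecondCountableTopology (Lp ℂ 2 (volume.restrict U)) := inferInstance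
  have h2 : SecondCountableTopology (Lp (EuclideanSpace ℂ (Fin d)) 2 (volume.restrict U)) :=
    inferInstance
  have h3 : SecondCountableTopology (SobolevPair U) := WithLp.secondCountableTopology 2 _ _
  have : TopologicalSpace.SeparableSpace (SobolevPair U) := inferInstance
  obtain ⟨g, hg, x, hx⟩ := exists_weak_subseq hb
  refine ⟨x, ?_, ?_, ?_⟩
  · have : CompleteSpace (sobolev U) := (isClosed_sobolev U).completeSpace_coe
    rw [← Submodule.orthogonal_orthogonal (sobolev U), Submodule.mem_orthogonal]
    intro k hk
    refine tendsto_nhds_unique (hx k) ?_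
    have : ∀ n, (inner ℂ k (p n) : ℂ) = 0 := fun n =>
      (Submodule.mem_orthogonal' _ _).1 hk _ (hp n)
    simp [this]
  · refine ext_inner_left ℂ fun y => ?_
    have h1 := hx (WithLp.toLp 2 (y, 0))
    have h2 : Tendsto (fun n => (inner ℂ y (p (g n)).fst : ℂ)) atTop (𝓝 (inner ℂ y f)) :=
      tendsto_const_nhds.inner (hf.comp hg.tendsto_atTop)
    refine tendsto_nhds_unique ?_ h2
    simpa using h1
  · have h1 := hx (WithLp.toLp 2 (0, x.snd))
    have h2 : Tendsto (fun n => (inner ℂ x.snd (p (g n)).snd : ℂ).re) atTop (𝓝 (‖x.snd‖ ^ 2)) := by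
      have e : (inner ℂ (WithLp.toLp 2 (0, x.snd) : SobolevPair U) x : ℂ).re = ‖x.snd‖ ^ 2 := by
        have := inner_self_eq_norm_sq (𝕜 := ℂ) x.snd
        simpa using this
      rw [← e]
      refine ((Complex.continuous_re.tendsto _).comp h1).congr fun n => ?_
      simp
    -- Lower semicontinuity from `Re⟨x, pₙ⟩ ≤ ‖x‖²/2 + ‖pₙ‖²/2` on second components, whose left
    -- side tends to `‖x‖²`.
    have h3 := le_of_tendsto_of_tendsto h2
      ((tendsto_const_nhds (x := ‖x.snd‖ ^ 2 / 2)).add ((hlim.comp hg.tendsto_atTop).div_const 2))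
      (Eventually.of_forall fun n => by
        have a1 : (inner ℂ x.snd (p (g n)).snd : ℂ).re ≤ ‖x.snd‖ * ‖(p (g n)).snd‖ :=
          re_inner_le_norm (𝕜 := ℂ) x.snd (p (g n)).snd
        have a2 := hC (g n)
        show _ ≤ ‖x.snd‖ ^ 2 / 2 + C (g n) / 2
        nlinarith [sq_nonneg (‖x.snd‖ - ‖(p (g n)).snd‖)])
    linarith

/-! ### The convexity inequality for gradients -/

theorem IsTestFun.prodMk {F F' : Type*} [NormedAddCommGroup F] [NormedSpace ℝ F]
    [NormedAddCommGroup F'] [NormedSpace ℝ F'] {φ : EuclideanSpace ℝ (Fin d) → F}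
    {χ : EuclideanSpace ℝ (Fin d) → F'} (h : IsTestFun U φ) (h' : IsTestFun U χ) :
    IsTestFun U (fun x => (φ x, χ x)) := by
  have hsub : tsupport (fun x => (φ x, χ x)) ⊆ tsupport φ ∪ tsupport χ := by
    refine closure_minimal (fun x hx => ?_)
      ((isClosed_tsupport φ).union (isClosed_tsupport χ))
    by_contra hn
    simp only [mem_union, not_or] at hn
    have h1 : φ x = 0 := image_eq_zero_of_notMem_tsupport hn.1
    have h2 : χ x = 0 := image_eq_zero_of_notMem_tsupport hn.2
    exact hx (Prod.ext h1 h2)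
  exact ⟨h.1.prodMk h'.1, (h.2.1.isCompact.union h'.2.1.isCompact).of_isClosed_subset
    (isClosed_tsupport _) hsub, hsub.trans (union_subset h.2.2 h'.2.2)⟩

/-- A smooth regularisation of `√(|φ|² + |χ|²)`. -/
noncomputable def regSqrt (δ : ℝ) (φ χ : EuclideanSpace ℝ (Fin d) → ℂ)
    (x : EuclideanSpace ℝ (Fin d)) : ℂ :=
  ((√(‖φ x‖ ^ 2 + ‖χ x‖ ^ 2 + δ ^ 2) - δ : ℝ) : ℂ)

theorem IsTestFun.regSqrt {φ χ : EuclideanSpace ℝ (Fin d) → ℂ} (h : IsTestFun U φ)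
    (h' : IsTestFun U χ) {δ : ℝ} (hδ : 0 < δ) : IsTestFun U (regSqrt δ φ χ) := by
  refine (h.prodMk h').of_support_subset ?_ fun x hx => ?_
  · refine Complex.ofRealCLM.contDiff.comp (ContDiff.sub (ContDiff.sqrt ?_ ?_) contDiff_const)
    · exact ((h.1.norm_sq ℝ).add (h'.1.norm_sq ℝ)).add contDiff_const
    · intro x; positivity
  · simp only [Prod.mk_eq_zero] at hx
    simp [_root_.regSqrt, hx.1, hx.2, Real.sqrt_sq hδ.le]

/-- For each partial derivative, `∂√(|φ|² + |χ|² + δ²)` is `(Re φ̄ ∂φ + Re χ̄ ∂χ) / √(|φ|² + |χ|² +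
δ²)`. Cauchy–Schwarz for `(|φ|, |χ|)` and `(|∂φ|, |∂χ|)` bounds it, and the term `δ²` only helps. -/
theorem norm_sq_classicalGrad_regSqrt_le {φ χ : EuclideanSpace ℝ (Fin d) → ℂ}
    (h : IsTestFun U φ) (h' : IsTestFun U χ) {δ : ℝ} (hδ : 0 < δ)
    (x : EuclideanSpace ℝ (Fin d)) :
    ‖classicalGrad (regSqrt δ φ χ) x‖ ^ 2
      ≤ ‖classicalGrad φ x‖ ^ 2 + ‖classicalGrad χ x‖ ^ 2 := by
  simp only [EuclideanSpace.norm_sq_eq, classicalGrad_apply, ← Finset.sum_add_distrib]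
  refine Finset.sum_le_sum fun i _ => ?_
  have hA : 0 < ‖φ x‖ ^ 2 + ‖χ x‖ ^ 2 + δ ^ 2 := by positivity
  have d1 := (h.differentiable x).hasFDerivAt.norm_sq
  have d2 := (h'.differentiable x).hasFDerivAt.norm_sq
  have d3 := (((d1.add d2).add_const (δ ^ 2)).sqrt hA.ne').sub_const δ
  have d4 := (Complex.ofRealCLM.hasFDerivAt.comp x d3).fderiv
  have d5 : partialDeriv i (regSqrt δ φ χ) x = ((1 / (2 * √(‖φ x‖ ^ 2 + ‖χ x‖ ^ 2 + δ ^ 2)) *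
      (2 * (inner ℝ (φ x) (partialDeriv i φ x)) + 2 * (inner ℝ (χ x) (partialDeriv i χ x))) : ℝ) : ℂ) := by
    unfold partialDeriv
    have : fderiv ℝ (regSqrt δ φ χ) x = _ := d4
    rw [this]
    simp
    ring
  rw [d5, Complex.norm_real, Real.norm_eq_abs, sq_abs]
  have c1 := abs_real_inner_le_norm (φ x) (partialDeriv i φ x)
  have c2 := abs_real_inner_le_norm (χ x) (partialDeriv i χ x)
  set I := inner ℝ (φ x) (partialDeriv i φ x)
  set J := inner ℝ (χ x) (partialDeriv i χ x)
  set A := ‖φ x‖ ^ 2 + ‖χ x‖ ^ 2 + δ ^ 2 with hAdef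
  have hs : √A ^ 2 = A := Real.sq_sqrt hA.le
  have hs0 : 0 < √A := Real.sqrt_pos.2 hA
  have e : (1 / (2 * √A) * (2 * I + 2 * J)) ^ 2 = (I + J) ^ 2 / A := by
    rw [eq_div_iff hA.ne']
    nth_rewrite 2 [← hs]
    field_simp
  rw [e, div_le_iff₀ hA]
  set a := ‖φ x‖
  set b := ‖χ x‖
  set m := ‖partialDeriv i φ x‖
  set k := ‖partialDeriv i χ x‖
  have h1 : |I + J| ≤ a * m + b * k := (abs_add_le _ _).trans (add_le_add c1 c2)
  have h2 : (I + J) ^ 2 ≤ (a * m + b * k) ^ 2 := sq_le_sq' (by linarith [(abs_le.1 h1).1]) (abs_le.1 h1).2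
  have h3 : (a * m + b * k) ^ 2 ≤ (m ^ 2 + k ^ 2) * (a ^ 2 + b ^ 2) := by
    nlinarith [sq_nonneg (a * k - b * m)]
  have h4 : 0 ≤ (m ^ 2 + k ^ 2) * δ ^ 2 := by positivity
  rw [hAdef]
  nlinarith

theorem abs_sqrt_sub_sqrt_le (a b c d : ℝ) :
    |√(a ^ 2 + b ^ 2) - √(c ^ 2 + d ^ 2)| ≤ |a - c| + |b - d| := by
  have key : ∀ a b c d : ℝ, √(a ^ 2 + b ^ 2) ≤ √(c ^ 2 + d ^ 2) + (|a - c| + |b - d|) := by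
    intro a b c d
    rw [Real.sqrt_le_left (by positivity)]
    have h1 : |c| ≤ √(c ^ 2 + d ^ 2) := Real.abs_le_sqrt (by nlinarith [sq_nonneg d])
    have h2 : |d| ≤ √(c ^ 2 + d ^ 2) := Real.abs_le_sqrt (by nlinarith [sq_nonneg c])
    have hs : √(c ^ 2 + d ^ 2) ^ 2 = c ^ 2 + d ^ 2 := Real.sq_sqrt (by positivity)
    have h3 : c * (a - c) ≤ √(c ^ 2 + d ^ 2) * |a - c| :=
      (le_abs_self _).trans (by rw [abs_mul]; gcongr)
    have h4 : d * (b - d) ≤ √(c ^ 2 + d ^ 2) * |b - d| :=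
      (le_abs_self _).trans (by rw [abs_mul]; gcongr)
    have h5 : 0 ≤ |a - c| * |b - d| := by positivity
    nlinarith [sq_abs (a - c), sq_abs (b - d)]
  rw [abs_le]
  have h1 := key a b c d
  have h2 := key c d a b
  rw [abs_sub_comm c a, abs_sub_comm d b] at h2
  constructor <;> linarith

theorem norm_regSqrt_sub_le (φ χ : EuclideanSpace ℝ (Fin d) → ℂ) {δ : ℝ} (hδ : 0 < δ)
    (x : EuclideanSpace ℝ (Fin d)) (z w : ℂ) :
    ‖regSqrt δ φ χ x - ((√(‖z‖ ^ 2 + ‖w‖ ^ 2) : ℝ) : ℂ)‖ ≤ ‖φ x - z‖ + ‖χ x - w‖ + δ := by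
  rw [regSqrt, ← Complex.ofReal_sub, Complex.norm_real, Real.norm_eq_abs]
  have h1 := abs_sqrt_sub_sqrt_le ‖φ x‖ ‖χ x‖ ‖z‖ ‖w‖
  have h2 := abs_norm_sub_norm_le (φ x) z
  have h3 := abs_norm_sub_norm_le (χ x) w
  set A := ‖φ x‖ ^ 2 + ‖χ x‖ ^ 2 with hA
  have hA0 : 0 ≤ A := by positivity
  have h4 : √A ≤ √(A + δ ^ 2) := Real.sqrt_le_sqrt (by nlinarith)
  have h5 : √(A + δ ^ 2) ≤ √A + δ := by
    rw [Real.sqrt_le_left (by positivity)]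
    nlinarith [Real.sq_sqrt hA0, Real.sqrt_nonneg A]
  have h6 := abs_le.1 (h1.trans (add_le_add h2 h3))
  rw [abs_le]
  constructor <;> linarith [h6.1, h6.2]

theorem tendsto_eLpNorm_fst {p : SobolevPair U} {φ : ℕ → EuclideanSpace ℝ (Fin d) → ℂ}
    {hφ : ∀ n, IsTestFun U (φ n)} (h : Tendsto (fun n => (hφ n).pair) atTop (𝓝 p)) :
    Tendsto (fun n => eLpNorm (fun x => φ n x - p.fst x) 2 (volume.restrict U)) atTop (𝓝 0) := by
  have h1 := ((WithLp.continuous_fst 2 _ _).tendsto p).comp h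
  rw [Lp.tendsto_Lp_iff_tendsto_eLpNorm'] at h1
  refine h1.congr fun n => eLpNorm_congr_ae ?_
  filter_upwards [(hφ n).pair_fst] with x h1
  simp [h1]

theorem norm_sq_pair_snd_regSqrt_le {φ χ : EuclideanSpace ℝ (Fin d) → ℂ}
    (h : IsTestFun U φ) (h' : IsTestFun U χ) {δ : ℝ} (hδ : 0 < δ) :
    ‖(h.regSqrt h' hδ).pair.snd‖ ^ 2 ≤ ‖h.pair.snd‖ ^ 2 + ‖h'.pair.snd‖ ^ 2 := by
  have hi : ∀ f : Lp (EuclideanSpace ℂ (Fin d)) 2 (volume.restrict U),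
      Integrable (fun x => ‖f x‖ ^ 2) (volume.restrict U) :=
    fun f => (Lp.memLp f).norm.integrable_sq
  rw [L2_norm_sq, L2_norm_sq, L2_norm_sq, ← integral_add (hi _) (hi _)]
  refine integral_mono_ae (hi _) ((hi _).add (hi _)) ?_
  filter_upwards [(h.regSqrt h' hδ).pair_snd, h.pair_snd, h'.pair_snd] with x h1 h2 h3
  have := norm_sq_classicalGrad_regSqrt_le h h' hδ x
  rwa [← h1, ← h2, ← h3] at this

/-- Regularised square roots of approximating test functions, with `δ = 1/(n+1)`, converge in `L²`;
the error `δ` is harmless because `U` has finite volume. `sobolev_lsc` then passes the pointwise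
gradient inequality to the limit. With one function zero this handles moduli; with both scaled, it
handles convex combinations of densities. -/
theorem exists_sqrt_mem_sobolev (hU : volume U ≠ ⊤) {p r : SobolevPair U} (hp : p ∈ sobolev U)
    (hr : r ∈ sobolev U) : ∃ s ∈ sobolev U,
      (s.fst =ᵐ[volume.restrict U] fun x => ((√(‖p.fst x‖ ^ 2 + ‖r.fst x‖ ^ 2) : ℝ) : ℂ)) ∧
      ‖s.snd‖ ^ 2 ≤ ‖p.snd‖ ^ 2 + ‖r.snd‖ ^ 2 := by
  have : IsFiniteMeasure (volume.restrict U) := ⟨by simpa using hU.lt_top⟩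
  obtain ⟨φ, hφ, hφl⟩ := exists_test_seq hp
  obtain ⟨χ, hχ, hχl⟩ := exists_test_seq hr
  have hS : MemLp (fun x => ((√(‖p.fst x‖ ^ 2 + ‖r.fst x‖ ^ 2) : ℝ) : ℂ)) 2
      (volume.restrict U) := by
    refine ((Lp.memLp p.fst).norm.add (Lp.memLp r.fst).norm).of_le ?_
      (Eventually.of_forall fun x => ?_)
    · exact Complex.continuous_ofReal.comp_aestronglyMeasurable
        (Real.continuous_sqrt.comp_aestronglyMeasurable
          (((Lp.aestronglyMeasurable p.fst).norm.pow 2).add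
            ((Lp.aestronglyMeasurable r.fst).norm.pow 2)))
    · rw [Complex.norm_real, Real.norm_of_nonneg (Real.sqrt_nonneg _), Pi.add_apply,
        Real.norm_of_nonneg (by positivity)]
      rw [Real.sqrt_le_left (by positivity)]
      nlinarith [norm_nonneg (p.fst x), norm_nonneg (r.fst x)]
  have hδ : ∀ n : ℕ, (0 : ℝ) < 1 / ((n : ℝ) + 1) := fun n => by positivity
  have hs := fun n => (hφ n).regSqrt (hχ n) (hδ n)
  have hlim1 := tendsto_eLpNorm_fst hφl
  have hlim2 := tendsto_eLpNorm_fst hχl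
  have hlim3 : Tendsto (fun n : ℕ => eLpNorm (fun _ : EuclideanSpace ℝ (Fin d) => 1 / ((n : ℝ) + 1))
      2 (volume.restrict U)) atTop (𝓝 0) := by
    have e : ∀ n : ℕ, eLpNorm (fun _ : EuclideanSpace ℝ (Fin d) => 1 / ((n : ℝ) + 1))
      2 (volume.restrict U) = ENNReal.ofReal (1 / ((n : ℝ) + 1)) *
        (volume.restrict U univ) ^ (1 / (2 : ENNReal).toReal) := by
      intro n
      rw [eLpNorm_const' _ (by norm_num) (by norm_num), Real.enorm_of_nonneg (hδ n).le]
    simp only [e]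
    have := ENNReal.Tendsto.mul_const (b := (volume.restrict U univ) ^ (1 / (2 : ENNReal).toReal))
      (ENNReal.tendsto_ofReal (tendsto_one_div_add_atTop_nhds_zero_nat (𝕜 := ℝ)))
      (Or.inr (ENNReal.rpow_ne_top_of_nonneg (by norm_num) (measure_ne_top _ _)))
    simpa using this
  have hfst : Tendsto (fun n => (hs n).pair.fst) atTop (𝓝 hS.toLp) := by
    rw [Lp.tendsto_Lp_iff_tendsto_eLpNorm']
    have h0 := (hlim1.add hlim2).add hlim3
    simp only [add_zero] at h0
    refine tendsto_of_tendsto_of_tendsto_of_le_of_le tendsto_const_nhds h0 (fun _ => zero_le)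
      fun n => ?_
    have m1 : AEStronglyMeasurable (fun x => φ n x - p.fst x) (volume.restrict U) :=
      (hφ n).continuous.aestronglyMeasurable.sub (Lp.aestronglyMeasurable _)
    have m2 : AEStronglyMeasurable (fun x => χ n x - r.fst x) (volume.restrict U) :=
      (hχ n).continuous.aestronglyMeasurable.sub (Lp.aestronglyMeasurable _)
    refine le_trans (eLpNorm_mono_ae_real (g := fun x => ‖φ n x - p.fst x‖
      + ‖χ n x - r.fst x‖ + 1 / ((n : ℝ) + 1)) ?_) ?_
    · filter_upwards [(hs n).pair_fst, hS.coeFn_toLp] with x h1 h2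
      rw [Pi.sub_apply, h1, h2]
      exact norm_regSqrt_sub_le _ _ (hδ n) _ _ _
    · refine (eLpNorm_add_le (m1.norm.add m2.norm) aestronglyMeasurable_const (by norm_num)).trans ?_
      gcongr
      refine (eLpNorm_add_le m1.norm m2.norm (by norm_num)).trans ?_
      rw [eLpNorm_norm, eLpNorm_norm]
  have hgrad : ∀ n, ‖(hs n).pair.snd‖ ^ 2 ≤ ‖(hφ n).pair.snd‖ ^ 2 + ‖(hχ n).pair.snd‖ ^ 2 :=
    fun n => norm_sq_pair_snd_regSqrt_le (hφ n) (hχ n) (hδ n)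
  obtain ⟨s, hs, he, hn⟩ := sobolev_lsc (fun n => (hs n).pair_mem) hfst hgrad
    (((((WithLp.continuous_snd 2 _ _).tendsto p).comp hφl).norm.pow 2).add
      ((((WithLp.continuous_snd 2 _ _).tendsto r).comp hχl).norm.pow 2))
  exact ⟨s, hs, by rw [he]; exact hS.coeFn_toLp, hn⟩

end

/-! ### Compactness of the embedding of `H¹₀(U)` into `L²(U)` -/

section

variable {d : ℕ} {U : Set (EuclideanSpace ℝ (Fin d))}

/-- A test function as a Schwartz function. -/
noncomputable def IsTestFun.schwartz {φ : EuclideanSpace ℝ (Fin d) → ℂ} (h : IsTestFun U φ) :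
    SchwartzMap (EuclideanSpace ℝ (Fin d)) ℂ :=
  h.2.1.toSchwartzMap h.1

theorem IsTestFun.coe_schwartz {φ : EuclideanSpace ℝ (Fin d) → ℂ} (h : IsTestFun U φ) :
    (h.schwartz : EuclideanSpace ℝ (Fin d) → ℂ) = φ := rfl

theorem IsTestFun.integral_norm_sq_fourier {φ : EuclideanSpace ℝ (Fin d) → ℂ}
    (h : IsTestFun U φ) : ∫ ξ, ‖𝓕 φ ξ‖ ^ 2 = ‖h.pair.fst‖ ^ 2 := by
  have h1 := h.schwartz.integral_norm_sq_fourier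
  rw [SchwartzMap.fourier_coe, h.coe_schwartz] at h1
  rw [h1, L2_norm_sq, ← setIntegral_eq_integral_of_forall_compl_eq_zero (s := U)
    (fun x hx => by simp [h.eq_zero_of_notMem hx])]
  refine integral_congr_ae ?_
  filter_upwards [h.pair_fst] with x hx
  rw [hx]

theorem IsTestFun.norm_fourier_partialDeriv {φ : EuclideanSpace ℝ (Fin d) → ℂ}
    (h : IsTestFun U φ) (i : Fin d) (ξ : EuclideanSpace ℝ (Fin d)) :
    ‖𝓕 (partialDeriv i φ) ξ‖ = 2 * Real.pi * ‖ξ i‖ * ‖𝓕 φ ξ‖ := by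
  have hi := h.continuous_fderiv.integrable_of_hasCompactSupport (μ := volume) (h.2.1.fderiv ℝ)
  have h1 := Real.fourier_fderiv (f := φ) (h.continuous.integrable_of_hasCompactSupport h.2.1)
    h.differentiable hi
  have h2 := Real.fourier_continuousLinearMap_apply hi (a := EuclideanSpace.single i 1) (v := ξ)
  have h3 : 𝓕 (partialDeriv i φ) ξ = (𝓕 (fderiv ℝ φ) ξ) (EuclideanSpace.single i 1) := h2.symm
  rw [h3, h1]
  simp [VectorFourier.fourierSMulRight_apply, abs_of_pos Real.pi_pos, innerSL_apply_apply ℝ,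
    EuclideanSpace.inner_single_right, mul_assoc, mul_left_comm]

theorem IsTestFun.integrable_norm_sq_fourier {φ : EuclideanSpace ℝ (Fin d) → ℂ}
    (h : IsTestFun U φ) : Integrable fun ξ => ‖𝓕 φ ξ‖ ^ 2 := by
  have := ((𝓕 h.schwartz).memLp 2 volume).norm.integrable_sq
  rwa [SchwartzMap.fourier_coe, h.coe_schwartz] at this

theorem IsTestFun.partialDeriv {F : Type*} [NormedAddCommGroup F] [NormedSpace ℝ F]
    {φ : EuclideanSpace ℝ (Fin d) → F} (h : IsTestFun U φ) (i : Fin d) :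
    IsTestFun U (partialDeriv i φ) := by
  refine ⟨?_, h.hasCompactSupport_partialDeriv i, (tsupport_fderiv_apply_subset ℝ _).trans h.2.2⟩
  exact (h.1.fderiv_right (m := ((⊤ : ℕ∞) : WithTop ℕ∞)) (by simp)).clm_apply contDiff_const

/-- Plancherel for each partial derivative, summed over the coordinates. -/
theorem IsTestFun.integral_norm_sq_mul_norm_sq_fourier {φ : EuclideanSpace ℝ (Fin d) → ℂ}
    (h : IsTestFun U φ) :
    Integrable (fun ξ => (2 * Real.pi * ‖ξ‖) ^ 2 * ‖𝓕 φ ξ‖ ^ 2) ∧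
    ∫ ξ, (2 * Real.pi * ‖ξ‖) ^ 2 * ‖𝓕 φ ξ‖ ^ 2 = ‖h.pair.snd‖ ^ 2 := by
  have e : (fun ξ => (2 * Real.pi * ‖ξ‖) ^ 2 * ‖𝓕 φ ξ‖ ^ 2) =
      fun ξ => ∑ i, ‖𝓕 (_root_.partialDeriv i φ) ξ‖ ^ 2 := by
    ext ξ
    simp only [h.norm_fourier_partialDeriv, mul_pow, EuclideanSpace.norm_sq_eq, Finset.mul_sum,
      Finset.sum_mul]
  rw [e]
  have hi := fun i => (h.partialDeriv i).integrable_norm_sq_fourier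
  refine ⟨integrable_finsetSum _ fun i _ => hi i, ?_⟩
  rw [integral_finsetSum _ fun i _ => hi i]
  have : ∀ i, ∫ x, ‖𝓕 (_root_.partialDeriv i φ) x‖ ^ 2 =
      ∫ x in U, ‖_root_.partialDeriv i φ x‖ ^ 2 := by
    intro i
    rw [(h.partialDeriv i).integral_norm_sq_fourier, L2_norm_sq]
    refine integral_congr_ae ?_
    filter_upwards [(h.partialDeriv i).pair_fst] with x hx
    rw [hx]
  simp only [this]
  rw [← integral_finsetSum _ fun i _ =>
    ((h.partialDeriv i).memLp 2 (volume.restrict U)).norm.integrable_sq, L2_norm_sq]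
  refine integral_congr_ae ?_
  filter_upwards [h.pair_snd] with x hx
  rw [hx, EuclideanSpace.norm_sq_eq]
  rfl

/-- Frequencies are split at `|ξ| = K`; outside the ball, `1 ≤ (2π|ξ|)² / (2πK)²` trades the mass
for the gradient. -/
theorem IsTestFun.norm_sq_pair_fst_le {φ : EuclideanSpace ℝ (Fin d) → ℂ}
    (h : IsTestFun U φ) {K : ℝ} (hK : 0 < K) :
    ‖h.pair.fst‖ ^ 2 ≤ (∫ ξ in Metric.ball 0 K, ‖𝓕 φ ξ‖ ^ 2)
      + ‖h.pair.snd‖ ^ 2 / (2 * Real.pi * K) ^ 2 := by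
  obtain ⟨hi, he⟩ := h.integral_norm_sq_mul_norm_sq_fourier
  rw [← h.integral_norm_sq_fourier, ← he,
    ← integral_add_compl (Metric.isOpen_ball (x := 0) (ε := K)).measurableSet
      h.integrable_norm_sq_fourier]
  gcongr
  rw [le_div_iff₀ (by positivity), ← integral_mul_const]
  refine le_trans ?_ (setIntegral_le_integral hi (Eventually.of_forall fun ξ => by positivity)
    (s := (Metric.ball 0 K)ᶜ))
  refine setIntegral_mono_on (h.integrable_norm_sq_fourier.mul_const _).integrableOn
    hi.integrableOn Metric.isOpen_ball.measurableSet.compl fun ξ hξ => ?_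
  have : K ≤ ‖ξ‖ := by simpa using hξ
  rw [mul_comm]
  have := Real.pi_pos
  gcongr

theorem IsTestFun.sub {F : Type*} [NormedAddCommGroup F] [NormedSpace ℝ F]
    {φ χ : EuclideanSpace ℝ (Fin d) → F}
    (h : IsTestFun U φ) (h' : IsTestFun U χ) : IsTestFun U (fun x => φ x - χ x) := by
  have := h.add (h'.const_smul (-1 : ℝ))
  simpa [sub_eq_add_neg] using this

theorem IsTestFun.pair_sub {φ χ : EuclideanSpace ℝ (Fin d) → ℂ}
    (h : IsTestFun U φ) (h' : IsTestFun U χ) : (h.sub h').pair = h.pair - h'.pair := by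
  apply (WithLp.ofLp_injective 2)
  refine Prod.ext ?_ ?_
  · exact MemLp.toLp_sub (h.memLp 2 _) (h'.memLp 2 _)
  · refine Eq.trans ?_ (MemLp.toLp_sub (h.memLp_classicalGrad 2 _) (h'.memLp_classicalGrad 2 _))
    refine MemLp.toLp_congr ((h.sub h').memLp_classicalGrad 2 _) _ (Eventually.of_forall fun x => ?_)
    ext i
    have := fderiv_fun_sub (h.differentiable x) (h'.differentiable x)
    simp [_root_.partialDeriv, this]

/-- On a set of finite volume the characters are square integrable. Evaluating `𝓕 φ` at a point is
thus an `L²` pairing with a norm bound independent of `ξ`, and weak convergence yields bounded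
pointwise convergence of Fourier transforms. -/
theorem exists_fourier_kernel (hU : volume U ≠ ⊤) (ξ : EuclideanSpace ℝ (Fin d)) :
    ∃ e : Lp ℂ 2 (volume.restrict U), ‖e‖ ≤ √(volume.real U) ∧
      ∀ φ : EuclideanSpace ℝ (Fin d) → ℂ, ∀ h : IsTestFun U φ, 𝓕 φ ξ = inner ℂ e h.pair.fst := by
  have : IsFiniteMeasure (volume.restrict U) := ⟨by simpa using hU.lt_top⟩
  have hm : MemLp (fun x => Complex.exp (((2 * Real.pi * inner ℝ x ξ : ℝ) : ℂ) * Complex.I)) 2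
      (volume.restrict U) := by
    refine MemLp.of_bound (Continuous.aestronglyMeasurable (by fun_prop)) 1
      (Eventually.of_forall fun x => by rw [Complex.norm_exp_ofReal_mul_I])
  refine ⟨hm.toLp, ?_, fun φ h => ?_⟩
  · apply Real.le_sqrt_of_sq_le
    rw [L2_norm_sq]
    rw [integral_congr_ae (g := fun _ => (1 : ℝ))]
    · simp [Measure.real]
    · filter_upwards [hm.coeFn_toLp] with x hx
      rw [hx, Complex.norm_exp_ofReal_mul_I, one_pow]
  · rw [L2.inner_def, Real.fourier_eq', ← setIntegral_eq_integral_of_forall_compl_eq_zero (s := U)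
      (fun x hx => by simp [h.eq_zero_of_notMem hx])]
    refine integral_congr_ae ?_
    filter_upwards [hm.coeFn_toLp, h.pair_fst] with x h1 h2
    rw [h1, h2, RCLike.inner_apply, ← Complex.exp_conj, smul_eq_mul, mul_comm]
    simp [Complex.conj_ofNat]

/-- Along a weakly convergent subsequence the transforms of differences tend to zero pointwise and
stay bounded, so their mass on each ball tends to zero by dominated convergence. The gradient bound
makes the mass outside a large ball uniformly small. Hence the sequence is Cauchy; neither
boundedness of `U` nor regularity of its boundary enters. -/
theorem exists_tendsto_fst_of_bounded_test (hU : volume U ≠ ⊤)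
    {φ : ℕ → EuclideanSpace ℝ (Fin d) → ℂ} (hφ : ∀ n, IsTestFun U (φ n)) {R : ℝ}
    (hR : ∀ n, ‖(hφ n).pair‖ ≤ R) :
    ∃ g : ℕ → ℕ, StrictMono g ∧ ∃ f, Tendsto (fun n => (hφ (g n)).pair.fst) atTop (𝓝 f) := by
  have hR0 : 0 ≤ R := (norm_nonneg _).trans (hR 0)
  have hR1 : ∀ n, ‖(hφ n).pair.fst‖ ≤ R := fun n => (WithLp.norm_fst_le _ _).trans (hR n)
  have hR2 : ∀ n, ‖(hφ n).pair.snd‖ ≤ R := fun n => (WithLp.norm_snd_le _ _).trans (hR n)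
  have : Fact ((2 : ENNReal) ≠ ⊤) := ⟨by norm_num⟩
  obtain ⟨g, hg, y, hy⟩ := exists_weak_subseq hR1
  refine ⟨g, hg, cauchySeq_tendsto_of_complete ?_⟩
  choose e he1 he2 using exists_fourier_kernel hU
  let D : ℕ × ℕ → EuclideanSpace ℝ (Fin d) → ℂ := fun m x => φ (g m.1) x - φ (g m.2) x
  have hD : ∀ m, IsTestFun U (D m) := fun m => (hφ _).sub (hφ _)
  have hDe : ∀ m ξ, 𝓕 (D m) ξ =
      inner ℂ (e ξ) (hφ (g m.1)).pair.fst - inner ℂ (e ξ) (hφ (g m.2)).pair.fst := by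
    intro m ξ
    rw [he2 ξ _ (hD m), IsTestFun.pair_sub (hφ _) (hφ _), WithLp.sub_fst, inner_sub_right]
  have hpt : ∀ ξ, Tendsto (fun m => ‖𝓕 (D m) ξ‖ ^ 2) atTop (𝓝 0) := by
    intro ξ
    have h1 : Tendsto (fun m : ℕ × ℕ => (inner ℂ (e ξ) (hφ (g m.1)).pair.fst
        - inner ℂ (e ξ) (hφ (g m.2)).pair.fst : ℂ)) atTop (𝓝 0) := by
      rw [← prod_atTop_atTop_eq, ← sub_self (inner ℂ (e ξ) y)]
      exact ((hy (e ξ)).comp tendsto_fst).sub ((hy (e ξ)).comp tendsto_snd)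
    have := (h1.norm.pow 2)
    simpa [hDe] using this
  have hbd : ∀ m ξ, ‖𝓕 (D m) ξ‖ ≤ √(volume.real U) * R + √(volume.real U) * R := by
    intro m ξ
    rw [hDe]
    refine (norm_sub_le _ _).trans (add_le_add ?_ ?_)
    all_goals
      refine (norm_inner_le_norm _ _).trans ?_
      gcongr
      · exact he1 ξ
      · exact hR1 _
  have hloc : ∀ K : ℝ, Tendsto (fun m => ∫ ξ in Metric.ball 0 K, ‖𝓕 (D m) ξ‖ ^ 2) atTop
      (𝓝 0) := by
    intro K
    have : IsFiniteMeasure (volume.restrict (Metric.ball (0 : EuclideanSpace ℝ (Fin d)) K)) :=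
      ⟨by simpa using measure_ball_lt_top⟩
    have := tendsto_integral_filter_of_dominated_convergence
      (μ := volume.restrict (Metric.ball (0 : EuclideanSpace ℝ (Fin d)) K))
      (F := fun m ξ => ‖𝓕 (D m) ξ‖ ^ 2) (l := atTop) (f := fun _ => 0)
      (fun _ => (√(volume.real U) * R + √(volume.real U) * R) ^ 2)
      (Eventually.of_forall fun m => (hD m).integrable_norm_sq_fourier.1.restrict)
      (Eventually.of_forall fun m => Eventually.of_forall fun ξ => by
        rw [norm_pow, norm_norm]
        gcongr
        exact hbd m ξ)
      (integrable_const _) (Eventually.of_forall hpt)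
    simpa using this
  have hdist : ∀ m : ℕ × ℕ, dist (hφ (g m.1)).pair.fst (hφ (g m.2)).pair.fst
      = ‖(hD m).pair.fst‖ := by
    intro m
    rw [dist_eq_norm, IsTestFun.pair_sub (hφ _) (hφ _), WithLp.sub_fst]
  rw [cauchySeq_iff_tendsto_dist_atTop_0]
  simp only [hdist]
  have hR3 : ∀ m, ‖(hD m).pair.snd‖ ≤ R + R := by
    intro m
    rw [IsTestFun.pair_sub (hφ _) (hφ _), WithLp.sub_snd]
    exact (norm_sub_le _ _).trans (add_le_add (hR2 _) (hR2 _))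
  have hsq : Tendsto (fun m => ‖(hD m).pair.fst‖ ^ 2) atTop (𝓝 0) := by
    have hpi := Real.pi_pos
    rw [Metric.tendsto_nhds]
    intro ε hε
    obtain ⟨K, hK0, hK⟩ : ∃ K : ℝ, 0 < K ∧ (R + R) ^ 2 / (2 * Real.pi * K) ^ 2 < ε / 2 := by
      have : Tendsto (fun K : ℝ => (R + R) ^ 2 / (2 * Real.pi * K) ^ 2) atTop (𝓝 0) := by
        refine Tendsto.const_div_atTop ?_ _
        exact (tendsto_pow_atTop two_ne_zero).comp
          (tendsto_id.const_mul_atTop (by positivity : (0 : ℝ) < 2 * Real.pi))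
      obtain ⟨K, h1, h2⟩ := ((eventually_gt_atTop 0).and
        (this.eventually (gt_mem_nhds (half_pos hε)))).exists
      exact ⟨K, h1, h2⟩
    filter_upwards [(hloc K).eventually (gt_mem_nhds (half_pos hε))] with m hm
    rw [Real.dist_eq, sub_zero, abs_of_nonneg (by positivity)]
    calc _ ≤ _ := (hD m).norm_sq_pair_fst_le hK0
      _ ≤ (∫ ξ in Metric.ball 0 K, ‖𝓕 (D m) ξ‖ ^ 2) + (R + R) ^ 2 / (2 * Real.pi * K) ^ 2 := by
        gcongr
        exact hR3 m
      _ < ε := by linarith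
  simpa [Real.sqrt_sq (norm_nonneg _)] using hsq.sqrt

end

/-! ### Interactions of positive type -/

section FourierInversion

variable {d : ℕ}

/-- Fourier inversion almost everywhere. -/
theorem ae_eq_fourierInv_fourier {f : EuclideanSpace ℝ (Fin d) → ℂ} (hf : Integrable f)
    (hf' : Integrable (𝓕 f)) : f =ᵐ[volume] 𝓕⁻ (𝓕 f) := by
  have hc : Continuous (𝓕⁻ (𝓕 f)) := by
    rw [Real.fourierInv_eq_fourier_comp_neg]
    exact VectorFourier.fourierIntegral_continuous Real.continuous_fourierChar
      continuous_inner hf'.comp_neg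
  -- No continuity of `f` is available, so both sides are tested against a smooth `g`: the
  -- multiplication formula turns each integral into `∫ 𝓕 f · 𝓕⁻ g`.
  refine ae_eq_of_integral_contDiff_smul_eq hf.locallyIntegrable hc.locallyIntegrable
    fun g hg hg' => ?_
  have hG : IsTestFun univ (fun x => (g x : ℂ)) :=
    ⟨Complex.ofRealCLM.contDiff.comp hg, hg'.comp_left (g := ((↑) : ℝ → ℂ)) (by simp),
      subset_univ _⟩
  obtain ⟨H, hH⟩ : ∃ H : SchwartzMap (EuclideanSpace ℝ (Fin d)) ℂ, H = 𝓕⁻ hG.schwartz := ⟨_, rfl⟩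
  have hGS : 𝓕 H = hG.schwartz := by
    rw [hH]; exact FourierTransform.fourier_fourierInv_eq _
  have h1 : ∫ x, f x * (g x : ℂ) = ∫ ξ, 𝓕 f ξ * H ξ := by
    have := VectorFourier.integral_fourierIntegral_smul_eq_flip (L := innerₗ _) (μ := volume)
      (ν := volume) Real.continuous_fourierChar continuous_inner hf H.integrable
    have e : 𝓕 (H : EuclideanSpace ℝ (Fin d) → ℂ) = fun x => (g x : ℂ) := by
      rw [← SchwartzMap.fourier_coe, hGS]; rfl
    have e2 : VectorFourier.fourierIntegral Real.fourierChar volume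
      (innerₗ (EuclideanSpace ℝ (Fin d))).flip H = fun x => (g x : ℂ) := by
      rw [flip_innerₗ]; exact e
    rw [e2] at this
    exact this.symm
  have h2 : ∫ x, 𝓕⁻ (𝓕 f) x * (g x : ℂ) = ∫ ξ, 𝓕 f ξ * H ξ := by
    have := VectorFourier.integral_fourierIntegral_smul_eq_flip (L := innerₗ _) (μ := volume)
      (ν := volume) Real.continuous_fourierChar continuous_inner hf' hG.schwartz.integrable.comp_neg
    rw [flip_innerₗ] at this
    have e : (H : EuclideanSpace ℝ (Fin d) → ℂ) =
        𝓕 (fun x => hG.schwartz (-x)) := by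
      rw [hH, SchwartzMap.fourierInv_coe, Real.fourierInv_eq_fourier_comp_neg]
    rw [e]
    refine Eq.trans ?_ this
    rw [← integral_neg_eq_self]
    refine integral_congr_ae (Eventually.of_forall fun x => ?_)
    show 𝓕⁻ (𝓕 f) (-x) * _ = 𝓕 (𝓕 f) x * _
    rw [Real.fourierInv_eq_fourier_neg, neg_neg]
    rfl
  simpa [mul_comm] using h1.trans h2.symm

end FourierInversion

/-- A continuous bounded even function of positive type. -/
structure IsPosKernel {d : ℕ} (w : EuclideanSpace ℝ (Fin d) → ℝ) : Prop where
  continuous : Continuous w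
  bounded : ∃ C, ∀ x, |w x| ≤ C
  even : ∀ x, w (-x) = w x
  nonneg : ∀ (μ : Measure (EuclideanSpace ℝ (Fin d))) [SFinite μ]
    (f : EuclideanSpace ℝ (Fin d) → ℝ), Integrable f μ →
      0 ≤ ∫ z, w (z.1 - z.2) * f z.1 * f z.2 ∂(μ.prod μ)

/-- The easy direction of Bochner's theorem: `cos(a - b) = cos a cos b + sin a sin b`, so the double
integral is that of `m(ξ)` times a sum of two squares. -/
theorem isPosKernel_integral_cos {d : ℕ} {m : EuclideanSpace ℝ (Fin d) → ℝ} (hm : Integrable m)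
    (hm0 : ∀ ξ, 0 ≤ m ξ) :
    IsPosKernel fun x => ∫ ξ, Real.cos (2 * Real.pi * inner ℝ ξ x) * m ξ := by
  refine ⟨?_, ⟨∫ ξ, m ξ, fun x => ?_⟩, fun x => ?_, fun μ _ f hf => ?_⟩
  · refine continuous_of_dominated (bound := m) (fun x => ?_) (fun x => ?_) hm ?_
    · exact (Continuous.aestronglyMeasurable (by fun_prop)).mul hm.1
    · refine Eventually.of_forall fun ξ => ?_
      rw [norm_mul, Real.norm_of_nonneg (hm0 ξ)]
      exact mul_le_of_le_one_left (hm0 ξ) (Real.abs_cos_le_one _)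
    · exact Eventually.of_forall fun ξ => by fun_prop
  · rw [← Real.norm_eq_abs]
    refine norm_integral_le_of_norm_le hm (Eventually.of_forall fun ξ => ?_)
    rw [norm_mul, Real.norm_of_nonneg (hm0 ξ)]
    exact mul_le_of_le_one_left (hm0 ξ) (Real.abs_cos_le_one _)
  · simp
  · have hint : Integrable (Function.uncurry fun (z : EuclideanSpace ℝ (Fin d) ×
        EuclideanSpace ℝ (Fin d)) (ξ : EuclideanSpace ℝ (Fin d)) =>
        Real.cos (2 * Real.pi * inner ℝ ξ (z.1 - z.2)) * ((f z.1 * f z.2) * m ξ))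
        ((μ.prod μ).prod volume) := by
      refine ((hf.mul_prod hf).mul_prod hm).bdd_mul (c := 1) ?_ ?_
      · exact Continuous.aestronglyMeasurable (by fun_prop)
      · exact Eventually.of_forall fun _ => Real.abs_cos_le_one _
    have e : ∀ z : EuclideanSpace ℝ (Fin d) × EuclideanSpace ℝ (Fin d),
        (∫ ξ, Real.cos (2 * Real.pi * inner ℝ ξ (z.1 - z.2)) * m ξ) * f z.1 * f z.2 =
        ∫ ξ, Real.cos (2 * Real.pi * inner ℝ ξ (z.1 - z.2)) * ((f z.1 * f z.2) * m ξ) := by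
      intro z
      rw [mul_assoc, ← integral_mul_const]
      congr with ξ
      ring
    simp only [e]
    rw [integral_integral_swap hint]
    refine integral_nonneg fun ξ => ?_
    have hcs : ∀ g : ℝ → ℝ, Continuous g → (∀ t, |g t| ≤ 1) →
        Integrable (fun x => g (2 * Real.pi * inner ℝ ξ x) * f x) μ := by
      intro g hg hg1
      refine hf.bdd_mul (c := 1) (Continuous.aestronglyMeasurable (by fun_prop)) ?_
      exact Eventually.of_forall fun x => hg1 _
    have hc := hcs _ Real.continuous_cos Real.abs_cos_le_one
    have hs := hcs _ Real.continuous_sin Real.abs_sin_le_one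
    have e2 : ∀ z : EuclideanSpace ℝ (Fin d) × EuclideanSpace ℝ (Fin d),
        Real.cos (2 * Real.pi * inner ℝ ξ (z.1 - z.2)) * ((f z.1 * f z.2) * m ξ) =
        ((Real.cos (2 * Real.pi * inner ℝ ξ z.1) * f z.1) *
          (Real.cos (2 * Real.pi * inner ℝ ξ z.2) * f z.2) +
        (Real.sin (2 * Real.pi * inner ℝ ξ z.1) * f z.1) *
          (Real.sin (2 * Real.pi * inner ℝ ξ z.2) * f z.2)) * m ξ := by
      intro z
      rw [inner_sub_right, mul_sub, Real.cos_sub]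
      ring
    simp only [e2]
    rw [integral_mul_const, integral_add (hc.mul_prod hc) (hs.mul_prod hs),
      integral_prod_mul (fun x => Real.cos (2 * Real.pi * inner ℝ ξ x) * f x)
        (fun x => Real.cos (2 * Real.pi * inner ℝ ξ x) * f x),
      integral_prod_mul (fun x => Real.sin (2 * Real.pi * inner ℝ ξ x) * f x)
        (fun x => Real.sin (2 * Real.pi * inner ℝ ξ x) * f x)]
    exact mul_nonneg (add_nonneg (mul_self_nonneg _) (mul_self_nonneg _)) (hm0 ξ)

/-- The real part of the inversion formula is a cosine integral of `v̂ ≥ 0`. Only integrals of `y ↦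
v (x - y)` occur in the problem, so `v` may be replaced by this continuous and bounded version. -/
theorem IsInteraction.exists_posKernel {d : ℕ} {v : EuclideanSpace ℝ (Fin d) → ℝ}
    (hv : IsInteraction v) : ∃ w, IsPosKernel w ∧ v =ᵐ[volume] w := by
  set m : EuclideanSpace ℝ (Fin d) → ℝ := fun ξ => (𝓕 (fun x => (v x : ℂ)) ξ).re with hmdef
  have hm : Integrable m := hv.fourier_integrable.re
  have hmc : 𝓕 (fun x => (v x : ℂ)) = fun ξ => (m ξ : ℂ) := by
    ext ξ
    exact Complex.ext (by simp [hmdef]) (by simp [(hv.fourier_nonneg ξ).2])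
  refine ⟨_, isPosKernel_integral_cos hm fun ξ => (hv.fourier_nonneg ξ).1, ?_⟩
  filter_upwards [ae_eq_fourierInv_fourier (memLp_one_iff_integrable.1 hv.memLp_one).ofReal
    hv.fourier_integrable] with x hx
  have h1 : v x = (𝓕⁻ (𝓕 (fun x => (v x : ℂ))) x).re := by
    exact congrArg Complex.re hx
  rw [h1, hmc, Real.fourierInv_eq', ← RCLike.re_eq_complex_re, ← integral_re]
  · congr with ξ
    rw [RCLike.re_eq_complex_re, smul_eq_mul, Complex.re_mul_ofReal, Complex.exp_ofReal_mul_I_re]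
  · refine hm.ofReal.bdd_mul (c := 1) (Continuous.aestronglyMeasurable (by fun_prop)) ?_
    exact Eventually.of_forall fun ξ => by rw [Complex.norm_exp_ofReal_mul_I]

/-! ### Changes of the kernel on null sets, and the bilinear form of a kernel. -/

section Kernel

variable {d : ℕ} {v w : EuclideanSpace ℝ (Fin d) → ℝ}

theorem ae_eq_comp_sub_left (h : v =ᵐ[volume] w) (x : EuclideanSpace ℝ (Fin d)) :
    (fun y => v (x - y)) =ᵐ[volume] fun y => w (x - y) :=
  (quasiMeasurePreserving_sub_left volume x).ae_eq h

theorem interactionEnergy_congr (h : v =ᵐ[volume] w) (A : Set (EuclideanSpace ℝ (Fin d)))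
    (ψ : EuclideanSpace ℝ (Fin d) → ℂ) : interactionEnergy A v ψ = interactionEnergy A w ψ := by
  unfold interactionEnergy
  congr with x
  refine integral_congr_ae (ae_restrict_of_ae ?_)
  filter_upwards [ae_eq_comp_sub_left h x] with y hy
  rw [hy]

theorem densityConv_congr (h : v =ᵐ[volume] w) (A : Set (EuclideanSpace ℝ (Fin d)))
    (ψ : EuclideanSpace ℝ (Fin d) → ℂ) : densityConv A v ψ = densityConv A w ψ := by
  ext x
  refine integral_congr_ae (ae_restrict_of_ae ?_)
  filter_upwards [ae_eq_comp_sub_left h x] with y hy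
  rw [hy]

/-- The mean-field operator integrates over the whole vacancy set, the Hartree functional over one
component. For a function extended by zero the two domains give the same result. -/
theorem densityConv_indicator {A U : Set (EuclideanSpace ℝ (Fin d))} (hU : MeasurableSet U)
    (hA : U ⊆ A) (v : EuclideanSpace ℝ (Fin d) → ℝ) (u : EuclideanSpace ℝ (Fin d) → ℂ) :
    densityConv A v (U.indicator u) = densityConv U v u := by
  ext x
  unfold densityConv
  have : (fun y => ‖U.indicator u y‖ ^ 2 * v (x - y)) =
      U.indicator fun y => ‖u y‖ ^ 2 * v (x - y) := by
    ext y
    by_cases hy : y ∈ U <;> simp [hy]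
  rw [this, setIntegral_indicator hU, inter_eq_right.2 hA]

theorem interactionEnergy_indicator {A U : Set (EuclideanSpace ℝ (Fin d))} (hU : MeasurableSet U)
    (hA : U ⊆ A) (v : EuclideanSpace ℝ (Fin d) → ℝ) (u : EuclideanSpace ℝ (Fin d) → ℂ) :
    interactionEnergy A v (U.indicator u) = interactionEnergy U v u := by
  unfold interactionEnergy
  have h1 : (fun x => ∫ y in A, v (x - y) * ‖U.indicator u x‖ ^ 2 * ‖U.indicator u y‖ ^ 2) =
      U.indicator fun x => ∫ y in U, v (x - y) * ‖u x‖ ^ 2 * ‖u y‖ ^ 2 := by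
    ext x
    by_cases hx : x ∈ U
    · have : (fun y => v (x - y) * ‖U.indicator u x‖ ^ 2 * ‖U.indicator u y‖ ^ 2) =
          U.indicator fun y => v (x - y) * ‖u x‖ ^ 2 * ‖u y‖ ^ 2 := by
        ext y
        by_cases hy : y ∈ U <;> simp [hx, hy]
      rw [this, setIntegral_indicator hU, inter_eq_right.2 hA, indicator_of_mem hx]
    · simp [hx]
  rw [h1, setIntegral_indicator hU, inter_eq_right.2 hA]

/-- `∬ w(x - y) f(x) g(y) dμ dμ`. -/
noncomputable def kernelForm (w : EuclideanSpace ℝ (Fin d) → ℝ)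
    (μ : Measure (EuclideanSpace ℝ (Fin d))) (f g : EuclideanSpace ℝ (Fin d) → ℝ) : ℝ :=
  ∫ z, w (z.1 - z.2) * f z.1 * g z.2 ∂(μ.prod μ)

variable {μ : Measure (EuclideanSpace ℝ (Fin d))}
  {f f' g g' : EuclideanSpace ℝ (Fin d) → ℝ}

theorem IsPosKernel.integrable (hw : IsPosKernel w) (hf : Integrable f μ) (hg : Integrable g μ) :
    Integrable (fun z => w (z.1 - z.2) * f z.1 * g z.2) (μ.prod μ) := by
  obtain ⟨C, hC⟩ := hw.bounded
  simp only [mul_assoc]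
  exact (hf.mul_prod hg).bdd_mul (c := C)
    (hw.continuous.comp (continuous_fst.sub continuous_snd)).aestronglyMeasurable
    (Eventually.of_forall fun z => hC _)

theorem IsPosKernel.kernelForm_comm [SFinite μ] (hw : IsPosKernel w) :
    kernelForm w μ f g = kernelForm w μ g f := by
  unfold kernelForm
  rw [← integral_prod_swap]
  congr with z
  simp only [Prod.fst_swap, Prod.snd_swap]
  rw [← neg_sub z.1 z.2, hw.even]
  ring

theorem IsPosKernel.kernelForm_combo_left [SFinite μ] (hw : IsPosKernel w) (hf : Integrable f μ)
    (hf' : Integrable f' μ) (hg : Integrable g μ) (a b : ℝ) :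
    kernelForm w μ (fun x => a * f x + b * f' x) g =
      a * kernelForm w μ f g + b * kernelForm w μ f' g := by
  unfold kernelForm
  rw [← integral_const_mul, ← integral_const_mul, ← integral_add
    ((hw.integrable hf hg).const_mul a) ((hw.integrable hf' hg).const_mul b)]
  congr with z
  ring

theorem IsPosKernel.kernelForm_combo [SFinite μ] (hw : IsPosKernel w) (hf : Integrable f μ)
    (hf' : Integrable f' μ) (a b : ℝ) :
    kernelForm w μ (fun x => a * f x + b * f' x) (fun x => a * f x + b * f' x) =
      a ^ 2 * kernelForm w μ f f + 2 * a * b * kernelForm w μ f f'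
        + b ^ 2 * kernelForm w μ f' f' := by
  have hs : Integrable (fun x => a * f x + b * f' x) μ := (hf.const_mul a).add (hf'.const_mul b)
  rw [hw.kernelForm_combo_left hf hf' hs, hw.kernelForm_comm (f := f),
    hw.kernelForm_comm (f := f'), hw.kernelForm_combo_left hf hf' hf,
    hw.kernelForm_combo_left hf hf' hf', hw.kernelForm_comm (f := f') (g := f)]
  ring

theorem kernelForm_congr (hf : f =ᵐ[μ] f') (hg : g =ᵐ[μ] g') :
    kernelForm w μ f g = kernelForm w μ f' g' := by
  refine integral_congr_ae ?_
  filter_upwards [Measure.quasiMeasurePreserving_fst.ae_eq hf,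
    Measure.quasiMeasurePreserving_snd.ae_eq hg] with z h1 h2
  have h1' : f z.1 = f' z.1 := h1
  have h2' : g z.2 = g' z.2 := h2
  rw [h1', h2']

theorem abs_kernelForm_le [SFinite μ] {C : ℝ} (hC : ∀ x, |w x| ≤ C) (hf : Integrable f μ)
    (hg : Integrable g μ) :
    |kernelForm w μ f g| ≤ C * ((∫ x, |f x| ∂μ) * ∫ x, |g x| ∂μ) := by
  unfold kernelForm
  rw [← integral_prod_mul (fun x => |f x|) (fun x => |g x|), ← integral_const_mul,
    ← Real.norm_eq_abs]
  refine norm_integral_le_of_norm_le ((hf.abs.mul_prod hg.abs).const_mul C)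
    (Eventually.of_forall fun z => ?_)
  rw [mul_assoc, norm_mul, norm_mul, Real.norm_eq_abs, Real.norm_eq_abs, Real.norm_eq_abs]
  gcongr
  exact hC _

theorem IsPosKernel.interactionEnergy_eq (hw : IsPosKernel w)
    {U : Set (EuclideanSpace ℝ (Fin d))} {ψ : EuclideanSpace ℝ (Fin d) → ℂ}
    (hψ : MemLp ψ 2 (volume.restrict U)) :
    interactionEnergy U w ψ
      = kernelForm w (volume.restrict U) (fun x => ‖ψ x‖ ^ 2) (fun x => ‖ψ x‖ ^ 2) := by
  have hi : Integrable (fun x => ‖ψ x‖ ^ 2) (volume.restrict U) := hψ.norm.integrable_sq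
  rw [kernelForm, integral_prod _ (hw.integrable hi hi)]
  rfl

theorem IsPosKernel.integral_densityConv_mul (hw : IsPosKernel w)
    {U : Set (EuclideanSpace ℝ (Fin d))} {u : EuclideanSpace ℝ (Fin d) → ℂ}
    (hu : MemLp u 2 (volume.restrict U)) (hg : Integrable g (volume.restrict U)) :
    ∫ x in U, densityConv U w u x * g x
      = kernelForm w (volume.restrict U) g (fun x => ‖u x‖ ^ 2) := by
  have hi : Integrable (fun x => ‖u x‖ ^ 2) (volume.restrict U) := hu.norm.integrable_sq
  rw [kernelForm, integral_prod _ (hw.integrable hg hi)]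
  refine integral_congr_ae (Eventually.of_forall fun x => ?_)
  simp only [densityConv]
  rw [← integral_mul_const]
  congr with y
  ring

theorem IsPosKernel.continuous_densityConv (hw : IsPosKernel w)
    {U : Set (EuclideanSpace ℝ (Fin d))} {u : EuclideanSpace ℝ (Fin d) → ℂ}
    (hu : MemLp u 2 (volume.restrict U)) : Continuous (densityConv U w u) := by
  have hi : Integrable (fun x => ‖u x‖ ^ 2) (volume.restrict U) := hu.norm.integrable_sq
  obtain ⟨C, hC⟩ := hw.bounded
  refine continuous_of_dominated (bound := fun y => ‖u y‖ ^ 2 * C) (fun x => ?_) (fun x => ?_)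
    (hi.mul_const C) ?_
  · exact hi.1.mul (hw.continuous.comp (continuous_const.sub continuous_id)).aestronglyMeasurable
  · refine Eventually.of_forall fun y => ?_
    rw [norm_mul, Real.norm_of_nonneg (by positivity)]
    gcongr
    exact hC _
  · exact Eventually.of_forall fun y =>
      continuous_const.mul (hw.continuous.comp (continuous_id.sub continuous_const))

theorem IsPosKernel.abs_densityConv_le {C : ℝ} (hC : ∀ x, |w x| ≤ C)
    {U : Set (EuclideanSpace ℝ (Fin d))} {u : EuclideanSpace ℝ (Fin d) → ℂ}
    (hu : MemLp u 2 (volume.restrict U)) (x : EuclideanSpace ℝ (Fin d)) :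
    |densityConv U w u x| ≤ (∫ y in U, ‖u y‖ ^ 2) * C := by
  have hi : Integrable (fun x => ‖u x‖ ^ 2) (volume.restrict U) := hu.norm.integrable_sq
  rw [← integral_mul_const, ← Real.norm_eq_abs]
  refine norm_integral_le_of_norm_le (hi.mul_const C) (Eventually.of_forall fun y => ?_)
  rw [norm_mul, Real.norm_of_nonneg (by positivity)]
  gcongr
  exact hC _

end Kernel

/-! ### Schrödinger forms with bounded potentials -/

section Form

variable {d : ℕ} {U : Set (EuclideanSpace ℝ (Fin d))}

/-- `V` is a bounded measurable potential on `U`. -/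
structure IsBddPotential (U : Set (EuclideanSpace ℝ (Fin d)))
    (V : EuclideanSpace ℝ (Fin d) → ℝ) : Prop where
  meas : AEStronglyMeasurable V (volume.restrict U)
  bounded : ∃ C, ∀ x, |V x| ≤ C

/-- The form `⟨∇φ, ∇ψ⟩ + ⟨φ, V ψ⟩`. -/
noncomputable def schrodingerForm (V : EuclideanSpace ℝ (Fin d) → ℝ) (p r : SobolevPair U) : ℂ :=
  inner ℂ p.snd r.snd + ∫ x in U, (V x : ℂ) * (conj (p.fst x) * r.fst x)

/-- The quadratic form of `schrodingerForm`. -/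
noncomputable def schrodingerEnergy (V : EuclideanSpace ℝ (Fin d) → ℝ) (p : SobolevPair U) : ℝ :=
  ‖p.snd‖ ^ 2 + ∫ x in U, V x * ‖p.fst x‖ ^ 2

variable {V : EuclideanSpace ℝ (Fin d) → ℝ}

theorem L2_integrable_sq {α F : Type*} [MeasurableSpace α] {μ : Measure α} [NormedAddCommGroup F]
    (f : Lp F 2 μ) : Integrable (fun x => ‖f x‖ ^ 2) μ :=
  (Lp.memLp f).norm.integrable_sq

theorem IsBddPotential.integrable_mul (hV : IsBddPotential U V) {f : EuclideanSpace ℝ (Fin d) → ℝ}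
    (hf : Integrable f (volume.restrict U)) :
    Integrable (fun x => V x * f x) (volume.restrict U) := by
  obtain ⟨C, hC⟩ := hV.bounded
  exact hf.bdd_mul hV.meas (Eventually.of_forall hC)

theorem IsBddPotential.integrable (hV : IsBddPotential U V) (f g : Lp ℂ 2 (volume.restrict U)) :
    Integrable (fun x => (V x : ℂ) * (conj (f x) * g x)) (volume.restrict U) := by
  obtain ⟨C, hC⟩ := hV.bounded
  have h := L2.integrable_inner (𝕜 := ℂ) f g
  simp only [RCLike.inner_apply'] at h
  exact h.bdd_mul (c := C) (Complex.continuous_ofReal.comp_aestronglyMeasurable hV.meas)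
    (Eventually.of_forall fun x => by simpa using hC x)

theorem schrodingerForm_self (V : EuclideanSpace ℝ (Fin d) → ℝ) (p : SobolevPair U) :
    schrodingerForm V p p = (schrodingerEnergy V p : ℂ) := by
  rw [schrodingerForm, schrodingerEnergy, inner_self_eq_norm_sq_to_K, Complex.ofReal_add,
    Complex.ofReal_pow]
  congr 1
  refine Eq.trans ?_ integral_ofReal
  congr with x
  rw [← Complex.normSq_eq_conj_mul_self, Complex.normSq_eq_norm_sq]
  push_cast
  rfl

theorem IsBddPotential.form_add_right (hV : IsBddPotential U V) (p r s : SobolevPair U) :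
    schrodingerForm V p (r + s) = schrodingerForm V p r + schrodingerForm V p s := by
  have : ∫ x in U, (V x : ℂ) * (conj (p.fst x) * (r + s).fst x) =
      (∫ x in U, (V x : ℂ) * (conj (p.fst x) * r.fst x))
        + ∫ x in U, (V x : ℂ) * (conj (p.fst x) * s.fst x) := by
    rw [← integral_add (hV.integrable _ _) (hV.integrable _ _)]
    refine integral_congr_ae ?_
    filter_upwards [Lp.coeFn_add r.fst s.fst] with x hx
    rw [WithLp.add_fst, hx, Pi.add_apply]
    ring
  rw [schrodingerForm, this, WithLp.add_snd, inner_add_right, schrodingerForm, schrodingerForm]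
  ring

theorem form_smul_right (V : EuclideanSpace ℝ (Fin d) → ℝ) (p r : SobolevPair U) (c : ℂ) :
    schrodingerForm V p (c • r) = c * schrodingerForm V p r := by
  have : ∫ x in U, (V x : ℂ) * (conj (p.fst x) * (c • r).fst x) =
      c * ∫ x in U, (V x : ℂ) * (conj (p.fst x) * r.fst x) := by
    rw [← integral_const_mul]
    refine integral_congr_ae ?_
    filter_upwards [Lp.coeFn_smul c r.fst] with x hx
    rw [WithLp.smul_fst, hx, Pi.smul_apply, smul_eq_mul]
    ring
  rw [schrodingerForm, this, WithLp.smul_snd, inner_smul_right, schrodingerForm]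
  ring

theorem form_conj_symm (V : EuclideanSpace ℝ (Fin d) → ℝ) (p r : SobolevPair U) :
    conj (schrodingerForm V p r) = schrodingerForm V r p := by
  rw [schrodingerForm, schrodingerForm, map_add, inner_conj_symm, ← integral_conj]
  congr 2 with x
  simp only [map_mul, Complex.conj_ofReal, Complex.conj_conj]
  ring

theorem IsBddPotential.energy_add_smul (hV : IsBddPotential U V) (p r : SobolevPair U) (c : ℂ) :
    schrodingerEnergy V (p + c • r) = schrodingerEnergy V p
      + 2 * (c * schrodingerForm V p r).re + ‖c‖ ^ 2 * schrodingerEnergy V r := by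
  have h : schrodingerForm V (p + c • r) (p + c • r) = schrodingerForm V p p
      + (c * schrodingerForm V p r + conj (c * schrodingerForm V p r))
      + conj c * c * schrodingerForm V r r := by
    rw [hV.form_add_right, form_smul_right, ← form_conj_symm V p, ← form_conj_symm V r,
      hV.form_add_right, hV.form_add_right, form_smul_right, form_smul_right]
    simp only [map_add, map_mul, form_conj_symm, schrodingerForm_self, Complex.conj_ofReal]
    ring
  rw [schrodingerForm_self, schrodingerForm_self, schrodingerForm_self,
    Complex.add_conj, ← Complex.normSq_eq_conj_mul_self, Complex.normSq_eq_norm_sq] at h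
  exact_mod_cast h

theorem energy_smul (V : EuclideanSpace ℝ (Fin d) → ℝ) (r : SobolevPair U) (c : ℂ) :
    schrodingerEnergy V (c • r) = ‖c‖ ^ 2 * schrodingerEnergy V r := by
  have h : schrodingerForm V (c • r) (c • r) = conj c * c * schrodingerForm V r r := by
    rw [form_smul_right, ← form_conj_symm V r, form_smul_right]
    simp only [map_mul, schrodingerForm_self, Complex.conj_ofReal]
    ring
  rw [schrodingerForm_self, schrodingerForm_self,
    ← Complex.normSq_eq_conj_mul_self, Complex.normSq_eq_norm_sq] at h
  exact_mod_cast h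

theorem IsBddPotential.energy_parallelogram (hV : IsBddPotential U V) (p r : SobolevPair U) :
    schrodingerEnergy V (p + r) + schrodingerEnergy V (p - r)
      = 2 * schrodingerEnergy V p + 2 * schrodingerEnergy V r := by
  have h1 := hV.energy_add_smul p r 1
  have h2 := hV.energy_add_smul p r (-1)
  simp only [one_smul, neg_smul, ← sub_eq_add_neg] at h1 h2
  rw [h1, h2]
  simp
  ring

/-- A null vector of a nonnegative form is orthogonal to everything. -/
theorem IsBddPotential.form_eq_zero (hV : IsBddPotential U V)
    (hpos : ∀ p ∈ sobolev U, 0 ≤ schrodingerEnergy V p) {p r : SobolevPair U}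
    (hp : p ∈ sobolev U) (hr : r ∈ sobolev U) (h0 : schrodingerEnergy V r = 0) :
    schrodingerForm V p r = 0 := by
  set B := schrodingerForm V p r
  have key : ∀ t : ℝ, 0 ≤ schrodingerEnergy V p - 2 * t * ‖B‖ ^ 2 := by
    intro t
    -- The phase `conj B` makes the cross term equal to `-2t‖B‖²`, and there is no quadratic term
    -- since `r` is null.
    have h := hpos (p + (-(t : ℂ) * conj B) • r)
      ((sobolev U).add_mem hp ((sobolev U).smul_mem _ hr))
    rw [hV.energy_add_smul, h0] at h
    have e : (-(t : ℂ) * conj B * B).re = -t * ‖B‖ ^ 2 := by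
      rw [mul_assoc, ← Complex.normSq_eq_conj_mul_self, Complex.normSq_eq_norm_sq]
      norm_cast
    rw [show schrodingerForm V p r = B from rfl, e] at h
    linarith
  by_contra hB
  have hB' : 0 < ‖B‖ ^ 2 := by positivity
  -- This `t` turns the lower bound into `0 ≤ -1`.
  have h := key ((schrodingerEnergy V p + 1) / (2 * ‖B‖ ^ 2))
  field_simp at h
  linarith

/-- The cross term vanishes by `form_eq_zero`, so the null vectors form a complex subspace. -/
theorem IsBddPotential.energy_add_smul_eq_zero (hV : IsBddPotential U V)
    (hpos : ∀ p ∈ sobolev U, 0 ≤ schrodingerEnergy V p) {p r : SobolevPair U}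
    (hp : p ∈ sobolev U) (hr : r ∈ sobolev U) (h0 : schrodingerEnergy V p = 0)
    (h1 : schrodingerEnergy V r = 0) (c : ℂ) : schrodingerEnergy V (p + c • r) = 0 := by
  rw [hV.energy_add_smul, hV.form_eq_zero hpos hp hr h1, h0, h1]
  simp

/-! ### Moduli and minima in `H¹₀`. -/

theorem exists_abs_mem_sobolev (hU : volume U ≠ ⊤) {p : SobolevPair U} (hp : p ∈ sobolev U) :
    ∃ s ∈ sobolev U, (s.fst =ᵐ[volume.restrict U] fun x => ((‖p.fst x‖ : ℝ) : ℂ)) ∧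
      ‖s.snd‖ ^ 2 ≤ ‖p.snd‖ ^ 2 := by
  obtain ⟨s, hs, h1, h2⟩ := exists_sqrt_mem_sobolev hU hp (sobolev U).zero_mem
  refine ⟨s, hs, ?_, by simpa using h2⟩
  filter_upwards [h1, Lp.coeFn_zero ℂ 2 (volume.restrict U)] with x hx h0
  rw [hx, WithLp.zero_fst, h0]
  simp [Real.sqrt_sq (norm_nonneg _)]

theorem exists_abs_energy_le (hU : volume U ≠ ⊤) (V : EuclideanSpace ℝ (Fin d) → ℝ)
    {p : SobolevPair U} (hp : p ∈ sobolev U) :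
    ∃ s ∈ sobolev U, (s.fst =ᵐ[volume.restrict U] fun x => ((‖p.fst x‖ : ℝ) : ℂ)) ∧
      schrodingerEnergy V s ≤ schrodingerEnergy V p := by
  obtain ⟨s, hs, h1, h2⟩ := exists_abs_mem_sobolev hU hp
  refine ⟨s, hs, h1, add_le_add h2 (le_of_eq (integral_congr_ae ?_))⟩
  filter_upwards [h1] with x hx
  simp [hx]

theorem min_eq_half_sub_abs (a b : ℝ) : min a b = (a + b - |a - b|) / 2 := by
  rcases le_total a b with h | h
  · rw [min_eq_left h, abs_of_nonpos (by linarith)]; ring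
  · rw [min_eq_right h, abs_of_nonneg (by linarith)]; ring

/-- With `z = |p - r|`, the minimum is `(p + r - z)/2` and the maximum `(p + r + z)/2`. Two
parallelogram identities and `E(z) ≤ E(p - r)` give `E(min) + E(max) ≤ E(p) + E(r)`, and `E(max) ≥
0` is dropped. -/
theorem exists_min_energy_le (hU : volume U ≠ ⊤) (hV : IsBddPotential U V)
    (hpos : ∀ p ∈ sobolev U, 0 ≤ schrodingerEnergy V p) {p r : SobolevPair U}
    (hp : p ∈ sobolev U) (hr : r ∈ sobolev U)
    (hp0 : ∀ᵐ x ∂(volume.restrict U), p.fst x = (‖p.fst x‖ : ℂ))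
    (hr0 : ∀ᵐ x ∂(volume.restrict U), r.fst x = (‖r.fst x‖ : ℂ)) :
    ∃ s ∈ sobolev U,
      (s.fst =ᵐ[volume.restrict U] fun x => ((min ‖p.fst x‖ ‖r.fst x‖ : ℝ) : ℂ)) ∧
      schrodingerEnergy V s ≤ schrodingerEnergy V p + schrodingerEnergy V r := by
  obtain ⟨z, hz, hz1, hz2⟩ := exists_abs_energy_le hU V ((sobolev U).sub_mem hp hr)
  have hm : (1 / 2 : ℂ) • (p + r - z) ∈ sobolev U :=
    (sobolev U).smul_mem _ ((sobolev U).sub_mem ((sobolev U).add_mem hp hr) hz)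
  have hM : p + r + z ∈ sobolev U := (sobolev U).add_mem ((sobolev U).add_mem hp hr) hz
  refine ⟨_, hm, ?_, ?_⟩
  · filter_upwards [hz1, hp0, hr0, Lp.coeFn_smul (1 / 2 : ℂ) (p.fst + r.fst - z.fst),
      Lp.coeFn_sub (p.fst + r.fst) z.fst, Lp.coeFn_add p.fst r.fst, Lp.coeFn_sub p.fst r.fst]
      with x h1 h2 h3 h4 h5 h6 h7
    rw [WithLp.smul_fst, WithLp.sub_fst, WithLp.add_fst, h4, Pi.smul_apply, h5, Pi.sub_apply, h6,
      Pi.add_apply, h1, WithLp.sub_fst, h7, Pi.sub_apply, min_eq_half_sub_abs]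
    rw [h2, h3, ← Complex.ofReal_sub, Complex.norm_real, Complex.norm_real, Complex.norm_real,
      norm_norm, norm_norm, Real.norm_eq_abs, smul_eq_mul]
    push_cast
    ring
  · have h1 := hV.energy_parallelogram (p + r) z
    have h2 := hV.energy_parallelogram p r
    have h3 := hpos _ hM
    rw [energy_smul]
    norm_num
    linarith

end Form

/-! ### Functions with vanishing weak gradient -/

section WeakConst

variable {d : ℕ}

/-- The derivative of the mollification at `x` is, up to sign, `f` tested against a partial
derivative of `t ↦ φ(x - t)`. The support of that bump lies within `R/2` of `x`, hence inside the
ball of radius `R`. -/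
theorem fderiv_bump_convolution_eq_zero {f : EuclideanSpace ℝ (Fin d) → ℝ}
    (hf : LocallyIntegrable f) {x₀ : EuclideanSpace ℝ (Fin d)} {R : ℝ}
    (h : ∀ θ : EuclideanSpace ℝ (Fin d) → ℝ, IsTestFun (Metric.ball x₀ R) θ → ∀ i,
      ∫ x, f x * partialDeriv i θ x = 0)
    (φ : ContDiffBump (0 : EuclideanSpace ℝ (Fin d))) (hφ : φ.rOut ≤ R / 2)
    {x : EuclideanSpace ℝ (Fin d)} (hx : x ∈ Metric.ball x₀ (R / 2)) :
    HasFDerivAt (convolution (φ.normed volume) f (ContinuousLinearMap.lsmul ℝ ℝ) volume)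
      (0 : EuclideanSpace ℝ (Fin d) →L[ℝ] ℝ) x := by
  have hη1 : ContDiff ℝ ((⊤ : ℕ∞) : WithTop ℕ∞) (φ.normed volume) := φ.contDiff_normed
  have hη : HasCompactSupport (φ.normed volume) := φ.hasCompactSupport_normed
  have hD := hη.hasFDerivAt_convolution_left (ContinuousLinearMap.lsmul ℝ ℝ)
    (hη1.of_le (by simp)) hf x
  have hint : ConvolutionExistsAt (fderiv ℝ (φ.normed volume)) f x
      ((ContinuousLinearMap.lsmul ℝ ℝ).precompL (EuclideanSpace ℝ (Fin d))) volume :=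
    (hη.fderiv ℝ).convolutionExists_left _ (hη1.continuous_fderiv (by simp)) hf x
  suffices hz : convolution (fderiv ℝ (φ.normed volume)) f
      ((ContinuousLinearMap.lsmul ℝ ℝ).precompL (EuclideanSpace ℝ (Fin d))) volume x = 0 by
    rwa [hz] at hD
  apply ContinuousLinearMap.coe_injective
  refine (EuclideanSpace.basisFun (Fin d) ℝ).toBasis.ext fun i => ?_
  have ht : IsTestFun (Metric.ball x₀ R) (fun t => φ.normed volume (x - t)) := by
    have hs : tsupport (fun t => φ.normed volume (x - t)) ⊆ Metric.closedBall x φ.rOut := by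
      refine closure_minimal (fun t ht => ?_) Metric.isClosed_closedBall
      have : x - t ∈ Function.support (φ.normed volume) := ht
      rw [φ.support_normed_eq, mem_ball_zero_iff] at this
      rw [Metric.mem_closedBall, dist_comm, dist_eq_norm]
      exact this.le
    refine ⟨hη1.comp (contDiff_const.sub contDiff_id),
      (isCompact_closedBall x φ.rOut).of_isClosed_subset (isClosed_tsupport _) hs,
      hs.trans fun y hy => ?_⟩
    rw [Metric.mem_ball] at hx ⊢
    rw [Metric.mem_closedBall] at hy
    have := dist_triangle y x x₀
    linarith
  have h0 := h _ ht i
  have hpd : ∀ t, partialDeriv i (fun t => φ.normed volume (x - t)) t =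
      -(fderiv ℝ (φ.normed volume) (x - t) (EuclideanSpace.single i 1)) := by
    intro t
    have h1 := ((hη1.differentiable (by simp)) (x - t)).hasFDerivAt.comp t
      ((hasFDerivAt_id t).const_sub x)
    have h2 : fderiv ℝ (fun t => φ.normed volume (x - t)) t = _ := h1.fderiv
    simp [partialDeriv, h2]
  simp only [hpd] at h0
  rw [ContinuousLinearMap.coe_coe, convolution_eq_swap,
    ContinuousLinearMap.integral_apply hint.integrable_swap]
  simp only [mul_neg, integral_neg, neg_eq_zero] at h0
  rw [ContinuousLinearMap.coe_coe, zero_apply, ← h0]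
  refine integral_congr_ae (Eventually.of_forall fun t => ?_)
  simp [ContinuousLinearMap.precompL_apply, mul_comm]

theorem ae_const_of_weak_deriv_eq_zero {f : EuclideanSpace ℝ (Fin d) → ℝ}
    (hf : LocallyIntegrable f) {x₀ : EuclideanSpace ℝ (Fin d)} {R : ℝ} (hR : 0 < R)
    (h : ∀ θ : EuclideanSpace ℝ (Fin d) → ℝ, IsTestFun (Metric.ball x₀ R) θ → ∀ i,
      ∫ x, f x * partialDeriv i θ x = 0) :
    ∃ c, ∀ᵐ x, x ∈ Metric.ball x₀ (R / 2) → f x = c := by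
  -- Outer radii at most `R / 2` keep the mollifications locally constant; the fixed ratio `2` of
  -- the radii is what almost everywhere convergence of mollifications asks for.
  let φ : ℕ → ContDiffBump (0 : EuclideanSpace ℝ (Fin d)) := fun n =>
    ⟨R / 4 / (n + 1), R / 2 / (n + 1), by positivity, by gcongr; linarith⟩
  have hlim : ∀ a : ℝ, Tendsto (fun n : ℕ => a / ((n : ℝ) + 1)) atTop (𝓝 0) := by
    intro a
    have := (tendsto_one_div_add_atTop_nhds_zero_nat (𝕜 := ℝ)).const_mul a
    simpa [div_eq_mul_inv] using this
  have hae := ContDiffBump.ae_convolution_tendsto_right_of_locallyIntegrable (μ := volume)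
    (φ := φ) (l := atTop) (K := 2) (hlim _)
    (Eventually.of_forall fun n => by
      show R / 2 / ((n : ℝ) + 1) ≤ 2 * (R / 4 / ((n : ℝ) + 1))
      apply le_of_eq; ring) hf
  have hconst : ∀ n, ∀ x ∈ Metric.ball x₀ (R / 2), ∀ y ∈ Metric.ball x₀ (R / 2),
      convolution ((φ n).normed volume) f (ContinuousLinearMap.lsmul ℝ ℝ) volume x =
      convolution ((φ n).normed volume) f (ContinuousLinearMap.lsmul ℝ ℝ) volume y := by
    intro n x hx y hy
    have hd : ∀ z ∈ Metric.ball x₀ (R / 2), HasFDerivAt _ _ z := fun z hz =>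
      fderiv_bump_convolution_eq_zero hf h (φ n) (by
        show R / 2 / ((n : ℝ) + 1) ≤ R / 2
        exact div_le_self (by positivity) (by linarith [(Nat.cast_nonneg n : (0 : ℝ) ≤ n)])) hz
    refine (convex_ball x₀ (R / 2)).is_const_of_fderivWithin_eq_zero (𝕜 := ℝ)
      (fun z hz => (hd z hz).differentiableAt.differentiableWithinAt) (fun z hz => ?_) hx hy
    rw [fderivWithin_of_isOpen Metric.isOpen_ball hz, (hd z hz).fderiv]
  by_cases hex : ∃ y ∈ Metric.ball x₀ (R / 2), Tendsto (fun n =>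
      convolution ((φ n).normed volume) f (ContinuousLinearMap.lsmul ℝ ℝ) volume y) atTop (𝓝 (f y))
  · obtain ⟨y, hy, hyl⟩ := hex
    refine ⟨f y, ?_⟩
    filter_upwards [hae] with x hx hxb
    exact tendsto_nhds_unique hx (hyl.congr fun n => hconst n y hy x hxb)
  -- With no convergence point in the ball the claim is vacuous, and the constant is arbitrary.
  · push Not at hex
    refine ⟨0, ?_⟩
    filter_upwards [hae] with x hx hxb
    exact absurd hx (hex x hxb)

/-- A measurable subset of a connected open set whose indicator has locally vanishing weak
derivatives is null or conull. -/
theorem null_or_conull_of_weak_deriv_eq_zero {U M : Set (EuclideanSpace ℝ (Fin d))}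
    (hU : IsOpen U) (hUc : IsPreconnected U) (hM : MeasurableSet M)
    (h : ∀ x ∈ U, ∃ R > 0, ∀ θ : EuclideanSpace ℝ (Fin d) → ℝ, IsTestFun (Metric.ball x R) θ →
      ∀ i, ∫ y, M.indicator (fun _ => (1 : ℝ)) y * partialDeriv i θ y = 0) :
    (∀ᵐ x ∂(volume.restrict U), x ∉ M) ∨ (∀ᵐ x ∂(volume.restrict U), x ∈ M) := by
  have hloc : LocallyIntegrable (M.indicator (fun _ => (1 : ℝ))) volume :=
    (locallyIntegrable_const (1 : ℝ)).indicator hM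
  -- `S A` consists of the points near which almost every point lies in `A`. The open sets `S M` and
  -- `S Mᶜ` cover `U`, and they are disjoint because balls have positive measure; preconnectedness
  -- leaves one of them.
  let S : Set (EuclideanSpace ℝ (Fin d)) → Set (EuclideanSpace ℝ (Fin d)) := fun A =>
    {x | ∃ r > 0, ∀ᵐ y, y ∈ Metric.ball x r → y ∈ A}
  have hSo : ∀ A, IsOpen (S A) := by
    intro A
    rw [Metric.isOpen_iff]
    rintro x ⟨r, hr, hx⟩
    refine ⟨r / 2, by positivity, fun y hy => ⟨r / 2, by positivity, ?_⟩⟩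
    filter_upwards [hx] with z hz hzy
    refine hz ?_
    rw [Metric.mem_ball] at *
    have := dist_triangle z y x
    linarith
  have hcov : U ⊆ S Mᶜ ∪ S M := by
    intro x hx
    obtain ⟨R, hR, hθ⟩ := h x hx
    obtain ⟨c, hc⟩ := ae_const_of_weak_deriv_eq_zero hloc hR hθ
    by_cases h1 : c = 1
    · right
      refine ⟨R / 2, by positivity, ?_⟩
      filter_upwards [hc] with y hy hyb
      by_contra hyM
      have := hy hyb
      rw [indicator_of_notMem hyM] at this
      rw [h1] at this
      norm_num at this
    · left
      refine ⟨R / 2, by positivity, ?_⟩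
      filter_upwards [hc] with y hy hyb hyM
      have := hy hyb
      rw [indicator_of_mem hyM] at this
      exact h1 this.symm
  have hdis : U ∩ (S Mᶜ ∩ S M) = ∅ := by
    rw [eq_empty_iff_forall_notMem]
    rintro x ⟨-, ⟨r, hr, h1⟩, ⟨s, hs, h2⟩⟩
    have : volume (Metric.ball x (min r s)) = 0 := by
      rw [measure_eq_zero_iff_ae_notMem]
      filter_upwards [h1, h2] with y h1 h2 hy
      exact h1 (Metric.ball_subset_ball (min_le_left _ _) hy)
        (h2 (Metric.ball_subset_ball (min_le_right _ _) hy))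
    exact (Metric.measure_ball_pos volume x (lt_min hr hs)).ne' this
  have hglob : ∀ A, U ⊆ S A → ∀ᵐ x ∂(volume.restrict U), x ∈ A := by
    intro A hA
    rw [ae_restrict_iff' hU.measurableSet, ae_iff]
    refine measure_null_of_locally_null _ fun x hx => ?_
    simp only [Classical.not_imp] at hx
    obtain ⟨r, hr, hxr⟩ := hA hx.1
    refine ⟨_, inter_mem_nhdsWithin _ (Metric.ball_mem_nhds x hr), ?_⟩
    rw [measure_eq_zero_iff_ae_notMem]
    filter_upwards [hxr] with y hy hy'
    simp only [mem_inter_iff, mem_ofPred_eq, Classical.not_imp] at hy'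
    exact hy'.1.2 (hy hy'.2)
  exact (isPreconnected_iff_subset_of_disjoint.1 hUc _ _ (hSo _) (hSo _) hcov hdis).imp
    (hglob Mᶜ) (hglob M)

end WeakConst

/-! ### The product rule -/

section Product

variable {d : ℕ} {U : Set (EuclideanSpace ℝ (Fin d))}

theorem continuous_integral_mul_fst {F : EuclideanSpace ℝ (Fin d) → ℂ}
    (hF : MemLp F 2 (volume.restrict U)) :
    Continuous fun p : SobolevPair U => ∫ x in U, F x * p.fst x := by
  have e : (fun p : SobolevPair U => ∫ x in U, F x * p.fst x) =
      fun p => inner ℂ (hF.star.toLp _) p.fst := by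
    ext p
    rw [L2.inner_def]
    refine integral_congr_ae ?_
    filter_upwards [hF.star.coeFn_toLp] with x hx
    rw [hx, RCLike.inner_apply']
    simp
  rw [e]
  exact continuous_const.inner (WithLp.continuous_fst 2 _ _)

theorem continuous_integral_mul_snd {F : EuclideanSpace ℝ (Fin d) → ℂ}
    (hF : MemLp F 2 (volume.restrict U)) (i : Fin d) :
    Continuous fun p : SobolevPair U => ∫ x in U, F x * p.snd x i := by
  let T := (EuclideanSpace.proj i : EuclideanSpace ℂ (Fin d) →L[ℂ] ℂ)
  have e : (fun p : SobolevPair U => ∫ x in U, F x * p.snd x i) =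
      fun p => inner ℂ (hF.star.toLp _) (T.compLpL 2 (volume.restrict U) p.snd) := by
    ext p
    rw [L2.inner_def]
    refine integral_congr_ae ?_
    filter_upwards [hF.star.coeFn_toLp, T.coeFn_compLpL p.snd] with x hx h2
    rw [hx, RCLike.inner_apply', h2]
    simp [T]
  rw [e]
  exact continuous_const.inner ((T.compLpL 2 _).continuous.comp (WithLp.continuous_snd 2 _ _))

theorem memLp_snd_apply (p : SobolevPair U) (i : Fin d) :
    MemLp (fun x => p.snd x i) 2 (volume.restrict U) :=
  (Lp.memLp p.snd).of_le ((EuclideanSpace.proj i : EuclideanSpace ℂ (Fin d) →L[ℂ] ℂ).continuous.comp_aestronglyMeasurable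
        (Lp.aestronglyMeasurable p.snd))
      (Eventually.of_forall fun x => PiLp.norm_apply_le (p.snd x) i)

theorem sobolev_induction {P : SobolevPair U → Prop} (hcl : IsClosed {p | P p})
    (h : ∀ (φ : EuclideanSpace ℝ (Fin d) → ℂ) (hφ : IsTestFun U φ), P hφ.pair)
    {p : SobolevPair U} (hp : p ∈ sobolev U) : P p := by
  have hmem : p ∈ {p | P p} := by
    refine closure_minimal ?_ hcl hp
    intro q hq
    obtain ⟨φ, hφ, rfl⟩ := mem_testPairs.1 hq
    exact h φ hφ
  exact hmem

theorem IsTestFun.mul {φ χ : EuclideanSpace ℝ (Fin d) → ℂ} (h : IsTestFun U φ)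
    (h' : IsTestFun U χ) : IsTestFun U (fun x => φ x * χ x) :=
  h.of_support_subset (h.1.mul h'.1) fun x hx => by simp [hx]

theorem IsTestFun.partialDeriv_mul {φ χ : EuclideanSpace ℝ (Fin d) → ℂ} (h : IsTestFun U φ)
    (h' : IsTestFun U χ) (i : Fin d) (x : EuclideanSpace ℝ (Fin d)) :
    _root_.partialDeriv i (fun x => φ x * χ x) x =
      φ x * _root_.partialDeriv i χ x + _root_.partialDeriv i φ x * χ x := by
  have := fderiv_fun_mul (h.differentiable x) (h'.differentiable x)
  simp [_root_.partialDeriv, this, mul_comm]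

theorem IsTestFun.ofReal {θ : EuclideanSpace ℝ (Fin d) → ℝ} (hθ : IsTestFun U θ) :
    IsTestFun U (fun x => (θ x : ℂ)) :=
  hθ.of_support_subset (Complex.ofRealCLM.contDiff.comp hθ.1) fun x hx => by simp [hx]

theorem IsTestFun.memLp_mul_top {V : Set (EuclideanSpace ℝ (Fin d))}
    {θ : EuclideanSpace ℝ (Fin d) → ℂ} (hθ : Continuous θ)
    (hc : HasCompactSupport θ) {f : EuclideanSpace ℝ (Fin d) → ℂ}
    (hf : MemLp f 2 (volume.restrict V)) :
    MemLp (fun x => θ x * f x) 2 (volume.restrict V) := by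
  obtain ⟨C, hC⟩ := hθ.bounded_above_of_compact_support hc
  exact hf.of_le_mul (c := C) (hθ.aestronglyMeasurable.mul hf.1)
    (Eventually.of_forall fun x => by
      rw [norm_mul]; gcongr; exact hC x)

/-- The product rule for `H¹₀` functions. -/
theorem sobolev_product_rule {p r : SobolevPair U} (hp : p ∈ sobolev U) (hr : r ∈ sobolev U)
    {θ : EuclideanSpace ℝ (Fin d) → ℝ} (hθ : IsTestFun U θ) (i : Fin d) :
    ∫ x in U, p.fst x * r.fst x * ((partialDeriv i θ x : ℝ) : ℂ)
      = -∫ x in U, (p.fst x * r.snd x i + p.snd x i * r.fst x) * (θ x : ℂ) := by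
  have hθc : Continuous fun x => ((partialDeriv i θ x : ℝ) : ℂ) :=
    Complex.continuous_ofReal.comp (hθ.continuous_partialDeriv i)
  have hθs : HasCompactSupport fun x => ((partialDeriv i θ x : ℝ) : ℂ) :=
    (hθ.hasCompactSupport_partialDeriv i).comp_left (g := ((↑) : ℝ → ℂ)) (by simp)
  have hm1 : ∀ {f : EuclideanSpace ℝ (Fin d) → ℂ}, MemLp f 2 (volume.restrict U) →
      MemLp (fun x => ((partialDeriv i θ x : ℝ) : ℂ) * f x) 2 (volume.restrict U) :=
    fun hf => IsTestFun.memLp_mul_top hθc hθs hf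
  have hm2 : ∀ {f : EuclideanSpace ℝ (Fin d) → ℂ}, MemLp f 2 (volume.restrict U) →
      MemLp (fun x => (θ x : ℂ) * f x) 2 (volume.restrict U) :=
    fun hf => IsTestFun.memLp_mul_top hθ.ofReal.continuous hθ.ofReal.2.1 hf
  have I : ∀ {f g : EuclideanSpace ℝ (Fin d) → ℂ}, MemLp f 2 (volume.restrict U) →
      MemLp g 2 (volume.restrict U) → Integrable (fun x => f x * g x) (volume.restrict U) :=
    fun hf hg => hf.integrable_mul hg
  -- Density is used in one factor at a time: with the other factor fixed, the identity is a closed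
  -- linear condition. The factor `θ` and its derivatives, bounded with compact support, keep every
  -- coefficient in `L²`.
  have stepA : ∀ (φ : EuclideanSpace ℝ (Fin d) → ℂ) (hφ : IsTestFun U φ), ∀ r ∈ sobolev U,
      (∫ x in U, (((partialDeriv i θ x : ℝ) : ℂ) * φ x + (θ x : ℂ) * partialDeriv i φ x) * r.fst x)
        + ∫ x in U, ((θ x : ℂ) * φ x) * r.snd x i = 0 := by
    intro φ hφ r hr
    refine sobolev_induction (P := fun r => (∫ x in U, (((partialDeriv i θ x : ℝ) : ℂ) * φ x
      + (θ x : ℂ) * partialDeriv i φ x) * r.fst x)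
      + ∫ x in U, ((θ x : ℂ) * φ x) * r.snd x i = 0) ?_ ?_ hr
    · exact isClosed_eq ((continuous_integral_mul_fst ((hm1 (hφ.memLp 2 _)).add
        (hm2 (hφ.memLp_partialDeriv i 2 _)))).add
        (continuous_integral_mul_snd (hm2 (hφ.memLp 2 _)) i)) continuous_const
    · intro χ hχ
      have h0 := (hφ.mul hχ).integral_mul_partialDeriv hθ i
      simp only [classicalGrad_apply, hφ.partialDeriv_mul hχ] at h0
      have e1 : ∫ x in U, (((partialDeriv i θ x : ℝ) : ℂ) * φ x
          + (θ x : ℂ) * partialDeriv i φ x) * hχ.pair.fst x =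
          (∫ x in U, φ x * χ x * ((partialDeriv i θ x : ℝ) : ℂ))
          + ∫ x in U, (θ x : ℂ) * partialDeriv i φ x * χ x := by
        rw [← integral_add]
        · refine integral_congr_ae ?_
          filter_upwards [hχ.pair_fst] with x hx
          rw [hx]; ring
        · refine (I (hm1 (hφ.memLp 2 _)) (hχ.memLp 2 _)).congr (Eventually.of_forall fun x => ?_)
          ring
        · exact I (hm2 (hφ.memLp_partialDeriv i 2 _)) (hχ.memLp 2 _)
      have e2 : ∫ x in U, ((θ x : ℂ) * φ x) * hχ.pair.snd x i =
          ∫ x in U, ((θ x : ℂ) * φ x) * partialDeriv i χ x := by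
        refine integral_congr_ae ?_
        filter_upwards [hχ.pair_snd] with x hx
        rw [hx]; rfl
      rw [e1, e2, h0, add_assoc, ← integral_add, neg_add_eq_zero]
      · congr with x
        ring
      · exact I (hm2 (hφ.memLp_partialDeriv i 2 _)) (hχ.memLp 2 _)
      · exact I (hm2 (hφ.memLp 2 _)) (hχ.memLp_partialDeriv i 2 _)
  have hrf := Lp.memLp r.fst
  have hrs := memLp_snd_apply r i
  have stepB : (∫ x in U, (((partialDeriv i θ x : ℝ) : ℂ) * r.fst x + (θ x : ℂ) * r.snd x i)
      * p.fst x) + ∫ x in U, ((θ x : ℂ) * r.fst x) * p.snd x i = 0 := by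
    refine sobolev_induction (P := fun p => (∫ x in U, (((partialDeriv i θ x : ℝ) : ℂ) * r.fst x
      + (θ x : ℂ) * r.snd x i) * p.fst x) + ∫ x in U, ((θ x : ℂ) * r.fst x) * p.snd x i = 0) ?_ ?_ hp
    · exact isClosed_eq ((continuous_integral_mul_fst ((hm1 hrf).add (hm2 hrs))).add
        (continuous_integral_mul_snd (hm2 hrf) i)) continuous_const
    · intro φ hφ
      rw [← stepA φ hφ r hr, ← integral_add, ← integral_add]
      · refine integral_congr_ae ?_
        filter_upwards [hφ.pair_fst, hφ.pair_snd] with x h1 h2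
        rw [h1, h2, classicalGrad_apply]
        ring
      · exact I ((hm1 (hφ.memLp 2 _)).add (hm2 (hφ.memLp_partialDeriv i 2 _))) hrf
      · exact I (hm2 (hφ.memLp 2 _)) hrs
      · exact I ((hm1 hrf).add (hm2 hrs)) (Lp.memLp _)
      · exact I (hm2 hrf) (memLp_snd_apply _ i)
  have e3 : ∫ x in U, (((partialDeriv i θ x : ℝ) : ℂ) * r.fst x + (θ x : ℂ) * r.snd x i)
      * p.fst x = (∫ x in U, p.fst x * r.fst x * ((partialDeriv i θ x : ℝ) : ℂ))
        + ∫ x in U, ((θ x : ℂ) * r.snd x i) * p.fst x := by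
    rw [← integral_add]
    · congr with x; ring
    · refine (I (hm1 hrf) (Lp.memLp p.fst)).congr (Eventually.of_forall fun x => ?_)
      ring
    · exact I (hm2 hrs) (Lp.memLp p.fst)
  rw [e3, add_assoc, ← integral_add (I (hm2 hrs) (Lp.memLp p.fst)) (I (hm2 hrf)
    (memLp_snd_apply p i))] at stepB
  rw [eq_neg_of_add_eq_zero_left stepB]
  congr 2 with x
  ring

end Product

/-! ### Null vectors of nonnegative Schrödinger forms -/

section NullVectors

variable {d : ℕ} {U : Set (EuclideanSpace ℝ (Fin d))} {V : EuclideanSpace ℝ (Fin d) → ℝ}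

theorem measurableSet_fst_ne_zero (u : SobolevPair U) : MeasurableSet {x | u.fst x ≠ 0} :=
  ((Lp.stronglyMeasurable u.fst).measurable (measurableSet_singleton 0)).compl

/-- Cutting off an `H¹₀` function to the support of a nonnegative null vector. -/
theorem exists_cut_mem_sobolev (hU : volume U ≠ ⊤) (hV : IsBddPotential U V)
    (hpos : ∀ p ∈ sobolev U, 0 ≤ schrodingerEnergy V p) {χ u : SobolevPair U}
    (hχ : χ ∈ sobolev U) (hu : u ∈ sobolev U)
    (hχ0 : ∀ᵐ x ∂(volume.restrict U), χ.fst x = (‖χ.fst x‖ : ℂ))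
    (hu0 : ∀ᵐ x ∂(volume.restrict U), u.fst x = (‖u.fst x‖ : ℂ))
    (hnull : schrodingerEnergy V u = 0) :
    ∃ g ∈ sobolev U, g.fst =ᵐ[volume.restrict U] {x | u.fst x ≠ 0}.indicator χ.fst := by
  -- The approximants are `min(χ, k u)`. Since `k u` has zero energy, their energies never exceed
  -- that of `χ`, and they tend to `χ 1_{u ≠ 0}` in `L²`.
  have hk : ∀ k : ℕ, ∃ s ∈ sobolev U,
      (s.fst =ᵐ[volume.restrict U] fun x => ((min ‖χ.fst x‖ (k * ‖u.fst x‖) : ℝ) : ℂ)) ∧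
      schrodingerEnergy V s ≤ schrodingerEnergy V χ := by
    intro k
    have hs := Lp.coeFn_smul (k : ℂ) u.fst
    obtain ⟨s, hs1, hs2, hs3⟩ := exists_min_energy_le hU hV hpos hχ
      ((sobolev U).smul_mem (k : ℂ) hu) hχ0 (by
        filter_upwards [hs, hu0] with x h1 h2
        rw [WithLp.smul_fst, h1, Pi.smul_apply, h2]
        simp)
    refine ⟨s, hs1, ?_, ?_⟩
    · filter_upwards [hs2, hs] with x h1 h2
      rw [h1, WithLp.smul_fst, h2, Pi.smul_apply, smul_eq_mul, norm_mul, Complex.norm_natCast]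
    · rw [energy_smul, hnull] at hs3
      simpa using hs3
  choose m hm1 hm2 hm3 using hk
  have hf : MemLp ({x | u.fst x ≠ 0}.indicator χ.fst) 2 (volume.restrict U) :=
    (Lp.memLp χ.fst).indicator (measurableSet_fst_ne_zero u)
  have hlim : Tendsto (fun k => (m k).fst) atTop (𝓝 hf.toLp) := by
    rw [tendsto_iff_norm_sub_tendsto_zero]
    have hsq : Tendsto (fun k => ‖(m k).fst - hf.toLp‖ ^ 2) atTop (𝓝 0) := by
      simp only [L2_norm_sq]
      have := tendsto_integral_of_dominated_convergence (μ := volume.restrict U)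
        (F := fun k x => ‖((m k).fst - hf.toLp : Lp ℂ 2 (volume.restrict U)) x‖ ^ 2)
        (f := fun _ => 0) (fun x => ‖χ.fst x‖ ^ 2) (fun k => (L2_integrable_sq _).1)
        (L2_integrable_sq _) (fun k => by
          filter_upwards [hm2 k, hf.coeFn_toLp, Lp.coeFn_sub (m k).fst hf.toLp, hχ0]
            with x h1 h2 h3 h4
          rw [norm_pow, norm_norm, h3, Pi.sub_apply, h1, h2]
          gcongr
          by_cases hx : u.fst x = 0
          · rw [indicator_of_notMem (by simp [hx])]
            simp [hx]
          · rw [indicator_of_mem (by exact hx), h4, ← Complex.ofReal_sub, Complex.norm_real,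
              Complex.norm_real, norm_norm, Real.norm_eq_abs, abs_le]
            have := min_le_left ‖χ.fst x‖ (k * ‖u.fst x‖)
            have h5 : 0 ≤ min ‖χ.fst x‖ (k * ‖u.fst x‖) := by positivity
            constructor <;> linarith [norm_nonneg (χ.fst x)])
        (by
          filter_upwards [ae_all_iff.2 hm2, hf.coeFn_toLp,
            ae_all_iff.2 fun k => Lp.coeFn_sub (m k).fst hf.toLp, hχ0] with x h1 h2 h3 h4
          simp only [h3, Pi.sub_apply, h1, h2]
          by_cases hx : u.fst x = 0
          · rw [indicator_of_notMem (by simp [hx])]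
            simp [hx]
          · rw [indicator_of_mem (by exact hx)]
            refine tendsto_const_nhds.congr' ?_
            obtain ⟨n, hn⟩ := exists_nat_ge (‖χ.fst x‖ / ‖u.fst x‖)
            filter_upwards [eventually_ge_atTop n] with k hk
            have hk' : ‖χ.fst x‖ ≤ k * ‖u.fst x‖ := by
              rw [← div_le_iff₀ (norm_pos_iff.2 hx)]
              exact hn.trans (by exact_mod_cast hk)
            rw [min_eq_left hk', ← h4]
            simp)
      simpa using this
    simpa [Real.sqrt_sq (norm_nonneg _)] using hsq.sqrt
  obtain ⟨C, hC⟩ := hV.bounded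
  have hC0 : 0 ≤ C := (abs_nonneg _).trans (hC 0)
  -- The approximants are dominated by `χ` and `V` is bounded, so the energy bound is a gradient
  -- bound uniform in `k`.
  have hgrad : ∀ k, ‖(m k).snd‖ ^ 2 ≤ schrodingerEnergy V χ + ∫ x in U, C * ‖χ.fst x‖ ^ 2 := by
    intro k
    have h1 := hm3 k
    have h2 : -∫ x in U, C * ‖χ.fst x‖ ^ 2 ≤ ∫ x in U, V x * ‖(m k).fst x‖ ^ 2 := by
      rw [← integral_neg]
      refine integral_mono_ae ((L2_integrable_sq _).const_mul C).neg
        (hV.integrable_mul (L2_integrable_sq _)) ?_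
      filter_upwards [hm2 k] with x hx
      have h3 : ‖(m k).fst x‖ ≤ ‖χ.fst x‖ := by
        rw [hx, Complex.norm_real, Real.norm_of_nonneg (by positivity)]
        exact min_le_left _ _
      have h4 : ‖(m k).fst x‖ ^ 2 ≤ ‖χ.fst x‖ ^ 2 := by gcongr
      have h5 := (abs_le.1 (hC x)).1
      have h6 : 0 ≤ ‖(m k).fst x‖ ^ 2 := by positivity
      nlinarith
    rw [schrodingerEnergy] at h1
    linarith
  obtain ⟨g, hg, hg1, -⟩ := sobolev_lsc hm1 hlim hgrad tendsto_const_nhds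
  exact ⟨g, hg, by rw [hg1]; exact hf.coeFn_toLp⟩

theorem IsTestFun.mono {W : Set (EuclideanSpace ℝ (Fin d))} {F : Type*} [NormedAddCommGroup F]
    [NormedSpace ℝ F] {φ : EuclideanSpace ℝ (Fin d) → F} (h : IsTestFun W φ) (hW : W ⊆ U) :
    IsTestFun U φ :=
  ⟨h.1, h.2.1, h.2.2.trans hW⟩

/-- An `H¹₀` function which on a ball coincides with an indicator function has vanishing gradient
there. -/
theorem integral_partialDeriv_eq_zero_of_indicator (hUf : volume U ≠ ⊤)
    {g : SobolevPair U} (hg : g ∈ sobolev U) {W M : Set (EuclideanSpace ℝ (Fin d))}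
    (hW : IsOpen W) (hWU : W ⊆ U)
    (hgW : ∀ᵐ x ∂(volume.restrict W), g.fst x = M.indicator (fun _ => (1 : ℂ)) x)
    {θ : EuclideanSpace ℝ (Fin d) → ℝ} (hθ : IsTestFun W θ) (i : Fin d) :
    ∫ y, M.indicator (fun _ => (1 : ℝ)) y * partialDeriv i θ y = 0 := by
  have : IsFiniteMeasure (volume.restrict U) := ⟨by simpa using hUf.lt_top⟩
  have hUW : ∀ {f : EuclideanSpace ℝ (Fin d) → ℂ}, (∀ x, x ∉ W → f x = 0) →
      ∫ x in U, f x = ∫ x in W, f x := by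
    intro f hf
    rw [setIntegral_eq_integral_of_forall_compl_eq_zero fun x hx => hf x fun h => hx (hWU h),
      setIntegral_eq_integral_of_forall_compl_eq_zero hf]
  have hid : ∀ {θ : EuclideanSpace ℝ (Fin d) → ℝ}, IsTestFun W θ →
      ∫ x in W, g.fst x * ((partialDeriv i θ x : ℝ) : ℂ) = -∫ x in W, g.snd x i * (θ x : ℂ) := by
    intro θ hθ
    have h := (hasWeakGrad_of_mem_sobolev hg).2 θ (hθ.mono hWU) i
    rwa [hUW fun x hx => by rw [hθ.partialDeriv_eq_zero_of_notMem i hx]; simp,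
      hUW fun x hx => by rw [hθ.eq_zero_of_notMem hx]; simp] at h
  have hid2 : ∀ {θ : EuclideanSpace ℝ (Fin d) → ℝ}, IsTestFun W θ →
      ∫ x in W, g.fst x * g.fst x * ((partialDeriv i θ x : ℝ) : ℂ)
        = -∫ x in W, (g.fst x * g.snd x i + g.snd x i * g.fst x) * (θ x : ℂ) := by
    intro θ hθ
    have h := sobolev_product_rule hg hg (hθ.mono hWU) i
    rwa [hUW fun x hx => by rw [hθ.partialDeriv_eq_zero_of_notMem i hx]; simp,
      hUW fun x hx => by rw [hθ.eq_zero_of_notMem hx]; simp] at h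
  have hsub : volume.restrict W ≤ volume.restrict U := Measure.restrict_mono_set _ hWU
  have i1 : Integrable (fun x => g.snd x i) (volume.restrict W) :=
    ((memLp_snd_apply g i).integrable (by norm_num)).mono_measure hsub
  have i2 : Integrable (fun x => g.fst x * g.snd x i + g.snd x i * g.fst x)
      (volume.restrict W) :=
    (((Lp.memLp g.fst).integrable_mul (memLp_snd_apply g i)).add
      ((memLp_snd_apply g i).integrable_mul (Lp.memLp g.fst))).mono_measure hsub
  -- On `W` the function `g` equals its square, so the product rule gives `∇g = 2g∇g`. As `g` takes
  -- only the values `0` and `1`, the factor `1 - 2g` never vanishes and `∇g = 0`.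
  have hz := ae_eq_zero_of_integral_test hW
    (f := fun x => g.snd x i - (g.fst x * g.snd x i + g.snd x i * g.fst x))
    (i1.sub i2).locallyIntegrable fun θ hθ => by
      obtain ⟨C, hC⟩ := hθ.ofReal.continuous.bounded_above_of_compact_support hθ.ofReal.2.1
      have hm : ∀ {f : EuclideanSpace ℝ (Fin d) → ℂ}, Integrable f (volume.restrict W) →
          Integrable (fun x => f x * (θ x : ℂ)) (volume.restrict W) := fun hf =>
        hf.mul_bdd (c := C) hθ.ofReal.continuous.aestronglyMeasurable (Eventually.of_forall hC)
      simp only [sub_mul]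
      rw [integral_sub (hm i1) (hm i2), sub_eq_zero, ← neg_inj, ← hid hθ, ← hid2 hθ]
      refine integral_congr_ae ?_
      filter_upwards [hgW] with x hx
      rw [hx]
      by_cases hxM : x ∈ M <;> simp [hxM]
  have hgi : ∀ᵐ x ∂(volume.restrict W), g.snd x i = 0 := by
    filter_upwards [hz, hgW] with x h1 h2
    simp only [h2, Pi.zero_apply] at h1
    by_cases hxM : x ∈ M
    · simp only [hxM, indicator_of_mem, one_mul, mul_one] at h1
      linear_combination -h1
    · simpa [hxM] using h1
  have h0 := hid hθ
  rw [integral_congr_ae (g := fun _ => (0 : ℂ)) (f := fun x => g.snd x i * (θ x : ℂ)) (by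
    filter_upwards [hgi] with x hx
    simp [hx])] at h0
  rw [integral_zero, neg_zero] at h0
  have h1 : ∫ x in W, g.fst x * ((partialDeriv i θ x : ℝ) : ℂ) =
      ∫ x in W, ((M.indicator (fun _ => (1 : ℝ)) x * partialDeriv i θ x : ℝ) : ℂ) := by
    refine integral_congr_ae ?_
    filter_upwards [hgW] with x hx
    rw [hx]
    by_cases hxM : x ∈ M <;> simp [hxM]
  have h2 : ((∫ x in W, M.indicator (fun _ => (1 : ℝ)) x * partialDeriv i θ x : ℝ) : ℂ) = 0 :=
    (integral_ofReal (𝕜 := ℂ)).symm.trans (h1.symm.trans h0)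
  rw [← setIntegral_eq_integral_of_forall_compl_eq_zero (s := W)
    fun x hx => by rw [hθ.partialDeriv_eq_zero_of_notMem i hx, mul_zero]]
  exact_mod_cast h2

/-- Nonnegative null vectors vanish almost everywhere or almost nowhere. -/
theorem null_vector_eq_zero_or_pos (hU : IsOpen U) (hUc : IsPreconnected U) (hUf : volume U ≠ ⊤)
    (hV : IsBddPotential U V) (hpos : ∀ p ∈ sobolev U, 0 ≤ schrodingerEnergy V p)
    {u : SobolevPair U} (hu : u ∈ sobolev U)
    (hu0 : ∀ᵐ x ∂(volume.restrict U), u.fst x = (‖u.fst x‖ : ℂ))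
    (hnull : schrodingerEnergy V u = 0) :
    (∀ᵐ x ∂(volume.restrict U), u.fst x = 0) ∨ (∀ᵐ x ∂(volume.restrict U), u.fst x ≠ 0) := by
  refine (null_or_conull_of_weak_deriv_eq_zero hU hUc (measurableSet_fst_ne_zero u)
    fun x hx => ?_).imp (fun h => ?_) fun h => h
  · obtain ⟨ε, hε, hεU⟩ := Metric.isOpen_iff.1 hU x hx
    -- The bump equals `1` on the ball of radius `ε / 4`, where its cut-off by `{u ≠ 0}` coincides
    -- with the indicator function.
    let b : ContDiffBump x := ⟨ε / 4, ε / 2, by positivity, by linarith⟩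
    have hb : IsTestFun U b := by
      refine ⟨b.contDiff, b.hasCompactSupport, ?_⟩
      rw [b.tsupport_eq]
      exact (Metric.closedBall_subset_ball (by show ε / 2 < ε; linarith)).trans hεU
    obtain ⟨g, hg, hge⟩ := exists_cut_mem_sobolev hUf hV hpos hb.ofReal.pair_mem hu (by
      filter_upwards [hb.ofReal.pair_fst] with y hy
      rw [hy, Complex.norm_real, Real.norm_of_nonneg b.nonneg]) hu0 hnull
    have hsub : Metric.ball x (ε / 4) ⊆ U :=
      (Metric.ball_subset_ball (by linarith)).trans hεU
    refine ⟨ε / 4, by positivity, fun θ hθ i => ?_⟩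
    refine integral_partialDeriv_eq_zero_of_indicator hUf hg Metric.isOpen_ball hsub ?_ hθ i
    filter_upwards [ae_restrict_of_ae_restrict_of_subset hsub hge,
      ae_restrict_of_ae_restrict_of_subset hsub hb.ofReal.pair_fst,
      ae_restrict_mem Metric.isOpen_ball.measurableSet] with y h1 h2 h3
    rw [h1]
    by_cases hy : u.fst y = 0
    · simp [hy]
    · rw [indicator_of_mem (by exact hy), indicator_of_mem (by exact hy), h2,
        b.one_of_mem_closedBall (Metric.ball_subset_closedBall h3), Complex.ofReal_one]
  · filter_upwards [h] with x hx
    simpa using hx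

/-- Real null vectors orthogonal to a positive null vector vanish. -/
theorem real_null_vector_eq_zero (hU : IsOpen U) (hUc : IsPreconnected U) (hUf : volume U ≠ ⊤)
    (hV : IsBddPotential U V) (hpos : ∀ p ∈ sobolev U, 0 ≤ schrodingerEnergy V p)
    {u f : SobolevPair U} (hf : f ∈ sobolev U)
    (hu0 : ∀ᵐ x ∂(volume.restrict U), u.fst x = (‖u.fst x‖ : ℂ) ∧ u.fst x ≠ 0)
    (hfr : ∀ᵐ x ∂(volume.restrict U), (f.fst x).im = 0)
    (hfnull : schrodingerEnergy V f = 0) (horth : (inner ℂ u.fst f.fst : ℂ) = 0) :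
    f.fst =ᵐ[volume.restrict U] 0 := by
  obtain ⟨z, hz, hz1, hz2⟩ := exists_abs_energy_le hUf V hf
  have hz3 : schrodingerEnergy V z = 0 := le_antisymm (hz2.trans hfnull.le) (hpos z hz)
  -- `|f| + f` is a nonnegative null vector, so it vanishes almost everywhere or almost nowhere.
  -- Hence `f` has one sign, which `∫ |u| f = 0` excludes unless `f = 0`.
  have hg := (sobolev U).add_mem hz ((sobolev U).smul_mem 1 hf)
  have hgn := hV.energy_add_smul_eq_zero hpos hz hf hz3 hfnull 1
  rw [one_smul] at hg hgn
  have hge : ∀ᵐ x ∂(volume.restrict U), (z + f).fst x = ((|(f.fst x).re| + (f.fst x).re : ℝ) : ℂ) ∧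
      f.fst x = ((f.fst x).re : ℂ) := by
    filter_upwards [hz1, hfr, Lp.coeFn_add z.fst f.fst] with x h1 h2 h3
    have h4 : f.fst x = ((f.fst x).re : ℂ) := Complex.ext (by simp) (by simp [h2])
    refine ⟨?_, h4⟩
    rw [WithLp.add_fst, h3, Pi.add_apply, h1]
    nth_rewrite 1 2 [h4]
    rw [Complex.norm_real, Real.norm_eq_abs]
    push_cast
    rfl
  have hgnn : ∀ᵐ x ∂(volume.restrict U), (z + f).fst x = (‖(z + f).fst x‖ : ℂ) := by
    filter_upwards [hge] with x hx
    rw [hx.1, Complex.norm_real, Real.norm_of_nonneg]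
    linarith [neg_abs_le (f.fst x).re]
  have hint : Integrable (fun x => ‖u.fst x‖ * (f.fst x).re) (volume.restrict U) :=
    (Lp.memLp u.fst).norm.integrable_mul (Lp.memLp f.fst).re
  have hzero : ∫ x in U, ‖u.fst x‖ * (f.fst x).re = 0 := by
    rw [L2.inner_def] at horth
    rw [integral_congr_ae (g := fun x => ((‖u.fst x‖ * (f.fst x).re : ℝ) : ℂ))] at horth
    · exact Complex.ofReal_eq_zero.1 ((integral_ofReal (𝕜 := ℂ)).symm.trans horth)
    · filter_upwards [hu0, hge] with x h1 h2
      rw [RCLike.inner_apply', h1.1, h2.2]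
      simp
  have hconc : (fun x => ‖u.fst x‖ * (f.fst x).re) =ᵐ[volume.restrict U] 0 := by
    rcases null_vector_eq_zero_or_pos hU hUc hUf hV hpos hg hgnn hgn with h | h
    · have hle : ∀ᵐ x ∂(volume.restrict U), 0 ≤ -(‖u.fst x‖ * (f.fst x).re) := by
        filter_upwards [h, hge] with x h1 h2
        rw [h2.1, Complex.ofReal_eq_zero] at h1
        have : (f.fst x).re ≤ 0 := by linarith [abs_nonneg (f.fst x).re]
        nlinarith [norm_nonneg (u.fst x)]
      have := (integral_eq_zero_iff_of_nonneg_ae hle hint.neg).1 (by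
        rw [integral_neg, hzero, neg_zero])
      filter_upwards [this] with x hx
      simpa using hx
    · have hle : ∀ᵐ x ∂(volume.restrict U), 0 ≤ ‖u.fst x‖ * (f.fst x).re := by
        filter_upwards [h, hge] with x h1 h2
        rw [h2.1, Ne, Complex.ofReal_eq_zero] at h1
        have : 0 ≤ (f.fst x).re := by
          by_contra hneg
          exact h1 (by rw [abs_of_neg (not_le.1 hneg)]; ring)
        positivity
      exact (integral_eq_zero_iff_of_nonneg_ae hle hint).1 hzero
  filter_upwards [hconc, hu0, hge] with x h1 h2 h3
  have h4 : ‖u.fst x‖ ≠ 0 := norm_ne_zero_iff.2 h2.2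
  have h5 : (f.fst x).re = 0 := by simpa [h4, h2.2] using h1
  rw [h3.2, h5]
  simp

/-- Nonnegative null vectors are multiples of a positive null vector. -/
theorem abs_null_vector_eq (hU : IsOpen U) (hUc : IsPreconnected U) (hUf : volume U ≠ ⊤)
    (hV : IsBddPotential U V) (hpos : ∀ p ∈ sobolev U, 0 ≤ schrodingerEnergy V p)
    {u w : SobolevPair U} (hu : u ∈ sobolev U) (hw : w ∈ sobolev U)
    (hu0 : ∀ᵐ x ∂(volume.restrict U), u.fst x = (‖u.fst x‖ : ℂ) ∧ u.fst x ≠ 0)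
    (hu1 : ‖u.fst‖ = 1)
    (hunull : schrodingerEnergy V u = 0) (hwnull : schrodingerEnergy V w = 0) :
    ∃ c : ℝ, ∀ᵐ x ∂(volume.restrict U), ‖w.fst x‖ = c * ‖u.fst x‖ := by
  obtain ⟨z, hz, hz1, hz2⟩ := exists_abs_energy_le hUf V hw
  have hz3 : schrodingerEnergy V z = 0 := le_antisymm (hz2.trans hwnull.le) (hpos z hz)
  -- The coefficient of the `L²` projection onto `u`: it makes `|w| - c u` a real null vector
  -- orthogonal to `u`.
  set c : ℝ := ∫ x in U, ‖u.fst x‖ * ‖w.fst x‖ with hc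
  have hcin : (inner ℂ u.fst z.fst : ℂ) = c := by
    rw [L2.inner_def, hc]
    refine Eq.trans ?_ (integral_ofReal (𝕜 := ℂ))
    refine integral_congr_ae ?_
    filter_upwards [hu0, hz1] with x h1 h2
    rw [RCLike.inner_apply', h1.1, h2]
    simp
  have hf := (sobolev U).add_mem hz ((sobolev U).smul_mem (-(c : ℂ)) hu)
  have hfn := hV.energy_add_smul_eq_zero hpos hz hu hz3 hunull (-(c : ℂ))
  have hfe : ∀ᵐ x ∂(volume.restrict U), (z + (-(c : ℂ)) • u).fst x =
      ((‖w.fst x‖ - c * ‖u.fst x‖ : ℝ) : ℂ) := by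
    filter_upwards [hz1, hu0, Lp.coeFn_add z.fst ((-(c : ℂ)) • u.fst),
      Lp.coeFn_smul (-(c : ℂ)) u.fst] with x h1 h2 h3 h4
    rw [WithLp.add_fst, WithLp.smul_fst, h3, Pi.add_apply, h4, Pi.smul_apply, h1, smul_eq_mul]
    nth_rewrite 1 [h2.1]
    push_cast
    ring
  have h0 := real_null_vector_eq_zero hU hUc hUf hV hpos hf hu0
    (by filter_upwards [hfe] with x hx; rw [hx, Complex.ofReal_im]) hfn (by
      rw [WithLp.add_fst, WithLp.smul_fst, inner_add_right, inner_smul_right, hcin,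
        inner_self_eq_norm_sq_to_K, hu1]
      simp)
  refine ⟨c, ?_⟩
  filter_upwards [h0, hfe] with x h1 h2
  rw [h2, Pi.zero_apply, Complex.ofReal_eq_zero] at h1
  linarith

/-- The null space is spanned by a positive null vector. -/
theorem null_vector_eq_smul (hU : IsOpen U) (hUc : IsPreconnected U) (hUf : volume U ≠ ⊤)
    (hV : IsBddPotential U V) (hpos : ∀ p ∈ sobolev U, 0 ≤ schrodingerEnergy V p)
    {u w : SobolevPair U} (hu : u ∈ sobolev U) (hw : w ∈ sobolev U)
    (hu0 : ∀ᵐ x ∂(volume.restrict U), u.fst x = (‖u.fst x‖ : ℂ) ∧ u.fst x ≠ 0)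
    (hu1 : ‖u.fst‖ = 1)
    (hunull : schrodingerEnergy V u = 0) (hwnull : schrodingerEnergy V w = 0) :
    ∃ c : ℂ, ∀ᵐ x ∂(volume.restrict U), w.fst x = c * u.fst x := by
  have hk : ∀ k : ℂ, ∃ c : ℝ, ∀ᵐ x ∂(volume.restrict U),
      ‖w.fst x + k * (‖u.fst x‖ : ℂ)‖ = c * ‖u.fst x‖ := by
    intro k
    obtain ⟨c, hc⟩ := abs_null_vector_eq hU hUc hUf hV hpos hu
      ((sobolev U).add_mem hw ((sobolev U).smul_mem k hu)) hu0 hu1 hunull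
      (hV.energy_add_smul_eq_zero hpos hw hu hwnull hunull k)
    refine ⟨c, ?_⟩
    filter_upwards [hc, hu0, Lp.coeFn_add w.fst (k • u.fst), Lp.coeFn_smul k u.fst]
      with x h1 h2 h3 h4
    rw [← h1, WithLp.add_fst, WithLp.smul_fst, h3, Pi.add_apply, h4, Pi.smul_apply, smul_eq_mul,
      ← h2.1]
  obtain ⟨c₀, h0⟩ := hk 0
  obtain ⟨c₁, h1⟩ := hk 1
  obtain ⟨c₂, h2⟩ := hk Complex.I
  -- Polarisation: `|w + u|² = |w|² + u² + 2u Re w` and `|w + iu|² = |w|² + u² + 2u Im w`, divided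
  -- by `u²`.
  refine ⟨⟨(c₁ ^ 2 - c₀ ^ 2 - 1) / 2, (c₂ ^ 2 - c₀ ^ 2 - 1) / 2⟩, ?_⟩
  filter_upwards [h0, h1, h2, hu0] with x h0 h1 h2 h3
  have ht : ‖u.fst x‖ ≠ 0 := norm_ne_zero_iff.2 h3.2
  set t := ‖u.fst x‖
  have e0 := congrArg (· ^ 2) h0
  have e1 := congrArg (· ^ 2) h1
  have e2 := congrArg (· ^ 2) h2
  simp only [← Complex.normSq_eq_norm_sq, Complex.normSq_apply, Complex.add_re, Complex.add_im,
    zero_mul, one_mul, Complex.zero_re, Complex.zero_im, Complex.ofReal_re, Complex.ofReal_im,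
    Complex.mul_re, Complex.mul_im, Complex.I_re, Complex.I_im] at e0 e1 e2
  rw [h3.1]
  apply Complex.ext
  · simp only [Complex.mul_re, Complex.ofReal_re, Complex.ofReal_im]
    apply mul_right_cancel₀ ht
    linear_combination (e1 - e0) / 2
  · simp only [Complex.mul_im, Complex.ofReal_re, Complex.ofReal_im]
    apply mul_right_cancel₀ ht
    linear_combination (e2 - e0) / 2

end NullVectors

/-! ### The Hartree functional on `H¹₀` -/

section Hartree

variable {d : ℕ} {U : Set (EuclideanSpace ℝ (Fin d))} {w : EuclideanSpace ℝ (Fin d) → ℝ}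

/-- The interaction `∬ w(x - y) |f(x)|² |g(y)|² dx dy` of two densities. -/
noncomputable def densityForm (w : EuclideanSpace ℝ (Fin d) → ℝ)
    (f g : Lp ℂ 2 (volume.restrict U)) : ℝ :=
  kernelForm w (volume.restrict U) (fun x => ‖f x‖ ^ 2) (fun x => ‖g x‖ ^ 2)

/-- The Hartree functional with coupling constant `c`. -/
noncomputable def hartreeEnergy (w : EuclideanSpace ℝ (Fin d) → ℝ) (c : ℝ) (p : SobolevPair U) :
    ℝ :=
  ‖p.snd‖ ^ 2 + c * densityForm w p.fst p.fst

theorem integral_norm_mul_norm_le {α : Type*} [MeasurableSpace α] {μ : Measure α}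
    (f g : Lp ℂ 2 μ) : ∫ x, ‖f x‖ * ‖g x‖ ∂μ ≤ ‖f‖ * ‖g‖ := by
  have h := real_inner_le_norm ((Lp.memLp f).norm.toLp _) ((Lp.memLp g).norm.toLp _)
  rw [Lp.norm_toLp, Lp.norm_toLp, eLpNorm_norm, eLpNorm_norm, ← Lp.norm_def, ← Lp.norm_def,
    L2.inner_def] at h
  refine le_of_eq_of_le (integral_congr_ae ?_) h
  filter_upwards [(Lp.memLp f).norm.coeFn_toLp, (Lp.memLp g).norm.coeFn_toLp] with x h1 h2
  rw [h1, h2]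
  simp [mul_comm]

theorem integral_abs_density_sub_le {α : Type*} [MeasurableSpace α] {μ : Measure α}
    (f g : Lp ℂ 2 μ) :
    ∫ x, |‖f x‖ ^ 2 - ‖g x‖ ^ 2| ∂μ ≤ ‖f - g‖ * ‖f‖ + ‖f - g‖ * ‖g‖ := by
  have hi : ∀ f g : Lp ℂ 2 μ, Integrable (fun x => ‖f x‖ * ‖g x‖) μ := fun f g =>
    (Lp.memLp f).norm.integrable_mul (Lp.memLp g).norm
  refine le_trans ?_ (add_le_add (integral_norm_mul_norm_le (f - g) f)
    (integral_norm_mul_norm_le (f - g) g))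
  rw [← integral_add (hi _ _) (hi _ _)]
  refine integral_mono_ae ((L2_integrable_sq f).sub (L2_integrable_sq g)).abs
    ((hi _ _).add (hi _ _)) ?_
  filter_upwards [Lp.coeFn_sub f g] with x hx
  rw [hx, Pi.sub_apply, sq_sub_sq, abs_mul, abs_of_nonneg (by positivity)]
  have := abs_norm_sub_norm_le (f x) (g x)
  nlinarith [norm_nonneg (f x), norm_nonneg (g x)]

/-- The difference of the two energies is the kernel form of `|fₙ|² - |g|²` and `|fₙ|² + |g|²`. The
kernel is bounded and the first density tends to zero in `L¹`. -/
theorem IsPosKernel.tendsto_densityForm (hw : IsPosKernel w)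
    {f : ℕ → Lp ℂ 2 (volume.restrict U)} {g : Lp ℂ 2 (volume.restrict U)}
    (h : Tendsto f atTop (𝓝 g)) :
    Tendsto (fun n => densityForm w (f n) (f n)) atTop (𝓝 (densityForm w g g)) := by
  obtain ⟨C, hC⟩ := hw.bounded
  have hC0 : 0 ≤ C := (abs_nonneg _).trans (hC 0)
  have hbd : ∀ n, |densityForm w (f n) (f n) - densityForm w g g| ≤
      C * ((‖f n - g‖ * ‖f n‖ + ‖f n - g‖ * ‖g‖) * (‖f n‖ ^ 2 + ‖g‖ ^ 2)) := by
    intro n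
    have i1 := L2_integrable_sq (f n)
    have i2 := L2_integrable_sq g
    have i3 : Integrable (fun x => ‖f n x‖ ^ 2 - ‖g x‖ ^ 2) (volume.restrict U) := i1.sub i2
    have i4 : Integrable (fun x => ‖f n x‖ ^ 2 + ‖g x‖ ^ 2) (volume.restrict U) := i1.add i2
    have e : densityForm w (f n) (f n) - densityForm w g g =
        kernelForm w (volume.restrict U) (fun x => ‖f n x‖ ^ 2 - ‖g x‖ ^ 2)
          (fun x => ‖f n x‖ ^ 2 + ‖g x‖ ^ 2) := by
      have h1 := hw.kernelForm_combo_left i1 i2 i4 1 (-1)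
      have h2 := hw.kernelForm_combo_left i1 i2 i1 1 1
      have h3 := hw.kernelForm_combo_left i1 i2 i2 1 1
      simp only [one_mul, neg_mul, ← sub_eq_add_neg] at h1 h2 h3
      rw [h1, hw.kernelForm_comm (f := fun x => ‖f n x‖ ^ 2), h2,
        hw.kernelForm_comm (f := fun x => ‖g x‖ ^ 2) (g := fun x => ‖f n x‖ ^ 2 + ‖g x‖ ^ 2), h3,
        hw.kernelForm_comm (f := fun x => ‖g x‖ ^ 2) (g := fun x => ‖f n x‖ ^ 2)]
      simp only [densityForm]
      ring
    rw [e]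
    refine (abs_kernelForm_le hC i3 i4).trans ?_
    gcongr
    · exact integral_abs_density_sub_le _ _
    · rw [L2_norm_sq, L2_norm_sq, ← integral_add i1 i2]
      refine le_of_eq (integral_congr_ae (Eventually.of_forall fun x => ?_))
      exact abs_of_nonneg (by positivity)
  have h0 : Tendsto (fun n => ‖f n - g‖) atTop (𝓝 0) := tendsto_iff_norm_sub_tendsto_zero.1 h
  have hlim : Tendsto (fun n => C * ((‖f n - g‖ * ‖f n‖ + ‖f n - g‖ * ‖g‖)
      * (‖f n‖ ^ 2 + ‖g‖ ^ 2))) atTop (𝓝 (C * ((0 * ‖g‖ + 0 * ‖g‖) * (‖g‖ ^ 2 + ‖g‖ ^ 2)))) :=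
    (((h0.mul h.norm).add (h0.mul_const _)).mul ((h.norm.pow 2).add_const _)).const_mul C
  rw [tendsto_iff_norm_sub_tendsto_zero]
  refine squeeze_zero (fun _ => norm_nonneg _) hbd ?_
  simpa using hlim

theorem IsPosKernel.densityForm_nonneg (hw : IsPosKernel w) (f : Lp ℂ 2 (volume.restrict U)) :
    0 ≤ densityForm w f f :=
  hw.nonneg _ _ (L2_integrable_sq f)

theorem hartreeEnergy_nonneg (hw : IsPosKernel w) {c : ℝ} (hc : 0 ≤ c) (p : SobolevPair U) :
    0 ≤ hartreeEnergy w c p :=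
  add_nonneg (by positivity) (mul_nonneg hc (hw.densityForm_nonneg _))

theorem exists_normalized_sobolev (hU : IsOpen U) (hne : U.Nonempty) :
    ∃ p ∈ sobolev U, ‖p.fst‖ = 1 := by
  obtain ⟨x, hx⟩ := hne
  obtain ⟨ε, hε, hεU⟩ := Metric.isOpen_iff.1 hU x hx
  let b : ContDiffBump x := ⟨ε / 4, ε / 2, by positivity, by linarith⟩
  have hb : IsTestFun U b := by
    refine ⟨b.contDiff, b.hasCompactSupport, ?_⟩
    rw [b.tsupport_eq]
    exact (Metric.closedBall_subset_ball (by show ε / 2 < ε; linarith)).trans hεU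
  have h0 : hb.ofReal.pair.fst ≠ 0 := by
    intro h
    have h1 := hb.ofReal.pair_fst
    rw [h] at h1
    have hsub : Metric.ball x (ε / 4) ⊆ U :=
      (Metric.ball_subset_ball (by linarith)).trans hεU
    have h2 : ∀ᵐ y ∂(volume.restrict (Metric.ball x (ε / 4))), False := by
      filter_upwards [ae_restrict_of_ae_restrict_of_subset hsub h1,
        ae_restrict_of_ae_restrict_of_subset hsub (Lp.coeFn_zero ℂ 2 (volume.restrict U)),
        ae_restrict_mem Metric.isOpen_ball.measurableSet] with y h1 h2 h3
      rw [h2, b.one_of_mem_closedBall (Metric.ball_subset_closedBall h3)] at h1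
      simp at h1
    rw [eventually_false_iff_eq_bot, ae_eq_bot, Measure.restrict_eq_zero] at h2
    exact (Metric.measure_ball_pos volume x (by positivity)).ne' h2
  refine ⟨((‖hb.ofReal.pair.fst‖⁻¹ : ℝ) : ℂ) • hb.ofReal.pair,
    (sobolev U).smul_mem _ hb.ofReal.pair_mem, ?_⟩
  rw [WithLp.smul_fst, norm_smul, Complex.norm_real, norm_inv, norm_norm,
    inv_mul_cancel₀ (norm_ne_zero_iff.2 h0)]

/-- Bounded sequences in `H¹₀(U)` have subsequences converging in `L²(U)`. -/
theorem exists_tendsto_fst_of_bounded (hU : volume U ≠ ⊤) {p : ℕ → SobolevPair U}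
    (hp : ∀ n, p n ∈ sobolev U) {R : ℝ} (hR : ∀ n, ‖p n‖ ≤ R) :
    ∃ g : ℕ → ℕ, StrictMono g ∧ ∃ f, Tendsto (fun n => (p (g n)).fst) atTop (𝓝 f) := by
  have hδ : ∀ n : ℕ, (0 : ℝ) < 1 / ((n : ℝ) + 1) := fun n => by positivity
  have hex : ∀ n, ∃ φ : EuclideanSpace ℝ (Fin d) → ℂ, ∃ h : IsTestFun U φ,
      ‖h.pair - p n‖ < 1 / ((n : ℝ) + 1) := by
    intro n
    obtain ⟨φ, hφ, hl⟩ := exists_test_seq (hp n)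
    obtain ⟨k, hk⟩ := (Metric.tendsto_nhds.1 hl _ (hδ n)).exists
    exact ⟨φ k, hφ k, by rwa [dist_eq_norm] at hk⟩
  choose φ hφ hφn using hex
  obtain ⟨g, hg, f, hf⟩ := exists_tendsto_fst_of_bounded_test hU hφ (R := R + 1) fun n => by
    have h1 : 1 / ((n : ℝ) + 1) ≤ 1 := by
      rw [div_le_one (by positivity)]; linarith [(Nat.cast_nonneg n : (0 : ℝ) ≤ n)]
    have h2 := norm_le_norm_add_norm_sub' (hφ n).pair (p n)
    linarith [hR n, hφn n]
  refine ⟨g, hg, f, ?_⟩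
  have h0 : Tendsto (fun n => (hφ (g n)).pair.fst - (p (g n)).fst) atTop (𝓝 0) := by
    refine squeeze_zero_norm (fun n => ?_)
      ((tendsto_one_div_add_atTop_nhds_zero_nat (𝕜 := ℝ)).comp hg.tendsto_atTop)
    rw [← WithLp.sub_fst]
    exact (WithLp.norm_fst_le _ _).trans (hφn (g n)).le
  simpa using hf.sub h0

theorem exists_hartree_minimizer (hU : IsOpen U) (hne : U.Nonempty) (hUf : volume U ≠ ⊤)
    (hw : IsPosKernel w) {c : ℝ} (hc : 0 ≤ c) :
    ∃ u ∈ sobolev U, ‖u.fst‖ = 1 ∧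
      (∀ᵐ x ∂(volume.restrict U), u.fst x = (‖u.fst x‖ : ℂ)) ∧
      ∀ p ∈ sobolev U, ‖p.fst‖ = 1 → hartreeEnergy w c u ≤ hartreeEnergy w c p := by
  let S : Set ℝ := {E | ∃ p ∈ sobolev U, ‖p.fst‖ = 1 ∧ hartreeEnergy w c p = E}
  have hSne : S.Nonempty := by
    obtain ⟨p, hp, hp1⟩ := exists_normalized_sobolev hU hne
    exact ⟨_, p, hp, hp1, rfl⟩
  have hSb : BddBelow S := ⟨0, by
    rintro _ ⟨p, -, -, rfl⟩
    exact hartreeEnergy_nonneg hw hc p⟩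
  obtain ⟨e, -, hel, heS⟩ := exists_seq_tendsto_sInf hSne hSb
  choose p hp hp1 hpe using heS
  obtain ⟨R, hR⟩ := hel.bddAbove_range
  have hbd : ∀ n, ‖p n‖ ≤ √(1 + R) := by
    intro n
    apply Real.le_sqrt_of_sq_le
    rw [WithLp.prod_norm_sq_eq_of_L2, hp1, one_pow]
    have h1 : e n ≤ R := hR (mem_range_self n)
    have h2 := mul_nonneg hc (hw.densityForm_nonneg (p n).fst)
    have h3 := hpe n
    rw [hartreeEnergy] at h3
    linarith
  obtain ⟨g, hg, f, hf⟩ := exists_tendsto_fst_of_bounded hUf hp hbd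
  have hf1 : ‖f‖ = 1 := by
    refine tendsto_nhds_unique hf.norm ?_
    simp [hp1]
  -- The gradient term is bounded by energy minus interaction, which converges to the infimum minus
  -- the interaction of the limit; so the limit attains the infimum.
  obtain ⟨q, hq, hqf, hqs⟩ := sobolev_lsc (fun n => hp (g n)) hf
    (C := fun n => e (g n) - c * densityForm w (p (g n)).fst (p (g n)).fst)
    (fun n => by rw [← hpe, hartreeEnergy]; linarith)
    ((hel.comp hg.tendsto_atTop).sub ((hw.tendsto_densityForm hf).const_mul c))
  obtain ⟨u, hu, hu1, hu2⟩ := exists_abs_mem_sobolev hUf hq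
  have hun : ∀ᵐ x ∂(volume.restrict U), ‖u.fst x‖ = ‖q.fst x‖ := by
    filter_upwards [hu1] with x hx
    simp [hx]
  refine ⟨u, hu, ?_, ?_, fun r hr hr1 => ?_⟩
  · rw [← hf1, ← hqf, Lp.norm_def, Lp.norm_def, eLpNorm_congr_norm_ae hun]
  · filter_upwards [hu1, hun] with x h1 h2
    rw [h2, h1]
  · have h1 : densityForm w u.fst u.fst = densityForm w f f := by
      rw [← hqf]
      refine kernelForm_congr ?_ ?_ <;>
      · filter_upwards [hun] with x hx
        rw [hx]
    have h2 : sInf S ≤ hartreeEnergy w c r := csInf_le hSb ⟨r, hr, hr1, rfl⟩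
    rw [hartreeEnergy, h1]
    linarith

/-- Hartree minimisers minimise the quadratic form of their mean-field operator. -/
theorem hartreeEnergy_le_meanField (hUf : volume U ≠ ⊤) (hw : IsPosKernel w) {c : ℝ}
    {u : SobolevPair U} (hu : u ∈ sobolev U) (hu1 : ‖u.fst‖ = 1)
    (hmin : ∀ p ∈ sobolev U, ‖p.fst‖ = 1 → hartreeEnergy w c u ≤ hartreeEnergy w c p)
    {p : SobolevPair U} (hp : p ∈ sobolev U) (hp1 : ‖p.fst‖ = 1) :
    hartreeEnergy w c u ≤ ‖p.snd‖ ^ 2 + 2 * c * densityForm w p.fst u.fst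
      - c * densityForm w u.fst u.fst := by
  -- The competitor is the square root of the density `(1-t)|u|² + t|p|²`. Its gradient term is at
  -- most the convex combination, and its interaction is a quadratic polynomial in `t`.
  have key : ∀ t : ℝ, 0 < t → t < 1 → hartreeEnergy w c u ≤ (1 - t) * ‖u.snd‖ ^ 2
      + t * ‖p.snd‖ ^ 2 + c * ((1 - t) ^ 2 * densityForm w u.fst u.fst
        + 2 * (1 - t) * t * densityForm w u.fst p.fst + t ^ 2 * densityForm w p.fst p.fst) := by
    intro t h0 h1
    have hn : ∀ s : ℝ, 0 ≤ s → ‖((√s : ℝ) : ℂ)‖ ^ 2 = s := fun s hs => by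
      rw [Complex.norm_real, Real.norm_of_nonneg (Real.sqrt_nonneg s), Real.sq_sqrt hs]
    obtain ⟨s, hs, hs1, hs2⟩ := exists_sqrt_mem_sobolev hUf
      ((sobolev U).smul_mem ((√(1 - t) : ℝ) : ℂ) hu) ((sobolev U).smul_mem ((√t : ℝ) : ℂ) hp)
    have hd : (fun x => ‖s.fst x‖ ^ 2) =ᵐ[volume.restrict U]
        fun x => (1 - t) * ‖u.fst x‖ ^ 2 + t * ‖p.fst x‖ ^ 2 := by
      filter_upwards [hs1, Lp.coeFn_smul ((√(1 - t) : ℝ) : ℂ) u.fst,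
        Lp.coeFn_smul ((√t : ℝ) : ℂ) p.fst] with x h2 h3 h4
      rw [h2, WithLp.smul_fst, WithLp.smul_fst, h3, h4, Pi.smul_apply, Pi.smul_apply, norm_smul,
        norm_smul, mul_pow, mul_pow, hn _ (by positivity), hn (1 - t) (by linarith), hn t h0.le]
    have hsn : ‖s.fst‖ = 1 := by
      have : ‖s.fst‖ ^ 2 = 1 := by
        rw [L2_norm_sq, integral_congr_ae hd, integral_add ((L2_integrable_sq _).const_mul _)
          ((L2_integrable_sq _).const_mul _), integral_const_mul, integral_const_mul,
          ← L2_norm_sq, ← L2_norm_sq, hu1, hp1]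
        ring
      nlinarith [norm_nonneg s.fst]
    have h2 := hmin s hs hsn
    rw [WithLp.smul_snd, WithLp.smul_snd, norm_smul, norm_smul, mul_pow, mul_pow,
      hn _ (by linarith), hn _ h0.le] at hs2
    have h3 : densityForm w s.fst s.fst = (1 - t) ^ 2 * densityForm w u.fst u.fst
        + 2 * (1 - t) * t * densityForm w u.fst p.fst + t ^ 2 * densityForm w p.fst p.fst := by
      rw [densityForm, kernelForm_congr hd hd,
        hw.kernelForm_combo (L2_integrable_sq _) (L2_integrable_sq _)]
      rfl
    rw [hartreeEnergy.eq_def w c s, h3] at h2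
    linarith
  have hcomm : densityForm w u.fst p.fst = densityForm w p.fst u.fst := hw.kernelForm_comm
  rw [hcomm] at key
  simp only [hartreeEnergy] at key ⊢
  set a := ‖u.snd‖ ^ 2
  set b := ‖p.snd‖ ^ 2
  set k₁ := densityForm w u.fst u.fst
  set k₂ := densityForm w p.fst u.fst
  set k₃ := densityForm w p.fst p.fst
  -- This is the difference quotient at `t = 0` of the upper bound in `key`; its limit is the
  -- one-sided derivative, which cannot be negative.
  have hlim : Tendsto (fun t : ℝ => b - a + c * (-2 * k₁ + 2 * k₂)
      + t * (c * (k₁ - 2 * k₂ + k₃))) (𝓝[>] 0) (𝓝 (b - a + c * (-2 * k₁ + 2 * k₂)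
      + 0 * (c * (k₁ - 2 * k₂ + k₃)))) := by
    refine Tendsto.mono_left ?_ nhdsWithin_le_nhds
    exact (Continuous.tendsto (by fun_prop) 0)
  have h0 : 0 ≤ b - a + c * (-2 * k₁ + 2 * k₂) + 0 * (c * (k₁ - 2 * k₂ + k₃)) := by
    refine ge_of_tendsto hlim ?_
    filter_upwards [Ioo_mem_nhdsGT (show (0 : ℝ) < 1 by norm_num)] with t ht
    have h1 := key t ht.1 ht.2
    have h2 : 0 ≤ t * (b - a + c * (-2 * k₁ + 2 * k₂) + t * (c * (k₁ - 2 * k₂ + k₃))) := by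
      linarith
    exact nonneg_of_mul_nonneg_right h2 ht.1
  linarith

/-- The mean-field potential of `u`, shifted by the energy `ε`. -/
noncomputable def meanFieldPotential (w : EuclideanSpace ℝ (Fin d) → ℝ) (c : ℝ)
    (u : SobolevPair U) (ε : ℝ) (x : EuclideanSpace ℝ (Fin d)) : ℝ :=
  2 * c * densityConv U w u.fst x - (c * densityForm w u.fst u.fst + ε)

theorem isBddPotential_meanField (hw : IsPosKernel w) (c : ℝ) (u : SobolevPair U) (ε : ℝ) :
    IsBddPotential U (meanFieldPotential w c u ε) := by
  obtain ⟨C, hC⟩ := hw.bounded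
  refine ⟨?_, |2 * c| * ((∫ y in U, ‖u.fst y‖ ^ 2) * C) + |c * densityForm w u.fst u.fst + ε|,
    fun x => ?_⟩
  · exact (((hw.continuous_densityConv (Lp.memLp u.fst)).const_mul (2 * c)).sub
      continuous_const).aestronglyMeasurable
  · refine (abs_sub _ _).trans ?_
    rw [abs_mul]
    gcongr
    exact IsPosKernel.abs_densityConv_le hC (Lp.memLp u.fst) x

theorem meanField_energy_eq (hw : IsPosKernel w) (c : ℝ) (u p : SobolevPair U) (ε : ℝ) :
    schrodingerEnergy (meanFieldPotential w c u ε) p = ‖p.snd‖ ^ 2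
      + 2 * c * densityForm w p.fst u.fst
      - (c * densityForm w u.fst u.fst + ε) * ‖p.fst‖ ^ 2 := by
  obtain ⟨C, hC⟩ := hw.bounded
  have hi : Integrable (fun x => densityConv U w u.fst x * ‖p.fst x‖ ^ 2) (volume.restrict U) :=
    (L2_integrable_sq p.fst).bdd_mul
      (hw.continuous_densityConv (Lp.memLp u.fst)).aestronglyMeasurable
      (Eventually.of_forall fun x => IsPosKernel.abs_densityConv_le hC (Lp.memLp u.fst) x)
  have h := hw.integral_densityConv_mul (Lp.memLp u.fst) (L2_integrable_sq p.fst)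
  rw [schrodingerEnergy, L2_norm_sq p.fst, densityForm, ← h, ← integral_const_mul,
    ← integral_const_mul, add_sub_assoc, ← integral_sub (hi.const_mul _)
    ((L2_integrable_sq _).const_mul _)]
  congr 2 with x
  rw [meanFieldPotential]
  ring

theorem meanField_energy_nonneg (hUf : volume U ≠ ⊤) (hw : IsPosKernel w) {c : ℝ}
    {u : SobolevPair U} (hu : u ∈ sobolev U) (hu1 : ‖u.fst‖ = 1)
    (hmin : ∀ p ∈ sobolev U, ‖p.fst‖ = 1 → hartreeEnergy w c u ≤ hartreeEnergy w c p)
    {p : SobolevPair U} (hp : p ∈ sobolev U) :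
    0 ≤ schrodingerEnergy (meanFieldPotential w c u (hartreeEnergy w c u)) p := by
  by_cases h0 : p.fst = 0
  · rw [schrodingerEnergy]
    have : ∫ x in U, meanFieldPotential w c u (hartreeEnergy w c u) x * ‖p.fst x‖ ^ 2 = 0 := by
      rw [integral_congr_ae (g := fun _ => (0 : ℝ)), integral_zero]
      rw [h0]
      filter_upwards [Lp.coeFn_zero ℂ 2 (volume.restrict U)] with x hx
      rw [hx, Pi.zero_apply, norm_zero]
      ring
    rw [this, add_zero]
    positivity
  · have hn : ‖p.fst‖ ≠ 0 := norm_ne_zero_iff.2 h0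
    set q := ((‖p.fst‖⁻¹ : ℝ) : ℂ) • p with hq
    have hq1 : ‖q.fst‖ = 1 := by
      rw [hq, WithLp.smul_fst, norm_smul, Complex.norm_real, norm_inv, norm_norm,
        inv_mul_cancel₀ hn]
    have hqs : q ∈ sobolev U := (sobolev U).smul_mem _ hp
    have h1 := hartreeEnergy_le_meanField hUf hw hu hu1 hmin hqs hq1
    have h2 : 0 ≤ schrodingerEnergy (meanFieldPotential w c u (hartreeEnergy w c u)) q := by
      rw [meanField_energy_eq hw, hq1]
      linarith
    rw [hq, energy_smul] at h2
    have h3 : 0 < ‖((‖p.fst‖⁻¹ : ℝ) : ℂ)‖ ^ 2 := by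
      have := norm_pos_iff.2 h0
      rw [Complex.norm_real, norm_inv, norm_norm]
      positivity
    exact nonneg_of_mul_nonneg_right h2 h3

theorem meanField_energy_self (hw : IsPosKernel w) (c : ℝ) {u : SobolevPair U}
    (hu1 : ‖u.fst‖ = 1) :
    schrodingerEnergy (meanFieldPotential w c u (hartreeEnergy w c u)) u = 0 := by
  rw [meanField_energy_eq hw, hu1, hartreeEnergy]
  ring

/-- The mean-field energy is dominated by the Hartree energy, by positivity of the interaction. -/
theorem meanField_energy_le_hartree (hw : IsPosKernel w) {c : ℝ} (hc : 0 ≤ c)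
    (u p : SobolevPair U) (hp1 : ‖p.fst‖ = 1) (ε : ℝ) :
    schrodingerEnergy (meanFieldPotential w c u ε) p ≤ hartreeEnergy w c p - ε := by
  -- Positive type is applied to `|p|² - |u|²`: its self-interaction times `c` is exactly the gap
  -- between the two sides.
  have h := hw.nonneg (volume.restrict U) (fun x => 1 * ‖p.fst x‖ ^ 2 + (-1) * ‖u.fst x‖ ^ 2)
    (((L2_integrable_sq p.fst).const_mul 1).add ((L2_integrable_sq u.fst).const_mul (-1)))
  have h2 := hw.kernelForm_combo (L2_integrable_sq p.fst) (L2_integrable_sq u.fst) 1 (-1)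
  rw [kernelForm] at h2
  rw [h2] at h
  have h3 : 0 ≤ densityForm w p.fst p.fst - 2 * densityForm w p.fst u.fst
      + densityForm w u.fst u.fst := by
    simp only [densityForm]
    linarith
  rw [meanField_energy_eq hw, hp1, hartreeEnergy]
  nlinarith [mul_nonneg hc h3]

end Hartree

/-! ### Translation to functions on `ℝ^d` -/

section Translation

variable {d : ℕ} {U : Set (EuclideanSpace ℝ (Fin d))} {v w : EuclideanSpace ℝ (Fin d) → ℝ}

theorem weakGrad_ae_eq_snd (hU : IsOpen U) {p : SobolevPair U} (hp : p ∈ sobolev U)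
    {ψ : EuclideanSpace ℝ (Fin d) → ℂ} (h : p.fst =ᵐ[volume.restrict U] ψ) :
    weakGrad U ψ =ᵐ[volume.restrict U] p.snd :=
  weakGrad_ae_eq hU ((hasWeakGrad_of_mem_sobolev hp).congr h (ae_eq_refl _))

theorem eLpNorm_eq_one_iff {p : SobolevPair U} {ψ : EuclideanSpace ℝ (Fin d) → ℂ}
    (h : p.fst =ᵐ[volume.restrict U] ψ) :
    eLpNorm ψ 2 (volume.restrict U) = 1 ↔ ‖p.fst‖ = 1 := by
  rw [Lp.norm_def, eLpNorm_congr_ae h, ENNReal.toReal_eq_one_iff]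

theorem isNormalizedH10_iff (hU : IsOpen U) {ψ : EuclideanSpace ℝ (Fin d) → ℂ} :
    IsNormalizedH10 U ψ ↔ ∃ p ∈ sobolev U, p.fst =ᵐ[volume.restrict U] ψ ∧ ‖p.fst‖ = 1 := by
  rw [IsNormalizedH10, memH10_iff hU]
  constructor
  · rintro ⟨⟨p, hp, h⟩, h1⟩
    exact ⟨p, hp, h, (eLpNorm_eq_one_iff h).1 h1⟩
  · rintro ⟨p, hp, h, h1⟩
    exact ⟨⟨p, hp, h⟩, (eLpNorm_eq_one_iff h).2 h1⟩

theorem interactionEnergy_eq_densityForm (hw : IsPosKernel w) (hvw : v =ᵐ[volume] w)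
    {p : SobolevPair U} {ψ : EuclideanSpace ℝ (Fin d) → ℂ}
    (h : p.fst =ᵐ[volume.restrict U] ψ) :
    interactionEnergy U v ψ = densityForm w p.fst p.fst := by
  have h2 : (fun x => ‖ψ x‖ ^ 2) =ᵐ[volume.restrict U] fun x => ‖p.fst x‖ ^ 2 := by
    filter_upwards [h] with x hx
    rw [hx]
  rw [interactionEnergy_congr hvw, hw.interactionEnergy_eq ((Lp.memLp p.fst).ae_eq h),
    kernelForm_congr h2 h2, densityForm]

theorem hartree_eq (hU : IsOpen U) (hw : IsPosKernel w) (hvw : v =ᵐ[volume] w) (N : ℕ)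
    {p : SobolevPair U} (hp : p ∈ sobolev U) {ψ : EuclideanSpace ℝ (Fin d) → ℂ}
    (h : p.fst =ᵐ[volume.restrict U] ψ) :
    hartree U v N ψ = hartreeEnergy w (((N : ℝ) - 1) / 2) p := by
  rw [hartree, hartreeEnergy, interactionEnergy_eq_densityForm hw hvw h, L2_norm_sq]
  congr 1
  refine integral_congr_ae ?_
  filter_upwards [weakGrad_ae_eq_snd hU hp h] with x hx
  rw [hx]

/-- The shift `ε` is free: it enters the potential and the added inner product with opposite signs.
The coupling `c = (N-1)/2` gives the factor `2c = N-1` in front of the convolution. -/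
theorem meanFieldForm_eq (hU : IsOpen U) {A : Set (EuclideanSpace ℝ (Fin d))} (hA : U ⊆ A)
    (hw : IsPosKernel w) (hvw : v =ᵐ[volume] w) (N : ℕ) (u : SobolevPair U) (ε : ℝ)
    {p r : SobolevPair U} (hp : p ∈ sobolev U) (hr : r ∈ sobolev U)
    {φ ψ : EuclideanSpace ℝ (Fin d) → ℂ}
    (hφ : p.fst =ᵐ[volume.restrict U] φ) (hψ : r.fst =ᵐ[volume.restrict U] ψ) :
    meanFieldForm A U v N (U.indicator u.fst) φ ψ
      = schrodingerForm (meanFieldPotential w (((N : ℝ) - 1) / 2) u ε) p r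
        + ε * ∫ x in U, conj (φ x) * ψ x := by
  obtain ⟨C, hC⟩ := hw.bounded
  have hD : IsBddPotential U (densityConv U w u.fst) :=
    ⟨(hw.continuous_densityConv (Lp.memLp u.fst)).aestronglyMeasurable, _,
      fun x => IsPosKernel.abs_densityConv_le hC (Lp.memLp u.fst) x⟩
  have hi := L2.integrable_inner (𝕜 := ℂ) p.fst r.fst
  simp only [RCLike.inner_apply'] at hi
  have h1 : ∫ x in U, inner ℂ (weakGrad U φ x) (weakGrad U ψ x) = inner ℂ p.snd r.snd := by
    rw [L2.inner_def]
    refine integral_congr_ae ?_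
    filter_upwards [weakGrad_ae_eq_snd hU hp hφ, weakGrad_ae_eq_snd hU hr hψ] with x h2 h3
    rw [h2, h3]
  have h2 : ∫ x in U, (densityConv U w u.fst x : ℂ) * (conj (φ x) * ψ x) =
      ∫ x in U, (densityConv U w u.fst x : ℂ) * (conj (p.fst x) * r.fst x) := by
    refine integral_congr_ae ?_
    filter_upwards [hφ, hψ] with x h2 h3
    rw [h2, h3]
  have h3 : ∫ x in U, conj (φ x) * ψ x = ∫ x in U, conj (p.fst x) * r.fst x := by
    refine integral_congr_ae ?_
    filter_upwards [hφ, hψ] with x h2 h3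
    rw [h2, h3]
  have h4 : ∫ x in U, (meanFieldPotential w (((N : ℝ) - 1) / 2) u ε x : ℂ)
        * (conj (p.fst x) * r.fst x) =
      ((N : ℂ) - 1) * (∫ x in U, (densityConv U w u.fst x : ℂ) * (conj (p.fst x) * r.fst x))
        - (((N : ℂ) - 1) / 2 * (densityForm w u.fst u.fst : ℂ) + ε)
          * ∫ x in U, conj (p.fst x) * r.fst x := by
    rw [← integral_const_mul, ← integral_const_mul, ← integral_sub
      ((hD.integrable _ _).const_mul _) (hi.const_mul _)]
    congr 1 with x
    rw [meanFieldPotential]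
    push_cast
    ring
  rw [meanFieldForm, densityConv_indicator hU.measurableSet hA,
    interactionEnergy_indicator hU.measurableSet hA, densityConv_congr hvw,
    interactionEnergy_eq_densityForm hw hvw (ae_eq_refl _), h1, h2, h3, schrodingerForm, h4]
  ring

theorem norm_eq_one_of_ae_eq_const_mul {f g : Lp ℂ 2 (volume.restrict U)} (hf : ‖f‖ = 1)
    (hg : ‖g‖ = 1) {c : ℂ} (h : ∀ᵐ x ∂(volume.restrict U), g x = c * f x) : ‖c‖ = 1 := by
  have : g = c • f := by
    refine Lp.ext ?_
    filter_upwards [h, Lp.coeFn_smul c f] with x h1 h2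
    rw [h1, h2, Pi.smul_apply, smul_eq_mul]
  rw [this, norm_smul, hf, mul_one] at hg
  exact hg

end Translation

/-! ### Hartree minimisers on a domain -/

/-- Both uniqueness claims reduce to the null space of the mean-field form shifted by `ε`, which is
the line through `u`. -/
theorem exists_hartree_ground_state {d : ℕ} {A U : Set (EuclideanSpace ℝ (Fin d))}
    (hU : IsOpen U) (hUc : IsPreconnected U) (hne : U.Nonempty) (hUf : volume U ≠ ⊤)
    (hA : U ⊆ A) {v : EuclideanSpace ℝ (Fin d) → ℝ} (hv : IsInteraction v) {N : ℕ} (hN : 1 ≤ N) :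
    ∃ (u : EuclideanSpace ℝ (Fin d) → ℂ) (ε : ℝ),
      IsNormalizedH10 U u ∧
      (∀ᵐ x ∂(volume.restrict U), (u x).im = 0 ∧ 0 < (u x).re) ∧
      hartree U v N u = ε ∧
      IsLeast {E : ℝ | ∃ ψ, IsNormalizedH10 U ψ ∧ hartree U v N ψ = E} ε ∧
      0 ≤ ε ∧
      (∀ w, IsNormalizedH10 U w → hartree U v N w = ε →
        ∃ c : ℂ, ‖c‖ = 1 ∧ w =ᵐ[volume.restrict U] fun x => c * u x) ∧
      MeanFieldOp A U v N (U.indicator u) u (fun x => (ε : ℂ) * u x) ∧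
      IsLeast {E : ℝ | ∃ ψ, IsNormalizedH10 U ψ ∧
        (meanFieldForm A U v N (U.indicator u) ψ ψ).re = E} ε ∧
      (∀ w, IsNormalizedH10 U w →
        MeanFieldOp A U v N (U.indicator u) w (fun x => (ε : ℂ) * w x) →
        ∃ c : ℂ, ‖c‖ = 1 ∧ w =ᵐ[volume.restrict U] fun x => c * u x) := by
  obtain ⟨w, hw, hvw⟩ := hv.exists_posKernel
  have hc : 0 ≤ ((N : ℝ) - 1) / 2 := by
    have : (1 : ℝ) ≤ N := by exact_mod_cast hN
    linarith
  have hform := fun u : SobolevPair U => @meanFieldForm_eq d U v w hU A hA hw hvw N u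
  have hhart := @hartree_eq d U v w hU hw hvw N
  set c : ℝ := ((N : ℝ) - 1) / 2
  obtain ⟨u, hu, hu1, hu0, hmin⟩ := exists_hartree_minimizer hU hne hUf hw hc
  set ε := hartreeEnergy w c u with hε
  set V := meanFieldPotential w c u ε with hVdef
  have hV : IsBddPotential U V := isBddPotential_meanField hw c u ε
  have hpos : ∀ p ∈ sobolev U, 0 ≤ schrodingerEnergy V p := fun p hp =>
    meanField_energy_nonneg hUf hw hu hu1 hmin hp
  have hnull : schrodingerEnergy V u = 0 := meanField_energy_self hw c hu1
  have hne0 : ∀ᵐ x ∂(volume.restrict U), u.fst x ≠ 0 := by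
    refine (null_vector_eq_zero_or_pos hU hUc hUf hV hpos hu hu0 hnull).resolve_left fun h => ?_
    have : u.fst = 0 := (Lp.eq_zero_iff_ae_eq_zero).2 h
    rw [this, norm_zero] at hu1
    exact zero_ne_one hu1
  have hN1 : IsNormalizedH10 U u.fst := (isNormalizedH10_iff hU).2 ⟨u, hu, ae_eq_refl _, hu1⟩
  have huniq : ∀ q ∈ sobolev U, ‖q.fst‖ = 1 → schrodingerEnergy V q = 0 →
      ∀ ψ : EuclideanSpace ℝ (Fin d) → ℂ, q.fst =ᵐ[volume.restrict U] ψ →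
      ∃ c : ℂ, ‖c‖ = 1 ∧ ψ =ᵐ[volume.restrict U] fun x => c * u.fst x := by
    intro q hq hq1 hq0 ψ hψ
    obtain ⟨a, ha⟩ := null_vector_eq_smul hU hUc hUf hV hpos hu hq (hu0.and hne0) hu1 hnull hq0
    exact ⟨a, norm_eq_one_of_ae_eq_const_mul hu1 hq1 ha, hψ.symm.trans ha⟩
  have hself : ∀ q ∈ sobolev U, ‖q.fst‖ = 1 → ∀ ψ : EuclideanSpace ℝ (Fin d) → ℂ,
      q.fst =ᵐ[volume.restrict U] ψ →
      meanFieldForm A U v N (U.indicator u.fst) ψ ψ = ((schrodingerEnergy V q + ε : ℝ) : ℂ) := by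
    intro q hq hq1 ψ hψ
    have h1 : ∫ x in U, conj (ψ x) * ψ x = 1 := by
      have h2 := inner_self_eq_norm_sq_to_K (𝕜 := ℂ) q.fst
      rw [hq1, L2.inner_def] at h2
      simp only [RCLike.inner_apply', RCLike.ofReal_one, one_pow] at h2
      rw [← h2]
      refine integral_congr_ae ?_
      filter_upwards [hψ] with x hx
      rw [hx]
    rw [hform u ε hq hq hψ hψ, h1, schrodingerForm_self]
    push_cast
    ring
  refine ⟨u.fst, ε, hN1, ?_, hhart hu (ae_eq_refl _), ⟨⟨_, hN1, hhart hu (ae_eq_refl _)⟩, ?_⟩,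
    hartreeEnergy_nonneg hw hc u, ?_, ⟨hN1.1, (Lp.memLp u.fst).const_mul _, ?_⟩,
    ⟨⟨_, hN1, ?_⟩, ?_⟩, ?_⟩
  · filter_upwards [hu0, hne0] with x h1 h2
    rw [h1]
    exact ⟨Complex.ofReal_im _, by simpa using h2⟩
  · rintro _ ⟨ψ, hψ, rfl⟩
    obtain ⟨p, hp, hpψ, hp1⟩ := (isNormalizedH10_iff hU).1 hψ
    rw [hhart hp hpψ]
    exact hmin p hp hp1
  · intro ψ hψ hE
    obtain ⟨p, hp, hpψ, hp1⟩ := (isNormalizedH10_iff hU).1 hψ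
    rw [hhart hp hpψ] at hE
    refine huniq p hp hp1 (le_antisymm ?_ (hpos p hp)) ψ hpψ
    -- For a minimiser the right side is zero, so it is a null vector of the nonnegative shifted
    -- form.
    have := meanField_energy_le_hartree hw hc u p hp1 ε
    rwa [hE, sub_self] at this
  · intro φ hφ
    obtain ⟨p, hp, hpφ⟩ := (memH10_iff hU).1 hφ
    -- The eigenvalue equation in the form sense: the null vector `u` has zero pairing with every
    -- form-domain vector.
    rw [hform u ε hp hu hpφ (ae_eq_refl _), hV.form_eq_zero hpos hp hu hnull, zero_add,
      ← integral_const_mul]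
    congr 1 with x
    ring
  · rw [hself u hu hu1 _ (ae_eq_refl _), hnull, zero_add, Complex.ofReal_re]
  · rintro _ ⟨ψ, hψ, rfl⟩
    obtain ⟨p, hp, hpψ, hp1⟩ := (isNormalizedH10_iff hU).1 hψ
    rw [hself p hp hp1 ψ hpψ, Complex.ofReal_re]
    linarith [hpos p hp]
  · rintro ψ hψ ⟨hψ1, -, hψ2⟩
    obtain ⟨p, hp, hpψ, hp1⟩ := (isNormalizedH10_iff hU).1 hψ
    refine huniq p hp hp1 ?_ ψ hpψ
    -- Testing the eigenvalue equation with the eigenfunction itself shows that it is a null vector.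
    have h := hψ2 ψ hψ1
    rw [hform u ε hp hp hpψ hpψ, schrodingerForm_self, ← integral_const_mul] at h
    have h2 : ∫ x in U, (ε : ℂ) * (conj (ψ x) * ψ x) = ∫ x in U, conj (ψ x) * ((ε : ℂ) * ψ x) := by
      congr 1 with x
      ring
    rw [h2, add_eq_right] at h
    exact_mod_cast h

/-! ### The vacancy set -/

theorem isOpen_box (d : ℕ) (ρ : ℝ) (N : ℕ) : IsOpen (box d ρ N) := by
  simp only [box, ofPred_forall]
  exact isOpen_iInter_of_finite fun i => isOpen_Ioo.preimage (by fun_prop)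

theorem isBounded_box (d : ℕ) (ρ : ℝ) (N : ℕ) : Bornology.IsBounded (box d ρ N) := by
  have h : Bornology.IsBounded (Set.univ.pi fun _ : Fin d =>
      Ioo (-(sideLength d ρ N / 2)) (sideLength d ρ N / 2)) :=
    Bornology.IsBounded.pi fun _ => Metric.isBounded_Ioo _ _
  refine ((PiLp.antilipschitzWith_ofLp 2 (fun _ : Fin d => ℝ)).isBounded_preimage h).subset ?_
  intro x hx i _
  exact hx i

/-- The family is locally finite: a ball of radius `1` about `x` meets only those closed balls whose
centres lie within `r + 1` of `x`. -/
theorem isClosed_biUnion_closedBall {E : Type*} [MetricSpace E] {S : Set E}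
    (hS : ∀ B : Set E, Bornology.IsBounded B → (S ∩ B).Finite) (r : ℝ) :
    IsClosed (⋃ x ∈ S, Metric.closedBall x r) := by
  rw [biUnion_eq_iUnion]
  refine LocallyFinite.isClosed_iUnion (fun x => ?_) fun _ => Metric.isClosed_closedBall
  refine ⟨Metric.ball x 1, Metric.ball_mem_nhds x one_pos, ?_⟩
  refine Finite.of_finite_image (f := Subtype.val) ((hS (Metric.closedBall x (r + 1))
    Metric.isBounded_closedBall).subset ?_) Subtype.val_injective.injOn
  rintro _ ⟨⟨y, hy⟩, ⟨z, hz1, hz2⟩, rfl⟩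
  refine ⟨hy, ?_⟩
  rw [Metric.mem_closedBall] at hz1 ⊢
  rw [Metric.mem_ball] at hz2
  linarith [dist_triangle y z x, dist_comm y z]

theorem isOpen_vacancySet {d : ℕ} {S : Set (EuclideanSpace ℝ (Fin d))}
    (hS : ∀ B : Set (EuclideanSpace ℝ (Fin d)), Bornology.IsBounded B → (S ∩ B).Finite)
    (ρ r : ℝ) (N : ℕ) : IsOpen (vacancySet ρ r N S) :=
  (isOpen_box d ρ N).sdiff (isClosed_biUnion_closedBall hS r)

theorem mainTheorem3 {Ω : Type*} [MeasurableSpace Ω] (P : Measure Ω) [IsProbabilityMeasure P]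
    (d : ℕ) (hd : 2 ≤ d) (ρ r ν : ℝ) (hρ : 0 < ρ) (hr : 0 < r) (hν : 0 < ν)
    (X : Ω → Set (EuclideanSpace ℝ (Fin d))) (hX : IsPoissonProcess P X ν)
    (N : ℕ) (hN : 1 ≤ N)
    (v : EuclideanSpace ℝ (Fin d) → ℝ) (hv : IsInteraction v)
    (η : ℝ) (hη : 0 < η) (hη' : η < vacancyFraction d ν r)
    (ω : Ω) (hω : ω ∈ volumeEvent X ρ r ν N η)
    (U : Set (EuclideanSpace ℝ (Fin d))) (hU : IsComponentOf (vacancySet ρ r N (X ω)) U) :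
    ∃ (u : EuclideanSpace ℝ (Fin d) → ℂ) (ε : ℝ),
      -- `u` is normalized and (real and) positive
      IsNormalizedH10 U u ∧
      (∀ᵐ x ∂(volume.restrict U), (u x).im = 0 ∧ 0 < (u x).re) ∧
      -- `u` minimizes the Hartree functional, with minimum `ε`
      hartree U v N u = ε ∧
      IsLeast {E : ℝ | ∃ ψ, IsNormalizedH10 U ψ ∧ hartree U v N ψ = E} ε ∧
      0 ≤ ε ∧
      -- every minimizer is `u` up to a phase
      (∀ w, IsNormalizedH10 U w → hartree U v N w = ε →
        ∃ c : ℂ, ‖c‖ = 1 ∧ w =ᵐ[volume.restrict U] fun x => c * u x) ∧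
      -- `u` (extended by zero) is the ground state of its mean-field operator, with energy `ε`
      MeanFieldOp (vacancySet ρ r N (X ω)) U v N (U.indicator u) u (fun x => (ε : ℂ) * u x) ∧
      IsLeast {E : ℝ | ∃ ψ, IsNormalizedH10 U ψ ∧
        (meanFieldForm (vacancySet ρ r N (X ω)) U v N (U.indicator u) ψ ψ).re = E} ε ∧
      -- the ground state of the mean-field operator is unique up to a phase
      (∀ w, IsNormalizedH10 U w →
        MeanFieldOp (vacancySet ρ r N (X ω)) U v N (U.indicator u) w
          (fun x => (ε : ℂ) * w x) →
        ∃ c : ℂ, ‖c‖ = 1 ∧ w =ᵐ[volume.restrict U] fun x => c * u x) := by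
  obtain ⟨x, hx, rfl⟩ := hU
  have hsub := connectedComponentIn_subset (vacancySet ρ r N (X ω)) x
  exact exists_hartree_ground_state (isOpen_vacancySet (hX.locallyFinite ω) ρ r N).connectedComponentIn
    isPreconnected_connectedComponentIn ⟨x, mem_connectedComponentIn hx⟩
    (((isBounded_box d ρ N).subset (hsub.trans sdiff_subset)).measure_lt_top).ne hsub hv hN
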